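/- \textbf{Theorem.} For a sequence $(a_n)_{n\ge 0}$ of positive integers let $[0;a_0,a_1,\dots]$ denote the corresponding infinite continued fraction. For $\theta=(a_n)_{n\in\mathbb Z}\in(\mathbb N^*)^{\mathbb Z}$ put $f(\theta)=[a_0;a_1,a_2,\dots]+[0;a_{-1},a_{-2},\dots]$ and $m(\theta)=\sup_{n\in\mathbb Z} f(\sigma^n\theta)\in(0,\infty]$, where $\sigma$ is the left shift, and for real $t$ let $\Sigma_t=\{\theta: m(\theta)\le t\}$ and $K_t^+=\{[0;a_0,a_1,\dots]:(a_n)_{n\in\mathbb Z}\in\Sigma_t\}$. Let $$\Delta^+(t)=\limsup_{r\to 0^+}\frac{\log N_{K_t^+}(r)}{\log(1/r)}$$ be the (upper) box-counting dimension of $K_t^+$, where $N_X(r)$ is the least number of intervals of length at most $r$ needed to cover $X$. Let $HD$ denote Hausdorff dimension and let $d(t)=HD(L\cap(-\infty,t))$, where $L=\{\ell(\alpha):\alpha\in\mathbb R\setminus\mathbb Q,\ \ell(\alpha)<\infty\}$, $\ell(\alpha)=\limsup_{q\to\infty,\,p\in\mathbb Z}\frac{1}{|q(q\alpha-p)|}$,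 is the Lagrange spectrum. For a finite set $B$ of at least two nonempty finite words of positive integers, none of which begins by another one, let $\Sigma(B)\subset(\mathbb N^*)^{\mathbb Z}$ be the set of all bi-infinite concatenations $\dots\gamma_{-1}\gamma_0\gamma_1\dots$ with $\gamma_i\in B$ for all $i$ ($\gamma_0$ starting at position $0$), and let $K(B)=\{[0;\gamma_0,\gamma_1,\gamma_2,\dots]:\gamma_i\in B\ \forall i\}$ be the associated Gauss--Cantor set. Let $\eta>0$ and $3\le t<5$ with $d(t)>0$. Then there are $\delta>0$ and such a set of words $B$ with $\Sigma(B)\subset\{1,2,3,4\}^{\mathbb Z}$, $$\Sigma(B)\subset\Sigma_{t-\delta}\quad\text{and}\quad HD(K(B))\ge(1-\eta)\,\Delta^+(t).$$ -/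

import Mathlib

open Filter Topology

namespace GaussCantor

noncomputable section

/-- The finite continued fraction `[0; a 0, a 1, …, a (n-1)]`. -/
def cfConv : ℕ → (ℕ → ℕ+) → ℝ
  | 0, _ => 0
  | n + 1, a => 1 / (((a 0 : ℕ) : ℝ) + cfConv n (fun k => a (k + 1)))

/-- The infinite continued fraction `[0; a 0, a 1, a 2, …]`, the limit of its convergents
(the limit always exists, see `tendsto_cfConv`). -/
def cfVal (a : ℕ → ℕ+) : ℝ :=
  limUnder atTop (fun n => cfConv n a)

theorem cfConv_mem (n : ℕ) (a : ℕ → ℕ+) : 0 ≤ cfConv n a ∧ cfConv n a ≤ 1 := by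
  induction n generalizing a with
  | zero => simp [cfConv]
  | succ n ih =>
    have h := (ih (fun k => a (k + 1))).1
    have h1 : (1 : ℝ) ≤ ((a 0 : ℕ) : ℝ) := by exact_mod_cast (a 0).pos
    constructor
    · simp only [cfConv]; positivity
    · simp only [cfConv]
      rw [div_le_one (by linarith)]
      linarith

theorem abs_cfConv_sub_le (n k : ℕ) (a : ℕ → ℕ+) :
    |cfConv (n + k) a - cfConv n a| ≤ 1 / ((n : ℝ) + 1) := by
  induction n generalizing a with
  | zero =>
    have h := cfConv_mem k a
    simp only [zero_add, cfConv, sub_zero, abs_of_nonneg h.1]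
    simpa using h.2
  | succ n ih =>
    have h := ih (fun j => a (j + 1))
    have hx := cfConv_mem (n + k) (fun j => a (j + 1))
    have hy := cfConv_mem n (fun j => a (j + 1))
    have h1 : (1 : ℝ) ≤ ((a 0 : ℕ) : ℝ) := by exact_mod_cast (a 0).pos
    rw [show n + 1 + k = (n + k) + 1 by ring]
    simp only [cfConv]
    generalize cfConv (n + k) (fun j => a (j + 1)) = x at *
    generalize cfConv n (fun j => a (j + 1)) = y at *
    generalize ((a 0 : ℕ) : ℝ) = c at *
    have hn : (0 : ℝ) ≤ n := Nat.cast_nonneg n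
    have hcx : 0 < c + x := by linarith
    have hcy : 0 < c + y := by linarith
    have e : 1 / (c + x) - 1 / (c + y) = (y - x) / ((c + x) * (c + y)) := by
      field_simp
      ring
    rw [e, abs_div, abs_of_pos (mul_pos hcx hcy), abs_sub_comm y x]
    rw [le_div_iff₀ (by positivity)] at h
    push_cast
    rw [div_le_div_iff₀ (mul_pos hcx hcy) (by positivity)]
    have hle : |x - y| ≤ x + y := by
      rw [abs_le]; constructor <;> linarith
    have hprod : 1 + x + y ≤ (c + x) * (c + y) := by
      nlinarith [mul_nonneg hx.1 hy.1]
    nlinarith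

theorem tendsto_cfConv (a : ℕ → ℕ+) :
    Tendsto (fun n => cfConv n a) atTop (𝓝 (cfVal a)) := by
  refine CauchySeq.tendsto_limUnder (cauchySeq_of_le_tendsto_0'
    (fun n : ℕ => 1 / ((n : ℝ) + 1)) ?_ tendsto_one_div_add_atTop_nhds_zero_nat)
  intro n m hnm
  obtain ⟨k, rfl⟩ := Nat.exists_eq_add_of_le hnm
  rw [dist_comm, Real.dist_eq]
  exact abs_cfConv_sub_le n k a

/-- The best constant of Diophantine approximation of `α`: the upper limit of
`1 / |q (q α - p)|` over integers `p` and denominators `q → ∞`. -/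
def bestConst (α : ℝ) : EReal :=
  limsup (fun x : ℤ × ℕ => ((1 / |(x.2 : ℝ) * ((x.2 : ℝ) * α - (x.1 : ℝ))| : ℝ) : EReal))
    (comap Prod.snd atTop)

/-- The Lagrange spectrum: the finite best constants of irrational numbers. -/
def lagrangeSpectrum : Set ℝ :=
  {x | ∃ α : ℝ, Irrational α ∧ bestConst α = (x : EReal)}

/-- `d(t)`, the Hausdorff dimension of the part of the Lagrange spectrum below `t`. -/
def dimLagrange (t : ℝ) : ENNReal :=
  dimH (lagrangeSpectrum ∩ Set.Iio t)

/-- The height `[a₀; a₁, a₂, …] + [0; a₋₁, a₋₂, …]` of a bi-infinite sequence. -/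
def height (θ : ℤ → ℕ+) : ℝ :=
  (((θ 0 : ℕ) : ℝ) + cfVal (fun n : ℕ => θ ((n : ℤ) + 1))) +
    cfVal (fun n : ℕ => θ (-((n : ℤ) + 1)))

/-- The Markov value `m(θ)`: the supremum of the height along the orbit of `θ` under the shift. -/
def markovValue (θ : ℤ → ℕ+) : EReal :=
  ⨆ n : ℤ, (height (fun k => θ (k + n)) : EReal)

/-- `Σ_t`, the sequences of Markov value at most `t`. -/
def sigmaLe (t : ℝ) : Set (ℤ → ℕ+) :=
  {θ | markovValue θ ≤ (t : EReal)}

/-- The set of all `[0; θ₀, θ₁, θ₂, …]` with `θ` in `S`: the projection of `S` to the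
nonnegative coordinates, read as continued fractions. -/
def cfProj (S : Set (ℤ → ℕ+)) : Set ℝ :=
  (fun θ : ℤ → ℕ+ => cfVal (fun n : ℕ => θ (n : ℤ))) '' S

/-- `N_X(r)`: the least number of intervals of length at most `r` needed to cover `X`
(they may be enlarged to have length exactly `r`); it is `⊤` if finitely many do not suffice. -/
def boxCount (X : Set ℝ) (r : ℝ) : ℕ∞ :=
  ⨅ (s : Finset ℝ) (_ : X ⊆ ⋃ a ∈ s, Set.Icc a (a + r)), (s.card : ℕ∞)

/-- The (upper) box-counting dimension of a set of reals. -/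
def boxDim (X : Set ℝ) : EReal :=
  limsup (fun r : ℝ => ENNReal.log (boxCount X r : ENNReal) / ((Real.log (1 / r) : ℝ) : EReal))
    (𝓝[>] 0)

/-- `Δ⁺(t)`, the box-counting dimension of the projection of `Σ_t`. -/
def deltaPlus (t : ℝ) : EReal :=
  boxDim (cfProj (sigmaLe t))

/-- The alphabets of Gauss–Cantor sets: at least two nonempty finite words of positive
integers, none of which begins by another one. -/
structure IsAlphabet (B : Finset (List ℕ+)) : Prop where
  two_le_card : 2 ≤ B.card
  ne_nil : ∀ β ∈ B, β ≠ []
  prefix_free : ∀ β ∈ B, ∀ γ ∈ B, β ≠ γ → ¬ γ <+: β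

/-- `Σ(B)`: the bi-infinite concatenations `… γ₋₁ γ₀ γ₁ …` of words of `B`, the word `γ i`
occupying the positions `c i, …, c (i + 1) - 1` and `γ 0` starting at position `0`. -/
def completeShift (B : Finset (List ℕ+)) : Set (ℤ → ℕ+) :=
  {θ | ∃ (γ : ℤ → List ℕ+) (c : ℤ → ℤ), (∀ i, γ i ∈ B) ∧ c 0 = 0 ∧
    (∀ i, c (i + 1) = c i + ((γ i).length : ℤ)) ∧
    ∀ (i : ℤ) (k : ℕ) (hk : k < (γ i).length), θ (c i + (k : ℤ)) = (γ i)[k]}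

/-- `K(B)`: the numbers `[0; γ₀, γ₁, γ₂, …]` with all `γ i` in `B`. -/
def gaussCantorSet (B : Finset (List ℕ+)) : Set ℝ :=
  cfProj (completeShift B)

end

end GaussCantor

/-! Write D for Δ⁺(t). Positivity of d(t) forces D > 0: a Lagrange value x < t is the height of a
bi-infinite sequence of Markov value at most x, hence has the form a + u + v with a ≤ 4 and u, v in
K_t⁺ (the left half by reflection), so box dimension zero of K_t⁺ would give d(t) = 0
(`dimLagrange_eq_zero`).

Sequences of Σ_t are cut into blocks, words whose continuant lies between R and 5R. Fixing k blocks
confines the continued fraction to an interval of length at most R^(-2k). Hence there are at most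
about R^(2D) blocks, while for suitable large k almost R^(2Dk) words of k blocks occur in Σ_t:
nearly as many as the number of blocks permits. Such a set of words must branch almost everywhere. A
position is good if, everything on one side of it being kept, its block can be replaced within the
set both by a smaller and by a greater one in the order of continued fractions. Among the blocks
possible at a place, only extreme ones of each length are bad, that is O(log R) of them, so words
with many bad positions are rare (`card_bad_right_mul_le`, `card_bad_left_mul_le`).

A pigeonhole over the pairs of consecutive blocks (`card_image_drop_le`, `exists_loop`) then yields
blocks a, b and positions p < q such that more than V^(q-p) different words b m a run from one good
pair (a, b) at p to another at q, with log V close to 2D log R. These words form B. They consist of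
equally many blocks, so none begins by another one; their continuants are at most (10R)^(q-p), so
`le_dimH_gaussCantorSet` gives a dimension close to D.

The Markov value drops for the following reason. Each place of a sequence of Σ(B) lies in some b m
a, and this word is surrounded as a b m a b. Goodness allows the replacement of an outer a or b on
the side where it is closer, closeness being measured by continuants. The height would then increase
by at least 1/(500 g²), g being the continuant of the word from the place to the replaced block, and
the other side is known so much further that the error is at most half of that. The modified word
occurs in Σ_t, where heights are at most t; so the original height lies below t by a definite amount
(`heightAt_le_of_goodLoop`), uniformly because B is finite. -/

namespace GaussCantor

noncomputable section

/-! ### Continuants -/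

/-- The product of the matrices `!![a, 1; 1, 0]` along a word. -/
def contMat : List ℕ+ → Matrix (Fin 2) (Fin 2) ℕ
  | [] => 1
  | a :: w => !![(a : ℕ), 1; 1, 0] * contMat w

/-- The continuant of a word: the denominator of `[0; w]`. -/
def continuant (w : List ℕ+) : ℕ := contMat w 0 0

theorem contMat_append (u v : List ℕ+) : contMat (u ++ v) = contMat u * contMat v := by
  induction u with
  | nil => simp [contMat]
  | cons a u ih => simp [contMat, ih]

theorem contMat_reverse (u : List ℕ+) : contMat u.reverse = (contMat u).transpose := by
  induction u with
  | nil => simp [contMat]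
  | cons a u ih =>
    rw [List.reverse_cons, contMat_append, ih]
    simp only [contMat, Matrix.transpose_mul, mul_one]
    congr 1
    ext i j
    fin_cases i <;> fin_cases j <;> rfl

theorem continuant_reverse (u : List ℕ+) : continuant u.reverse = continuant u := by
  simp [continuant, contMat_reverse]

theorem contMat_cons_apply (a : ℕ+) (w : List ℕ+) (j : Fin 2) :
    contMat (a :: w) 0 j = a * contMat w 0 j + contMat w 1 j ∧
      contMat (a :: w) 1 j = contMat w 0 j := by
  simp [contMat, Matrix.mul_apply, Fin.sum_univ_two]

theorem contMat_row_le (w : List ℕ+) : contMat w 1 0 ≤ contMat w 0 0 := by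
  induction w with
  | nil => simp [contMat]
  | cons a w ih =>
    rw [(contMat_cons_apply a w 0).1, (contMat_cons_apply a w 0).2]
    nlinarith [a.pos]

theorem contMat_col_le (w : List ℕ+) : contMat w 0 1 ≤ contMat w 0 0 := by
  have := contMat_row_le w.reverse
  simpa [contMat_reverse] using this

theorem continuant_pos (w : List ℕ+) : 0 < continuant w := by
  induction w with
  | nil => simp [continuant, contMat]
  | cons a w ih =>
    rw [continuant, (contMat_cons_apply a w 0).1]
    have := Nat.mul_pos a.pos ih
    unfold continuant at this
    omega

@[simp] theorem continuant_nil : continuant [] = 1 := by simp [continuant, contMat]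

theorem continuant_append (u v : List ℕ+) :
    continuant (u ++ v) = continuant u * continuant v + contMat u 0 1 * contMat v 1 0 := by
  simp [continuant, contMat_append, Matrix.mul_apply, Fin.sum_univ_two]

/-- The cross term lies between 0 and the main product, because the corner entry dominates its row
and its column. Continuants are thus multiplicative up to a factor 2 per concatenation. -/
theorem continuant_mul_le (u v : List ℕ+) :
    continuant u * continuant v ≤ continuant (u ++ v) := by
  rw [continuant_append]; omega

theorem continuant_append_le (u v : List ℕ+) :
    continuant (u ++ v) ≤ 2 * (continuant u * continuant v) := by
  rw [continuant_append]
  have := Nat.mul_le_mul (contMat_col_le u) (contMat_row_le v)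
  unfold continuant
  omega

theorem continuant_le_append_right (u v : List ℕ+) : continuant u ≤ continuant (u ++ v) :=
  (Nat.le_mul_of_pos_right _ (continuant_pos v)).trans (continuant_mul_le u v)

theorem continuant_le_append_left (u v : List ℕ+) : continuant v ≤ continuant (u ++ v) :=
  (Nat.le_mul_of_pos_left _ (continuant_pos u)).trans (continuant_mul_le u v)

theorem continuant_append_singleton_le (u : List ℕ+) (a : ℕ+) :
    continuant (u ++ [a]) ≤ (a + 1) * continuant u := by
  rw [continuant_append]
  have h := contMat_col_le u
  simp only [continuant, contMat, mul_one] at *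
  simp
  nlinarith

/-- Two further letters at least double the continuant. This makes block lengths logarithmic in the
size and gives the convergence rates below. -/
theorem two_pow_length_le (w : List ℕ+) : 2 ^ w.length ≤ 2 * continuant w ^ 2 := by
  match w with
  | [] => simp
  | [a] =>
    have := continuant_pos [a]
    simp only [List.length_singleton]
    nlinarith
  | a :: b :: w =>
    have ih := two_pow_length_le w
    have h : 2 * continuant w ≤ continuant (a :: b :: w) := by
      unfold continuant
      rw [(contMat_cons_apply a _ 0).1, (contMat_cons_apply b _ 0).1, (contMat_cons_apply b _ 0).2]
      have h1 := Nat.mul_le_mul a.pos (Nat.mul_le_mul b.pos (le_refl (contMat w 0 0)))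
      nlinarith [Nat.zero_le (a * contMat w 1 0)]
    simp only [List.length_cons, pow_succ] at *
    nlinarith

/-- The determinant of `contMat w` is `± 1`. -/
theorem contMat_coprime (w : List ℕ+) : Nat.Coprime (contMat w 0 0) (contMat w 1 0) := by
  induction w with
  | nil => simp [contMat]
  | cons a w ih =>
    rw [(contMat_cons_apply a w 0).1, (contMat_cons_apply a w 0).2]
    rw [Nat.coprime_mul_right_add_left]
    exact ih.symm

/-! ### Continued fractions with a given beginning -/

/-- `[0; w₀, …, wₙ₋₁ + x]`. -/
def cfApp : List ℕ+ → ℝ → ℝ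
  | [], x => x
  | a :: w, x => 1 / (((a : ℕ) : ℝ) + cfApp w x)

theorem cfApp_append (u v : List ℕ+) (x : ℝ) : cfApp (u ++ v) x = cfApp u (cfApp v x) := by
  induction u with
  | nil => rfl
  | cons a u ih => simp [cfApp, ih]

theorem cfApp_mem (w : List ℕ+) {x : ℝ} (hx : 0 ≤ x) (hx1 : x ≤ 1) :
    0 ≤ cfApp w x ∧ cfApp w x ≤ 1 := by
  induction w with
  | nil => exact ⟨hx, hx1⟩
  | cons a w ih =>
    have h1 : (1 : ℝ) ≤ ((a : ℕ) : ℝ) := by exact_mod_cast a.pos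
    simp only [cfApp]
    refine ⟨by have := ih.1; positivity, ?_⟩
    rw [div_le_one (by linarith)]
    linarith

/-- The Möbius action of `contMat w`, cleared of its denominator. -/
theorem cfApp_eq (w : List ℕ+) {x : ℝ} (hx : 0 ≤ x) :
    cfApp w x * ((contMat w 0 0 : ℝ) + contMat w 0 1 * x) =
      (contMat w 1 0 : ℝ) + contMat w 1 1 * x := by
  induction w with
  | nil => simp [cfApp, contMat]
  | cons a w ih =>
    have h00 : (0 : ℝ) < contMat w 0 0 := by exact_mod_cast continuant_pos w
    have hD : 0 < (contMat w 0 0 : ℝ) + contMat w 0 1 * x := by positivity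
    -- Here x may exceed 1, so nonnegativity is read off the induction hypothesis and not from
    -- `cfApp_mem`.
    have hpos : 0 ≤ cfApp w x := by
      by_contra hneg
      have : cfApp w x * ((contMat w 0 0 : ℝ) + contMat w 0 1 * x) < 0 :=
        mul_neg_of_neg_of_pos (not_le.1 hneg) hD
      have h2 : (0 : ℝ) ≤ (contMat w 1 0 : ℝ) + contMat w 1 1 * x := by positivity
      linarith
    have h1 : (1 : ℝ) ≤ ((a : ℕ) : ℝ) := by exact_mod_cast a.pos
    rw [(contMat_cons_apply a w 0).1, (contMat_cons_apply a w 1).1, (contMat_cons_apply a w 0).2,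
      (contMat_cons_apply a w 1).2]
    simp only [cfApp]
    push_cast
    have hne : ((a : ℕ) : ℝ) + cfApp w x ≠ 0 := by positivity
    field_simp
    linear_combination -ih

/-- The exact distance between two numbers with a common beginning. -/
theorem cfApp_sub_cfApp (w : List ℕ+) {x y : ℝ} (hx : 0 ≤ x) (hx1 : x ≤ 1) (hy : 0 ≤ y)
    (hy1 : y ≤ 1) :
    (cfApp w x - cfApp w y) * (((contMat w 0 0 : ℝ) + contMat w 0 1 * x) *
      ((contMat w 0 0 : ℝ) + contMat w 0 1 * y)) = (-1) ^ w.length * (x - y) := by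
  induction w with
  | nil => simp [cfApp, contMat]
  | cons a w ih =>
    have h1 : (1 : ℝ) ≤ ((a : ℕ) : ℝ) := by exact_mod_cast a.pos
    have hX := cfApp_mem w hx hx1
    have hY := cfApp_mem w hy hy1
    have ex := cfApp_eq w hx
    have ey := cfApp_eq w hy
    rw [(contMat_cons_apply a w 0).1, (contMat_cons_apply a w 1).1]
    simp only [cfApp, List.length_cons, pow_succ]
    push_cast
    have hnx : ((a : ℕ) : ℝ) + cfApp w x ≠ 0 := by linarith
    have hny : ((a : ℕ) : ℝ) + cfApp w y ≠ 0 := by linarith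
    have e1 : ((a : ℕ) : ℝ) * contMat w 0 0 + contMat w 1 0 +
        (((a : ℕ) : ℝ) * contMat w 0 1 + contMat w 1 1) * x =
        (((a : ℕ) : ℝ) + cfApp w x) * ((contMat w 0 0 : ℝ) + contMat w 0 1 * x) := by
      linear_combination -ex
    have e2 : ((a : ℕ) : ℝ) * contMat w 0 0 + contMat w 1 0 +
        (((a : ℕ) : ℝ) * contMat w 0 1 + contMat w 1 1) * y =
        (((a : ℕ) : ℝ) + cfApp w y) * ((contMat w 0 0 : ℝ) + contMat w 0 1 * y) := by
      linear_combination -ey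
    rw [e1, e2]
    field_simp
    linear_combination -ih

/-- In `cfApp_sub_cfApp` this makes the contraction by a word q⁻² up to a factor 4, whatever the
tails. -/
theorem contMat_den_bounds (w : List ℕ+) {x : ℝ} (hx : 0 ≤ x) (hx1 : x ≤ 1) :
    (continuant w : ℝ) ≤ (contMat w 0 0 : ℝ) + contMat w 0 1 * x ∧
      (contMat w 0 0 : ℝ) + contMat w 0 1 * x ≤ 2 * continuant w := by
  have h : (contMat w 0 1 : ℝ) ≤ continuant w := by exact_mod_cast contMat_col_le w
  have h0 : (0 : ℝ) ≤ contMat w 0 1 := by positivity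
  have e : (contMat w 0 0 : ℝ) = continuant w := rfl
  rw [e]
  constructor <;> nlinarith

theorem abs_cfApp_sub_le (w : List ℕ+) {x y : ℝ} (hx : 0 ≤ x) (hx1 : x ≤ 1) (hy : 0 ≤ y)
    (hy1 : y ≤ 1) : |cfApp w x - cfApp w y| ≤ |x - y| / (continuant w : ℝ) ^ 2 := by
  have hq : (0 : ℝ) < continuant w := by exact_mod_cast continuant_pos w
  have h := congrArg abs (cfApp_sub_cfApp w hx hx1 hy hy1)
  have bx := contMat_den_bounds w hx hx1
  have bys := contMat_den_bounds w hy hy1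
  rw [abs_mul, abs_mul ((-1) ^ _), abs_neg_one_pow, one_mul, abs_of_nonneg (a := _ * _)
    (mul_nonneg (hq.le.trans bx.1) (hq.le.trans bys.1))] at h
  rw [le_div_iff₀ (by positivity), ← h]
  have := mul_le_mul bx.1 bys.1 hq.le (hq.le.trans bx.1)
  rw [← sq] at this
  exact mul_le_mul_of_nonneg_left this (abs_nonneg _)

theorem le_abs_cfApp_sub (w : List ℕ+) {x y : ℝ} (hx : 0 ≤ x) (hx1 : x ≤ 1) (hy : 0 ≤ y)
    (hy1 : y ≤ 1) : |x - y| / (4 * (continuant w : ℝ) ^ 2) ≤ |cfApp w x - cfApp w y| := by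
  have hq : (0 : ℝ) < continuant w := by exact_mod_cast continuant_pos w
  have h := congrArg abs (cfApp_sub_cfApp w hx hx1 hy hy1)
  have bx := contMat_den_bounds w hx hx1
  have bys := contMat_den_bounds w hy hy1
  rw [abs_mul, abs_mul ((-1) ^ _), abs_neg_one_pow, one_mul, abs_of_nonneg (a := _ * _)
    (mul_nonneg (hq.le.trans bx.1) (hq.le.trans bys.1))] at h
  rw [div_le_iff₀ (by positivity), ← h]
  have := mul_le_mul bx.2 bys.2 (hq.le.trans bys.1) (by positivity)
  refine mul_le_mul_of_nonneg_left (this.trans (by nlinarith)) (abs_nonneg _)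

/-! ### Beginnings of sequences -/

/-- The word of the first `n` terms of a sequence. -/
def pre (a : ℕ → ℕ+) (n : ℕ) : List ℕ+ := (List.range n).map a

@[simp] theorem pre_length (a : ℕ → ℕ+) (n : ℕ) : (pre a n).length = n := by simp [pre]

@[simp] theorem pre_zero (a : ℕ → ℕ+) : pre a 0 = [] := rfl

theorem pre_succ (a : ℕ → ℕ+) (n : ℕ) : pre a (n + 1) = pre a n ++ [a n] := by
  simp [pre, List.range_succ]

theorem pre_succ' (a : ℕ → ℕ+) (n : ℕ) : pre a (n + 1) = a 0 :: pre (fun k => a (k + 1)) n := by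
  simp [pre, List.range_succ_eq_map, Function.comp_def]

theorem pre_add (a : ℕ → ℕ+) (m n : ℕ) : pre a (m + n) = pre a m ++ pre (fun k => a (k + m)) n := by
  simp [pre, List.range_add, Function.comp_def, add_comm]

theorem pre_congr {a b : ℕ → ℕ+} {n : ℕ} (h : ∀ i < n, a i = b i) : pre a n = pre b n := by
  unfold pre
  exact List.map_congr_left fun i hi => h i (List.mem_range.1 hi)

@[simp] theorem pre_getElem (a : ℕ → ℕ+) (n i : ℕ) (h : i < (pre a n).length) :
    (pre a n)[i] = a i := by simp [pre]

theorem cfVal_eq (a : ℕ → ℕ+) :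
    cfVal a = 1 / (((a 0 : ℕ) : ℝ) + cfVal (fun k => a (k + 1))) := by
  have h1 := (tendsto_cfConv a).comp (tendsto_add_atTop_nat 1)
  have h2 := tendsto_cfConv (fun k => a (k + 1))
  have h0 : 0 ≤ cfVal (fun k => a (k + 1)) :=
    ge_of_tendsto' h2 fun n => (cfConv_mem n _).1
  have hpos : (1 : ℝ) ≤ ((a 0 : ℕ) : ℝ) := by exact_mod_cast (a 0).pos
  have h3 : Tendsto (fun n => 1 / (((a 0 : ℕ) : ℝ) + cfConv n (fun k => a (k + 1)))) atTop
      (𝓝 (1 / (((a 0 : ℕ) : ℝ) + cfVal (fun k => a (k + 1))))) :=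
    Tendsto.div tendsto_const_nhds (tendsto_const_nhds.add h2) (by linarith)
  exact tendsto_nhds_unique h1 h3

theorem cfVal_nonneg (a : ℕ → ℕ+) : 0 ≤ cfVal a :=
  ge_of_tendsto' (tendsto_cfConv a) fun n => (cfConv_mem n _).1

theorem cfVal_le_one (a : ℕ → ℕ+) : cfVal a ≤ 1 :=
  le_of_tendsto' (tendsto_cfConv a) fun n => (cfConv_mem n _).2

theorem cfVal_eq_cfApp (a : ℕ → ℕ+) (n : ℕ) :
    cfVal a = cfApp (pre a n) (cfVal (fun k => a (k + n))) := by
  induction n generalizing a with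
  | zero => simp [cfApp]
  | succ n ih =>
    rw [pre_succ', cfApp, cfVal_eq a, ih (fun k => a (k + 1))]
    simp only [add_assoc, add_comm n 1]

theorem inv_five_le_cfVal (a : ℕ → ℕ+) (h : a 0 ≤ 4) : 1 / 5 ≤ cfVal a := by
  rw [cfVal_eq]
  have h4 : ((a 0 : ℕ) : ℝ) ≤ 4 := by exact_mod_cast h
  have h1 : (1 : ℝ) ≤ ((a 0 : ℕ) : ℝ) := by exact_mod_cast (a 0).pos
  have := cfVal_le_one (fun k => a (k + 1))
  have := cfVal_nonneg (fun k => a (k + 1))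
  exact one_div_le_one_div_of_le (by linarith) (by linarith)

theorem abs_cfVal_sub_le {a b : ℕ → ℕ+} {n : ℕ} (h : ∀ i < n, a i = b i) :
    |cfVal a - cfVal b| ≤ 1 / (continuant (pre a n) : ℝ) ^ 2 := by
  rw [cfVal_eq_cfApp a n, cfVal_eq_cfApp b n, ← pre_congr h]
  refine (abs_cfApp_sub_le _ (cfVal_nonneg _) (cfVal_le_one _) (cfVal_nonneg _)
    (cfVal_le_one _)).trans ?_
  gcongr
  rw [abs_le]
  constructor <;>
  linarith [cfVal_nonneg (fun k => a (k + n)), cfVal_le_one (fun k => a (k + n)),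
    cfVal_nonneg (fun k => b (k + n)), cfVal_le_one (fun k => b (k + n))]

/-- The tails satisfy x ≤ 1 and y ≥ 1/5, so the denominators c + x and d + y differ by at least 1/5;
both are at most 5, whence (1/5)/(5·5). -/
theorem lt_cfVal_sub_of_head_lt {a b : ℕ → ℕ+} (ha : ∀ i, a i ≤ 4) (hb : ∀ i, b i ≤ 4)
    (h : a 0 < b 0) : 1 / 125 ≤ cfVal a - cfVal b := by
  rw [cfVal_eq a, cfVal_eq b]
  have h4 : ((a 0 : ℕ) : ℝ) ≤ 4 := by exact_mod_cast ha 0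
  have h4' : ((b 0 : ℕ) : ℝ) ≤ 4 := by exact_mod_cast hb 0
  have h1 : (1 : ℝ) ≤ ((a 0 : ℕ) : ℝ) := by exact_mod_cast (a 0).pos
  have h2 : ((a 0 : ℕ) : ℝ) + 1 ≤ ((b 0 : ℕ) : ℝ) := by
    have : (a 0 : ℕ) < b 0 := h
    exact_mod_cast this
  have hx := cfVal_le_one (fun k => a (k + 1))
  have hx0 := cfVal_nonneg (fun k => a (k + 1))
  have hy := cfVal_le_one (fun k => b (k + 1))
  have hy0 := inv_five_le_cfVal (fun k => b (k + 1)) (hb 1)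
  have aux : ∀ x y c d : ℝ, 0 ≤ x → x ≤ 1 → 1 / 5 ≤ y → y ≤ 1 → 1 ≤ c → c + 1 ≤ d → d ≤ 4 →
      1 / 125 ≤ 1 / (c + x) - 1 / (d + y) := by
    intro x y c d hx0 hx hy0 hy h1 h2 h4'
    have hc : 0 < c + x := by linarith
    have hd : 0 < d + y := by linarith
    rw [div_sub_div _ _ hc.ne' hd.ne', div_le_div_iff₀ (by norm_num) (by positivity)]
    have : (c + x) * (d + y) ≤ 5 * 5 := mul_le_mul (by linarith) (by linarith) hd.le (by norm_num)
    linarith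
  exact aux _ _ _ _ hx0 hx hy0 hy h1 h2 h4'

/-- At the first disagreement the tails are 1/125 apart, and the common beginning contracts by at
most 4q²; 500 = 4·125. Passing to the longer beginning only weakens the bound. -/
theorem le_abs_cfVal_sub {a b : ℕ → ℕ+} (ha : ∀ i, a i ≤ 4) (hb : ∀ i, b i ≤ 4) {n : ℕ}
    (h : ∃ i < n, a i ≠ b i) :
    1 / (500 * (continuant (pre a n) : ℝ) ^ 2) ≤ |cfVal a - cfVal b| := by
  classical
  obtain ⟨hi, hne⟩ := Nat.find_spec h
  set i := Nat.find h with hidef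
  have hmin : ∀ j < i, a j = b j := by
    intro j hj
    by_contra hc
    exact Nat.find_min h hj ⟨hj.trans hi, hc⟩
  have hle : continuant (pre a i) ≤ continuant (pre a n) := by
    have hsplit := pre_add a i (n - i)
    rw [Nat.add_sub_cancel' hi.le] at hsplit
    rw [hsplit]
    exact continuant_le_append_right _ _
  have hq : (0 : ℝ) < continuant (pre a i) := by exact_mod_cast continuant_pos _
  have hle' : (continuant (pre a i) : ℝ) ≤ continuant (pre a n) := by exact_mod_cast hle
  rw [cfVal_eq_cfApp a i, cfVal_eq_cfApp b i, ← pre_congr hmin]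
  refine le_trans ?_ (le_abs_cfApp_sub _ (cfVal_nonneg _) (cfVal_le_one _) (cfVal_nonneg _)
    (cfVal_le_one _))
  have hgap : 1 / 125 ≤ |cfVal (fun k => a (k + i)) - cfVal (fun k => b (k + i))| := by
    rcases lt_or_gt_of_ne hne with hlt | hlt
    · exact (lt_cfVal_sub_of_head_lt (fun k => ha _) (fun k => hb _) (by simpa using hlt)).trans
        (le_abs_self _)
    · rw [abs_sub_comm]
      exact (lt_cfVal_sub_of_head_lt (fun k => hb _) (fun k => ha _) (by simpa using hlt)).trans
        (le_abs_self _)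
  calc 1 / (500 * (continuant (pre a n) : ℝ) ^ 2) ≤ 1 / (500 * (continuant (pre a i) : ℝ) ^ 2) := by
        gcongr
    _ = (1 / 125) / (4 * (continuant (pre a i) : ℝ) ^ 2) := by field_simp; norm_num
    _ ≤ _ := by gcongr

/-! ### The order of continued fractions -/

/-- `cfLt u v`: the words differ at some place and every number `[0; u, …]` is smaller than
every number `[0; v, …]`. -/
def cfLt (u v : List ℕ+) : Prop :=
  ∃ (p u' v' : List ℕ+) (x y : ℕ+), u = p ++ x :: u' ∧ v = p ++ y :: v' ∧ x ≠ y ∧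
    (x < y ↔ Odd p.length)

/-- The map x ↦ 1/(a + x) is decreasing. -/
theorem cfLt_cons (a : ℕ+) {u v : List ℕ+} (h : cfLt u v) : cfLt (a :: v) (a :: u) := by
  obtain ⟨p, u', v', x, y, rfl, rfl, hne, hxy⟩ := h
  refine ⟨a :: p, v', u', y, x, rfl, rfl, hne.symm, ?_⟩
  rw [List.length_cons, Nat.odd_add_one, ← hxy, not_lt]
  exact ⟨le_of_lt, fun h => lt_of_le_of_ne h hne.symm⟩

/-- Two words are incomparable only if one begins by the other; equal lengths exclude this for
distinct words. -/
theorem cfLt_or_cfLt {u v : List ℕ+} (hl : u.length = v.length) (h : u ≠ v) :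
    cfLt u v ∨ cfLt v u := by
  induction u generalizing v with
  | nil => exact absurd (List.length_eq_zero_iff.1 hl.symm).symm h
  | cons a u ih =>
    cases v with
    | nil => simp at hl
    | cons b v =>
      by_cases hab : a = b
      · subst hab
        have := ih (v := v) (by simpa using hl) (fun e => h (by rw [e]))
        exact this.symm.imp (cfLt_cons a) (cfLt_cons a)
      · rcases lt_or_gt_of_ne hab with hlt | hlt
        · exact Or.inr ⟨[], v, u, b, a, rfl, rfl, Ne.symm hab, by simp [hlt.le]⟩
        · exact Or.inl ⟨[], u, v, a, b, rfl, rfl, hab, by simp [hlt.le]⟩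

theorem pre_eq_of_pre_append {a : ℕ → ℕ+} {u v : List ℕ+}
    (h : pre a (u ++ v).length = u ++ v) :
    pre a u.length = u ∧ pre (fun k => a (k + u.length)) v.length = v := by
  rw [List.length_append, pre_add] at h
  exact List.append_inj h (by simp)

/-- Each common letter reverses the order. The parity of the common part of u and v is built into
`cfLt`, so only the sign of z remains. -/
theorem cfVal_sign_of_cfLt {a b : ℕ → ℕ+} (ha : ∀ i, a i ≤ 4) (hb : ∀ i, b i ≤ 4)
    {z u v : List ℕ+} (hu : pre a (z ++ u).length = z ++ u) (hv : pre b (z ++ v).length = z ++ v)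
    (h : cfLt u v) :
    0 < (-1) ^ z.length * (cfVal b - cfVal a) ∧ ∃ i < (z ++ u).length, a i ≠ b i := by
  obtain ⟨p, u', v', x, y, rfl, rfl, hne, hxy⟩ := h
  rw [← List.append_assoc] at hu hv
  obtain ⟨hu1, hu2⟩ := pre_eq_of_pre_append hu
  obtain ⟨hv1, hv2⟩ := pre_eq_of_pre_append hv
  set n := (z ++ p).length with hn
  have hx : a n = x := by
    rw [List.length_cons, pre_succ'] at hu2
    simpa using (List.cons.inj hu2).1
  have hy : b n = y := by
    rw [List.length_cons, pre_succ'] at hv2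
    simpa using (List.cons.inj hv2).1
  refine ⟨?_, n, by simp [hn], by rw [hx, hy]; exact hne⟩
  have key := cfApp_sub_cfApp (z ++ p) (cfVal_nonneg (fun k => b (k + n)))
    (cfVal_le_one (fun k => b (k + n))) (cfVal_nonneg (fun k => a (k + n)))
    (cfVal_le_one (fun k => a (k + n)))
  have ea := cfVal_eq_cfApp a n
  have eb := cfVal_eq_cfApp b n
  rw [hu1] at ea
  rw [hv1] at eb
  rw [← ea, ← eb] at key
  have hq : (0 : ℝ) < continuant (z ++ p) := by exact_mod_cast continuant_pos _
  have d1 := hq.trans_le (contMat_den_bounds (z ++ p) (cfVal_nonneg (fun k => b (k + n)))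
    (cfVal_le_one (fun k => b (k + n)))).1
  have d2 := hq.trans_le (contMat_den_bounds (z ++ p) (cfVal_nonneg (fun k => a (k + n)))
    (cfVal_le_one (fun k => a (k + n)))).1
  have hD := mul_pos d1 d2
  refine pos_of_mul_pos_left (b := _) ?_ hD.le
  rw [mul_assoc, key, List.length_append, pow_add]
  have hs : ((-1 : ℝ) ^ z.length) * ((-1) ^ z.length * (-1) ^ p.length *
      (cfVal (fun k => b (k + n)) - cfVal (fun k => a (k + n)))) =
      (-1) ^ p.length * (cfVal (fun k => b (k + n)) - cfVal (fun k => a (k + n))) := by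
    have : ((-1 : ℝ) ^ z.length) * (-1) ^ z.length = 1 := by
      rw [← mul_pow]; simp
    linear_combination ((-1) ^ p.length *
      (cfVal (fun k => b (k + n)) - cfVal (fun k => a (k + n)))) * this
  rw [hs]
  rcases Nat.even_or_odd p.length with hp | hp
  · have hlt : y < x := by
      have : ¬ x < y := fun hlt => (Nat.not_odd_iff_even.2 hp) (hxy.1 hlt)
      exact lt_of_le_of_ne (not_lt.1 this) hne.symm
    have := lt_cfVal_sub_of_head_lt (a := fun k => b (k + n)) (b := fun k => a (k + n))
      (fun i => hb _) (fun i => ha _) (by simpa [hx, hy] using hlt)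
    rw [hp.neg_one_pow]
    linarith
  · have hlt : x < y := hxy.2 hp
    have := lt_cfVal_sub_of_head_lt (a := fun k => a (k + n)) (b := fun k => b (k + n))
      (fun i => ha _) (fun i => hb _) (by simpa [hx, hy] using hlt)
    rw [hp.neg_one_pow]
    linarith

/-- If `a` continues after `z` by a word with neighbours on both sides, then replacing that word
by a suitable neighbour increases `[0; a]` by a definite amount. -/
theorem exists_cfVal_add_le {z u : List ℕ+} {a : ℕ → ℕ+} (ha : ∀ i, a i ≤ 4)
    (hu : pre a (z ++ u).length = z ++ u) (P : List ℕ+ → Prop)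
    (hlo : ∃ v, P v ∧ cfLt v u) (hhi : ∃ v, P v ∧ cfLt u v) :
    ∃ v, P v ∧ ∀ b : ℕ → ℕ+, (∀ i, b i ≤ 4) → pre b (z ++ v).length = z ++ v →
      cfVal a + 1 / (500 * (continuant (z ++ u) : ℝ) ^ 2) ≤ cfVal b := by
  have main : ∀ b : ℕ → ℕ+, (∀ i, b i ≤ 4) → (∃ i < (z ++ u).length, a i ≠ b i) →
      0 < cfVal b - cfVal a →
      cfVal a + 1 / (500 * (continuant (z ++ u) : ℝ) ^ 2) ≤ cfVal b := by
    intro b hb hd hpos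
    have := le_abs_cfVal_sub ha hb hd
    rw [hu, abs_sub_comm, abs_of_pos hpos] at this
    linarith
  -- An even z preserves the order, so the greater neighbour is taken; an odd z reverses it, so the
  -- smaller one is.
  rcases Nat.even_or_odd z.length with hz | hz
  · obtain ⟨v, hv, hlt⟩ := hhi
    refine ⟨v, hv, fun b hb hbv => ?_⟩
    have := cfVal_sign_of_cfLt ha hb hu hbv hlt
    rw [hz.neg_one_pow, one_mul] at this
    exact main b hb this.2 this.1
  · obtain ⟨v, hv, hlt⟩ := hlo
    refine ⟨v, hv, fun b hb hbv => ?_⟩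
    have := cfVal_sign_of_cfLt hb ha hbv hu hlt
    rw [hz.neg_one_pow] at this
    refine main b hb ?_ (by linarith [this.1])
    -- The disagreement must be located within the length of z ++ u, while the previous lemma
    -- locates it within z ++ v. Full agreement there would give b the beginning z ++ u, against the
    -- distinct letters x and y.
    by_contra hcon
    push Not at hcon
    have he : pre b (z ++ u).length = z ++ u := by rw [← pre_congr hcon, hu]
    obtain ⟨p, v', u', x, y, rfl, rfl, hne, -⟩ := hlt
    rw [← List.append_assoc] at he hbv
    have h1 := (pre_eq_of_pre_append he).2
    have h2 := (pre_eq_of_pre_append hbv).2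
    rw [List.length_cons, pre_succ'] at h1 h2
    exact hne ((List.cons.inj h2).1.symm.trans (List.cons.inj h1).1)

/-! ### Good positions in a finite set of words, and the rarity of bad ones -/

open scoped Classical in
/-- The words of length `k` over a finite alphabet. -/
def words {α : Type*} (B : Finset α) : ℕ → Finset (List α)
  | 0 => {[]}
  | k + 1 => (B ×ˢ words B k).image fun x => x.1 :: x.2

theorem mem_words {α : Type*} {B : Finset α} {k : ℕ} {w : List α} :
    w ∈ words B k ↔ w.length = k ∧ ∀ x ∈ w, x ∈ B := by
  classical
  induction k generalizing w with
  | zero => simp only [words, Finset.mem_singleton, List.length_eq_zero_iff]; aesop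
  | succ k ih =>
    simp only [words, Finset.mem_image, Finset.mem_product, Prod.exists, ih]
    constructor
    · rintro ⟨x, v, ⟨hx, hl, hv⟩, rfl⟩
      simpa [hl, hx] using hv
    · rintro ⟨hl, hw⟩
      cases w with
      | nil => simp at hl
      | cons x v =>
        exact ⟨x, v, ⟨hw x (by simp), by simpa using hl, fun y hy => hw y (by simp [hy])⟩, rfl⟩

theorem card_words_le {α : Type*} (B : Finset α) (k : ℕ) : (words B k).card ≤ B.card ^ k := by
  classical
  induction k with
  | zero => simp [words]
  | succ k ih =>
    refine Finset.card_image_le.trans ?_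
    rw [Finset.card_product, pow_succ, mul_comm]
    exact Nat.mul_le_mul_right _ ih

/-- Position `j` of the word `w` is right-good in `X` if, keeping what precedes it, its letter may
be replaced by a smaller one and by a greater one. -/
def rightGood {α : Type*} (X : Finset (List α)) (lt : α → α → Prop) (w : List α) (j : ℕ) : Prop :=
  (∃ u ∈ X, u.take j = w.take j ∧ ∃ x y, u[j]? = some x ∧ w[j]? = some y ∧ lt x y) ∧
    ∃ u ∈ X, u.take j = w.take j ∧ ∃ x y, u[j]? = some x ∧ w[j]? = some y ∧ lt y x

/-- Position `j` of the word `w` is left-good in `X` if, keeping what follows it, its letter may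
be replaced by a smaller one and by a greater one. -/
def leftGood {α : Type*} (X : Finset (List α)) (lt : α → α → Prop) (w : List α) (j : ℕ) : Prop :=
  (∃ u ∈ X, u.drop (j + 1) = w.drop (j + 1) ∧
      ∃ x y, u[j]? = some x ∧ w[j]? = some y ∧ lt x y) ∧
    ∃ u ∈ X, u.drop (j + 1) = w.drop (j + 1) ∧
      ∃ x y, u[j]? = some x ∧ w[j]? = some y ∧ lt y x

theorem rightGood_cons {α : Type*} {X X' : Finset (List α)} {lt : α → α → Prop} {x : α}
    (hX : ∀ w, w ∈ X' ↔ x :: w ∈ X) (w : List α) (j : ℕ) :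
    rightGood X lt (x :: w) (j + 1) ↔ rightGood X' lt w j := by
  have key : ∀ P : α → α → Prop,
      (∃ u ∈ X, u.take (j + 1) = (x :: w).take (j + 1) ∧
        ∃ a b, u[j + 1]? = some a ∧ (x :: w)[j + 1]? = some b ∧ P a b) ↔
      ∃ u ∈ X', u.take j = w.take j ∧ ∃ a b, u[j]? = some a ∧ w[j]? = some b ∧ P a b := by
    intro P
    constructor
    · rintro ⟨u, hu, ht, a, b, ha, hb, hP⟩
      cases u with
      | nil => simp at ha
      | cons y u =>
        simp only [List.take_succ_cons, List.cons.injEq] at ht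
        obtain ⟨rfl, ht⟩ := ht
        exact ⟨u, (hX u).2 hu, ht, a, b, by simpa using ha, by simpa using hb, hP⟩
    · rintro ⟨u, hu, ht, a, b, ha, hb, hP⟩
      exact ⟨x :: u, (hX u).1 hu, by simp [ht], a, b, by simpa using ha, by simpa using hb, hP⟩
  exact and_congr (key lt) (key fun a b => lt b a)

open scoped Classical in
/-- Words are weighted by a factor `N` for each position that is not right-good. -/
theorem sum_pow_bad_le {α : Type*} (B : Finset α) (lt : α → α → Prop) (len : α → ℕ) (L : ℕ)
    (hlen : ∀ x ∈ B, len x < L)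
    (tri : ∀ x ∈ B, ∀ y ∈ B, len x = len y → x ≠ y → lt x y ∨ lt y x)
    (k : ℕ) (X : Finset (List α)) (hX : X ⊆ words B k) :
    ∑ w ∈ X, B.card ^ ((Finset.range k).filter fun j => ¬ rightGood X lt w j).card ≤
      ((2 * L + 1) * B.card) ^ k := by
  induction k generalizing X with
  | zero =>
    simp only [Finset.range_zero, Finset.filter_empty, Finset.card_empty, pow_zero,
      Finset.sum_const, smul_eq_mul, mul_one]
    exact (Finset.card_le_card hX).trans (by simp [words])
  | succ k ih =>
    -- Induction on the first letter: X' x collects the tails after x, H the first letters that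
    -- occur. Goodness of later positions depends only on X' x.
    set X' : α → Finset (List α) := fun x => X.preimage (List.cons x) List.cons_injective.injOn
      with hX'
    have memX' : ∀ x w, w ∈ X' x ↔ x :: w ∈ X := fun x w => by simp [hX']
    have hsub : ∀ x, X' x ⊆ words B k := by
      intro x w hw
      have := mem_words.1 (hX ((memX' x w).1 hw))
      refine mem_words.2 ⟨by simpa using this.1, fun y hy => this.2 y (by simp [hy])⟩
    set H : Finset α := B.filter fun x => (X' x).Nonempty with hH
    set bad : α → Prop := fun x =>
      ¬ ((∃ y ∈ H, lt y x) ∧ ∃ y ∈ H, lt x y) with hbad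
    have hgood0 : ∀ x w, x :: w ∈ X → (¬ rightGood X lt (x :: w) 0 ↔ bad x) := by
      intro x w hw
      have key : ∀ P : α → α → Prop,
          (∃ u ∈ X, u.take 0 = (x :: w).take 0 ∧
            ∃ a b, u[0]? = some a ∧ (x :: w)[0]? = some b ∧ P a b) ↔ ∃ y ∈ H, P y x := by
        intro P
        constructor
        · rintro ⟨u, hu, -, a, b, ha, hb, hP⟩
          cases u with
          | nil => simp at ha
          | cons y u =>
            simp only [List.getElem?_cons_zero, Option.some.injEq] at ha hb
            subst ha hb
            refine ⟨y, Finset.mem_filter.2 ⟨(mem_words.1 (hX hu)).2 y (by simp), u,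
              (memX' y u).2 hu⟩, hP⟩
        · rintro ⟨y, hy, hP⟩
          obtain ⟨u, hu⟩ := (Finset.mem_filter.1 hy).2
          exact ⟨y :: u, (memX' y u).1 hu, rfl, y, x, rfl, rfl, hP⟩
      rw [hbad, rightGood, key lt, key fun a b => lt b a]
    have hXeq : X = (H.sigma X').image fun s => s.1 :: s.2 := by
      ext w
      simp only [Finset.mem_image, Finset.mem_sigma, Sigma.exists]
      constructor
      · intro hw
        cases w with
        | nil => have := (mem_words.1 (hX hw)).1; simp at this
        | cons x w =>
          refine ⟨x, w, ⟨Finset.mem_filter.2 ⟨(mem_words.1 (hX hw)).2 x (by simp), w,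
            (memX' x w).2 hw⟩, (memX' x w).2 hw⟩, rfl⟩
      · rintro ⟨x, v, ⟨-, hv⟩, rfl⟩
        exact (memX' x v).1 hv
    have hsum : ∀ f : List α → ℕ, ∑ w ∈ X, f w = ∑ x ∈ H, ∑ w ∈ X' x, f (x :: w) := by
      intro f
      conv_lhs => rw [hXeq]
      rw [Finset.sum_image, Finset.sum_sigma]
      rintro ⟨x, v⟩ - ⟨y, u⟩ - h
      simp only [List.cons.injEq] at h
      obtain ⟨rfl, rfl⟩ := h
      rfl
    have hcard : ∀ x w, x :: w ∈ X →
        ((Finset.range (k + 1)).filter fun j => ¬ rightGood X lt (x :: w) j).card =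
          ((Finset.range k).filter fun j => ¬ rightGood (X' x) lt w j).card +
            if bad x then 1 else 0 := by
      intro x w hw
      rw [Finset.card_filter, Finset.card_filter, Finset.sum_range_succ']
      simp only [rightGood_cons (memX' x), hgood0 x w hw]
    -- A bad letter is determined by its length and by whether H has a smaller letter: of two bad
    -- letters with the same data, the lower one would have both a smaller and a greater neighbour.
    have hbadcard : (H.filter bad).card ≤ 2 * L := by
      have : (H.filter bad).card ≤ ((Finset.univ : Finset Bool) ×ˢ Finset.range L).card := by
        refine Finset.card_le_card_of_injOn (fun x => (decide (∃ y ∈ H, lt y x), len x)) ?_ ?_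
        · intro x hx
          have hxB := (Finset.mem_filter.1 (Finset.mem_filter.1 hx).1).1
          exact Finset.mem_coe.2 (Finset.mem_product.2
            ⟨Finset.mem_univ _, Finset.mem_range.2 (hlen x hxB)⟩)
        · intro x hx y hy hxy
          simp only [Prod.mk.injEq, decide_eq_decide] at hxy
          obtain ⟨hx1, hx2⟩ := Finset.mem_filter.1 hx
          obtain ⟨hy1, hy2⟩ := Finset.mem_filter.1 hy
          by_contra hne
          simp only [hbad, not_and] at hx2 hy2
          have := tri x (Finset.mem_filter.1 hx1).1 y (Finset.mem_filter.1 hy1).1 hxy.2 hne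
          rcases this with h | h
          · have h2 : ∃ z ∈ H, lt z y := ⟨x, hx1, h⟩
            exact hx2 (hxy.1.2 h2) ⟨y, hy1, h⟩
          · have h2 : ∃ z ∈ H, lt z x := ⟨y, hy1, h⟩
            exact hy2 (hxy.1.1 h2) ⟨x, hx1, h⟩
      simpa using this
    have hHB : H.card ≤ B.card := Finset.card_le_card (Finset.filter_subset _ _)
    rw [hsum]
    calc ∑ x ∈ H, ∑ w ∈ X' x, B.card ^
          ((Finset.range (k + 1)).filter fun j => ¬ rightGood X lt (x :: w) j).card
        = ∑ x ∈ H, (∑ w ∈ X' x, B.card ^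
          ((Finset.range k).filter fun j => ¬ rightGood (X' x) lt w j).card) *
            B.card ^ (if bad x then 1 else 0) := by
          refine Finset.sum_congr rfl fun x hx => ?_
          rw [Finset.sum_mul]
          refine Finset.sum_congr rfl fun w hw => ?_
          rw [hcard x w ((memX' x w).1 hw), pow_add]
      _ ≤ ∑ x ∈ H, ((2 * L + 1) * B.card) ^ k * B.card ^ (if bad x then 1 else 0) :=
          Finset.sum_le_sum fun x hx => Nat.mul_le_mul_right _ (ih (X' x) (hsub x))
      _ = ((2 * L + 1) * B.card) ^ k * ∑ x ∈ H, B.card ^ (if bad x then 1 else 0) := by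
          rw [Finset.mul_sum]
      _ ≤ ((2 * L + 1) * B.card) ^ k * ((2 * L + 1) * B.card) := by
          refine Nat.mul_le_mul_left _ ?_
          -- At most 2L bad letters of weight N and at most N good ones of weight 1.
          rw [← Finset.sum_filter_add_sum_filter_not H bad]
          have e1 : ∑ x ∈ H.filter bad, B.card ^ (if bad x then 1 else 0) =
              (H.filter bad).card * B.card := by
            rw [Finset.sum_congr rfl (g := fun _ => B.card), Finset.sum_const, smul_eq_mul]
            intro x hx
            rw [if_pos (Finset.mem_filter.1 hx).2, pow_one]
          have e2 : ∑ x ∈ H.filter (fun x => ¬ bad x), B.card ^ (if bad x then 1 else 0) =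
              (H.filter fun x => ¬ bad x).card := by
            rw [Finset.sum_congr rfl (g := fun _ => 1), Finset.sum_const, smul_eq_mul, mul_one]
            intro x hx
            rw [if_neg (Finset.mem_filter.1 hx).2, pow_zero]
          rw [e1, e2]
          have h3 : (H.filter fun x => ¬ bad x).card ≤ B.card :=
            (Finset.card_le_card (Finset.filter_subset _ _)).trans hHB
          have h4 := Nat.mul_le_mul_right B.card hbadcard
          linarith
      _ = _ := (pow_succ _ _).symm

open scoped Classical in
/-- Words with many positions that are not right-good are rare. -/
theorem card_bad_right_mul_le {α : Type*} (B : Finset α) (lt : α → α → Prop) (len : α → ℕ) (L : ℕ)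
    (hlen : ∀ x ∈ B, len x < L)
    (tri : ∀ x ∈ B, ∀ y ∈ B, len x = len y → x ≠ y → lt x y ∨ lt y x)
    (k : ℕ) (X : Finset (List α)) (hX : X ⊆ words B k) (m : ℕ) :
    (X.filter fun w => m ≤ ((Finset.range k).filter fun j => ¬ rightGood X lt w j).card).card *
      B.card ^ m ≤ ((2 * L + 1) * B.card) ^ k := by
  rcases Nat.eq_zero_or_pos B.card with h0 | hpos
  · rcases Nat.eq_zero_or_pos k with rfl | hk
    · have := (Finset.card_le_card hX).trans (card_words_le B 0)
      rcases Nat.eq_zero_or_pos m with rfl | hm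
      · rw [pow_zero, mul_one, pow_zero]
        exact (Finset.card_le_card (Finset.filter_subset _ X)).trans (by simpa using this)
      · simp [h0, hm.ne']
    · have := (Finset.card_le_card hX).trans (card_words_le B k)
      rw [h0, zero_pow hk.ne', Nat.le_zero, Finset.card_eq_zero] at this
      simp [this]
  · refine le_trans ?_ (sum_pow_bad_le B lt len L hlen tri k X hX)
    rw [← smul_eq_mul, ← Finset.sum_const]
    refine (Finset.sum_le_sum fun w hw => ?_).trans
      (Finset.sum_le_sum_of_subset (Finset.filter_subset _ _))
    exact Nat.pow_le_pow_right hpos (Finset.mem_filter.1 hw).2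

/-- Reversal exchanges the two notions, so that the left count follows from the right one. -/
theorem leftGood_iff_rightGood_reverse {α : Type*} {X X' : Finset (List α)} {k : ℕ}
    (hX : ∀ w ∈ X, w.length = k) (hX' : ∀ w, w ∈ X' ↔ w.reverse ∈ X)
    (lt : α → α → Prop) {w : List α} (hw : w.length = k) {j : ℕ} (hj : j < k) :
    leftGood X lt w j ↔ rightGood X' lt w.reverse (k - 1 - j) := by
  have hidx : ∀ u : List α, u.length = k → u.reverse[k - 1 - j]? = u[j]? := by
    intro u hu
    rw [List.getElem?_reverse (by omega), hu]
    congr 1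
    omega
  have htake : ∀ u : List α, u.length = k →
      u.reverse.take (k - 1 - j) = (u.drop (j + 1)).reverse := by
    intro u hu
    rw [List.take_reverse, hu]
    congr 2
    omega
  have key : ∀ P : α → α → Prop,
      (∃ u ∈ X, u.drop (j + 1) = w.drop (j + 1) ∧
        ∃ a b, u[j]? = some a ∧ w[j]? = some b ∧ P a b) ↔
      ∃ u ∈ X', u.take (k - 1 - j) = w.reverse.take (k - 1 - j) ∧
        ∃ a b, u[k - 1 - j]? = some a ∧ w.reverse[k - 1 - j]? = some b ∧ P a b := by
    intro P
    constructor
    · rintro ⟨u, hu, ht, a, b, ha, hb, hP⟩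
      refine ⟨u.reverse, (hX' _).2 (by simpa using hu), ?_, a, b, ?_, ?_, hP⟩
      · rw [htake u (hX u hu), htake w hw, ht]
      · rw [hidx u (hX u hu), ha]
      · rw [hidx w hw, hb]
    · rintro ⟨u, hu, ht, a, b, ha, hb, hP⟩
      have hu' := (hX' _).1 hu
      have hul := hX _ hu'
      refine ⟨u.reverse, hu', ?_, a, b, ?_, ?_, hP⟩
      · have h1 := htake _ hul
        rw [List.reverse_reverse, ht, htake w hw] at h1
        exact (List.reverse_injective h1).symm
      · rw [← ha, ← hidx _ hul, List.reverse_reverse]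
      · rw [← hb, hidx w hw]
  exact and_congr (key lt) (key fun a b => lt b a)

open scoped Classical in
/-- Words with many positions that are not left-good are rare. -/
theorem card_bad_left_mul_le {α : Type*} (B : Finset α) (lt : α → α → Prop) (len : α → ℕ) (L : ℕ)
    (hlen : ∀ x ∈ B, len x < L)
    (tri : ∀ x ∈ B, ∀ y ∈ B, len x = len y → x ≠ y → lt x y ∨ lt y x)
    (k : ℕ) (X : Finset (List α)) (hX : X ⊆ words B k) (m : ℕ) :
    (X.filter fun w => m ≤ ((Finset.range k).filter fun j => ¬ leftGood X lt w j).card).card *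
      B.card ^ m ≤ ((2 * L + 1) * B.card) ^ k := by
  set X' := X.image List.reverse with hX'
  have memX' : ∀ w, w ∈ X' ↔ w.reverse ∈ X := by
    intro w
    simp only [hX', Finset.mem_image]
    constructor
    · rintro ⟨u, hu, rfl⟩
      simpa using hu
    · intro h
      exact ⟨_, h, by simp⟩
  have hsub : X' ⊆ words B k := by
    intro w hw
    have := mem_words.1 (hX ((memX' w).1 hw))
    exact mem_words.2 ⟨by simpa using this.1, fun x hx => this.2 x (by simpa using hx)⟩
  refine le_trans (Nat.mul_le_mul_right _ ?_)
    (card_bad_right_mul_le B lt len L hlen tri k X' hsub m)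
  refine Finset.card_le_card_of_injOn List.reverse ?_ List.reverse_injective.injOn
  intro w hw
  obtain ⟨hw, hm⟩ := Finset.mem_filter.1 hw
  have hl := (mem_words.1 (hX hw)).1
  refine Finset.mem_coe.2 (Finset.mem_filter.2 ⟨(memX' _).2 (by simpa using hw), hm.trans_eq ?_⟩)
  rw [Finset.card_filter, Finset.card_filter, ← Finset.sum_range_reflect]
  refine Finset.sum_congr rfl fun j hj => ?_
  have hj := Finset.mem_range.1 hj
  rw [leftGood_iff_rightGood_reverse (fun w hw => (mem_words.1 (hX hw)).1) memX' lt hl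
    (by omega : k - 1 - j < k)]
  have : k - 1 - (k - 1 - j) = j := by omega
  rw [this]

/-! ### Counting words by their loops between good positions of equal type -/

/-- The letters of `w` at the positions `p + 1, …, q`. -/
def loopWord {α : Type*} (p q : ℕ) (w : List α) : List α := (w.drop (p + 1)).take (q - p)

theorem drop_eq_append_loopWord {α : Type*} {a p q : ℕ} (hap : a ≤ p) (hpq : p ≤ q) (w : List α) :
    w.drop a = (w.drop a).take (p + 1 - a) ++ (loopWord p q w ++ w.drop (q + 1)) := by
  have h1 : w.drop (p + 1) = loopWord p q w ++ w.drop (q + 1) := by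
    conv_lhs => rw [← List.take_append_drop (q - p) (w.drop (p + 1)), List.drop_drop]
    rw [loopWord, show p + 1 + (q - p) = q + 1 by omega]
  rw [← h1, show p + 1 = a + (p + 1 - a) by omega, ← List.drop_drop]
  rw [show a + (p + 1 - a) - a = p + 1 - a by omega, List.take_append_drop]

theorem mem_words_of_sublist {α : Type*} {B : Finset α} {k : ℕ} {w v : List α}
    (hw : w ∈ words B k) (h : v.Sublist w) : v ∈ words B v.length :=
  mem_words.2 ⟨rfl, fun _ hx => (mem_words.1 hw).2 _ (h.subset hx)⟩

set_option maxHeartbeats 1000000 in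
open scoped Classical in
/-- If, for each type `c`, few words occur between two good positions of type `c`, then there are
few words with few positions that are not good. -/
theorem card_image_drop_le {α τ : Type*} (B : Finset α) (hB : 1 ≤ B.card) (k ℓ M : ℕ)
    (X : Finset (List α)) (hX : X ⊆ words B k) (good : List α → ℕ → Prop) (ty : List α → ℕ → τ)
    (V : ℝ) (hV : 1 ≤ V)
    (hloop : ∀ p q c, p + ℓ ≤ q → q < k → ∀ Z ⊆ X,
      (∀ w ∈ Z, good w p ∧ good w q ∧ ty w p = c ∧ ty w q = c) →
      (((Z.image (loopWord p q)).card : ℕ) : ℝ) ≤ V ^ (q - p))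
    (T : Finset τ) (hTM : T.card ≤ M) (a : ℕ) (hak : a ≤ k) (Y : Finset (List α)) (hYX : Y ⊆ X)
    (e : ℕ)
    (hT : ∀ w ∈ Y, ∀ p, a ≤ p → p < k → good w p → ty w p ∈ T)
    (he : ∀ w ∈ Y, ((Finset.Ico a k).filter fun p => ¬ good w p).card ≤ e) :
    (((Y.image (List.drop a)).card : ℕ) : ℝ) ≤
      ((k : ℝ) ^ 2 * M + 1) ^ T.card * (B.card : ℝ) ^ (e + T.card * (ℓ + 1)) * V ^ (k - a) := by
  have hN : (1 : ℝ) ≤ B.card := by exact_mod_cast hB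
  have hN0 : (0 : ℝ) ≤ B.card := zero_le_one.trans hN
  have hV0 : 0 ≤ V := zero_le_one.trans hV
  have hM0 : 0 ≤ (k : ℝ) ^ 2 * M + 1 := by positivity
  have aux : ∀ {b V W c x y : ℝ} {i j l m n : ℕ}, 0 ≤ b → 0 ≤ V → c ≤ b ^ i * (x * y) →
      x ≤ b ^ j * V ^ l → y ≤ W * b ^ m * V ^ n → 0 ≤ y → c ≤ W * b ^ (i + j + m) * V ^ (l + n) := by
    intro b V W c x y i j l m n hb hV hc hx hy hy0
    calc c ≤ b ^ i * (x * y) := hc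
      _ ≤ b ^ i * ((b ^ j * V ^ l) * (W * b ^ m * V ^ n)) :=
          mul_le_mul_of_nonneg_left (mul_le_mul hx hy hy0 (by positivity)) (by positivity)
      _ = _ := by ring
  -- Without good positions from a on, all k - a positions are bad, hence k - a ≤ e and the trivial
  -- count suffices.
  have none_le : ∀ a e : ℕ, a ≤ k → ∀ Y ⊆ X,
      (∀ w ∈ Y, ((Finset.Ico a k).filter fun p => ¬ good w p).card ≤ e) →
      (∀ w ∈ Y, ∀ p, a ≤ p → p < k → ¬ good w p) →
      (((Y.image (List.drop a)).card : ℕ) : ℝ) ≤ (B.card : ℝ) ^ e := by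
    intro a e hak Y hYX he hno
    rcases Y.eq_empty_or_nonempty with rfl | ⟨w, hw⟩
    · simp
    · have hke : k - a ≤ e := by
        have := he w hw
        rw [Finset.filter_true_of_mem, Nat.card_Ico] at this
        · exact this
        · intro p hp
          rw [Finset.mem_Ico] at hp
          exact hno w hw p hp.1 hp.2
      have h1 : (Y.image (List.drop a)).card ≤ B.card ^ (k - a) := by
        refine (Finset.card_le_card ?_).trans (card_words_le B (k - a))
        intro v hv
        obtain ⟨u, hu, rfl⟩ := Finset.mem_image.1 hv
        have hu := hX (hYX hu)
        have := mem_words_of_sublist hu (List.drop_sublist a u)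
        rwa [List.length_drop, (mem_words.1 hu).1] at this
      calc (((Y.image (List.drop a)).card : ℕ) : ℝ) ≤ (B.card : ℝ) ^ (k - a) := by exact_mod_cast h1
        _ ≤ _ := pow_le_pow_right₀ hN hke
  induction hn : T.card generalizing T a Y e with
  | zero =>
    have hT0 : T = ∅ := Finset.card_eq_zero.1 hn
    subst hT0
    rw [pow_zero, one_mul, zero_mul, add_zero]
    refine (none_le a e hak Y hYX he fun w hw p h1 h2 hg => by simpa using hT w hw p h1 h2 hg).trans
      (le_mul_of_one_le_right (by positivity) (one_le_pow₀ hV))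
  | succ n ih =>
    set Y0 := Y.filter fun w => ∀ p, a ≤ p → p < k → ¬ good w p with hY0
    -- Classification by (p, q, c): p is the first good position from a on, c its type, q the last
    -- good position of type c. After q the type c is gone, so the induction continues with one type
    -- fewer.
    set Z : ℕ × ℕ × τ → Finset (List α) := fun s => Y.filter fun w =>
      a ≤ s.1 ∧ s.1 ≤ s.2.1 ∧ (∀ p', a ≤ p' → p' < s.1 → ¬ good w p') ∧ good w s.1 ∧
        good w s.2.1 ∧ ty w s.1 = s.2.2 ∧ ty w s.2.1 = s.2.2 ∧
        ∀ q', s.2.1 < q' → q' < k → good w q' → ty w q' ≠ s.2.2 with hZ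
    set I := Finset.range k ×ˢ Finset.range k ×ˢ T with hI
    have hcover : Y ⊆ Y0 ∪ I.biUnion Z := by
      intro w hw
      by_cases h0 : ∀ p, a ≤ p → p < k → ¬ good w p
      · exact Finset.mem_union_left _ (Finset.mem_filter.2 ⟨hw, h0⟩)
      · push Not at h0
        have hex : ∃ p, a ≤ p ∧ p < k ∧ good w p := h0
        obtain ⟨hp1, hp2, hp3⟩ := Nat.find_spec hex
        set p := Nat.find hex with hp
        have hmin : ∀ p', a ≤ p' → p' < p → ¬ good w p' := fun p' h1 h2 h3 =>
          Nat.find_min hex h2 ⟨h1, h2.trans hp2, h3⟩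
        set S := (Finset.range k).filter fun q => p ≤ q ∧ good w q ∧ ty w q = ty w p with hS
        have hpS : p ∈ S := Finset.mem_filter.2 ⟨Finset.mem_range.2 hp2, le_rfl, hp3, rfl⟩
        have hmax := S.max'_mem ⟨p, hpS⟩
        set q := S.max' ⟨p, hpS⟩ with hq
        obtain ⟨hq0, hq1, hq2, hq3⟩ := Finset.mem_filter.1 hmax
        refine Finset.mem_union_right _ (Finset.mem_biUnion.2 ⟨(p, q, ty w p), ?_, ?_⟩)
        · exact Finset.mem_product.2 ⟨Finset.mem_range.2 hp2, Finset.mem_product.2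
            ⟨hq0, hT w hw p hp1 hp2 hp3⟩⟩
        · refine Finset.mem_filter.2 ⟨hw, hp1, hq1, hmin, hp3, hq2, rfl, hq3, ?_⟩
          intro q' h1 h2 h3 h4
          have : q' ≤ q := S.le_max' q' (Finset.mem_filter.2
            ⟨Finset.mem_range.2 h2, hq1.trans h1.le, h3, h4⟩)
          exact absurd this (not_le.2 h1)
    have hpiece : ∀ s ∈ I, ((((Z s).image (List.drop a)).card : ℕ) : ℝ) ≤
        ((k : ℝ) ^ 2 * M + 1) ^ n * (B.card : ℝ) ^ (e + (n + 1) * (ℓ + 1)) * V ^ (k - a) := by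
      rintro ⟨p, q, c⟩ hs
      simp only [hI, Finset.mem_product, Finset.mem_range] at hs
      obtain ⟨hpk, hqk, hcT⟩ := hs
      rcases (Z (p, q, c)).eq_empty_or_nonempty with hemp | ⟨w₀, hw₀⟩
      · rw [hemp, Finset.image_empty, Finset.card_empty, Nat.cast_zero]
        exact mul_nonneg (mul_nonneg (pow_nonneg hM0 _) (pow_nonneg hN0 _)) (pow_nonneg hV0 _)
      · have hprop : ∀ w ∈ Z (p, q, c), w ∈ Y ∧ a ≤ p ∧ p ≤ q ∧
            (∀ p', a ≤ p' → p' < p → ¬ good w p') ∧ good w p ∧ good w q ∧ ty w p = c ∧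
            ty w q = c ∧ ∀ q', q < q' → q' < k → good w q' → ty w q' ≠ c :=
          fun w hw => Finset.mem_filter.1 hw
        obtain ⟨hw₀Y, hap, hpq, -⟩ := hprop w₀ hw₀
        have hZX : Z (p, q, c) ⊆ X := (Finset.filter_subset _ _).trans hYX
        -- The positions from a up to p are all bad. The arbitrary choice of their letters is
        -- therefore paid out of the budget e.
        have hbadsplit : ∀ w ∈ Z (p, q, c),
            (p - a) + ((Finset.Ico (q + 1) k).filter fun p => ¬ good w p).card ≤ e := by
          intro w hw
          obtain ⟨hwY, -, -, hmin, -⟩ := hprop w hw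
          refine le_trans ?_ (he w hwY)
          rw [← Nat.card_Ico, ← Finset.card_union_of_disjoint]
          · refine Finset.card_le_card ?_
            intro i hi
            rw [Finset.mem_union, Finset.mem_filter, Finset.mem_Ico, Finset.mem_Ico] at hi
            rw [Finset.mem_filter, Finset.mem_Ico]
            rcases hi with hi | hi
            · exact ⟨⟨hi.1, hi.2.trans hpk⟩, hmin i hi.1 hi.2⟩
            · exact ⟨⟨by omega, hi.1.2⟩, hi.2⟩
          · rw [Finset.disjoint_left]
            intro i hi hi'
            rw [Finset.mem_filter, Finset.mem_Ico] at hi'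
            rw [Finset.mem_Ico] at hi
            omega
        have hrec := ih (T.erase c) (by rw [Finset.card_erase_of_mem hcT]; omega) (q + 1) hqk
          (Z (p, q, c)) hZX (e - (p - a))
          (by
            intro w hw r hr hrk hgr
            obtain ⟨hwY, -, -, -, -, -, -, -, hlast⟩ := hprop w hw
            exact Finset.mem_erase.2 ⟨hlast r hr hrk hgr, hT w hwY r (by omega) hrk hgr⟩)
          (by intro w hw; have := hbadsplit w hw; omega)
          (by rw [Finset.card_erase_of_mem hcT, hn]; rfl)
        -- Loops shorter than ℓ escape the hypothesis `hloop`; they are counted trivially, at the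
        -- price N^ℓ.
        have hmid : ((((Z (p, q, c)).image (loopWord p q)).card : ℕ) : ℝ) ≤
            (B.card : ℝ) ^ ℓ * V ^ (q - p) := by
          by_cases hlq : p + ℓ ≤ q
          · have h1 := hloop p q c hlq hqk (Z (p, q, c)) hZX fun w hw => by
              obtain ⟨-, -, -, -, g1, g2, t1, t2, -⟩ := hprop w hw
              exact ⟨g1, g2, t1, t2⟩
            exact h1.trans (le_mul_of_one_le_left (pow_nonneg hV0 _) (one_le_pow₀ hN))
          · have h1 : ((Z (p, q, c)).image (loopWord p q)).card ≤ B.card ^ (q - p) := by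
              refine (Finset.card_le_card ?_).trans (card_words_le B (q - p))
              intro v hv
              obtain ⟨u, hu, rfl⟩ := Finset.mem_image.1 hv
              have hu := hX (hZX hu)
              have := mem_words_of_sublist hu (v := loopWord p q u)
                ((List.take_sublist _ _).trans (List.drop_sublist _ _))
              have hl : (loopWord p q u).length = q - p := by
                simp only [loopWord, List.length_take, List.length_drop, (mem_words.1 hu).1]
                omega
              rwa [hl] at this
            calc (((Z (p, q, c)).image (loopWord p q)).card : ℝ) ≤ (B.card : ℝ) ^ (q - p) := by
                  exact_mod_cast h1
              _ ≤ (B.card : ℝ) ^ ℓ := pow_le_pow_right₀ hN (by omega)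
              _ ≤ _ := le_mul_of_one_le_right (pow_nonneg hN0 _) (one_le_pow₀ hV)
        have hprod : ((Z (p, q, c)).image (List.drop a)).card ≤ B.card ^ (p + 1 - a) *
            (((Z (p, q, c)).image (loopWord p q)).card *
              ((Z (p, q, c)).image (List.drop (q + 1))).card) := by
          refine le_trans ?_ (Nat.mul_le_mul_right _ (card_words_le B (p + 1 - a)))
          rw [← Finset.card_product, ← Finset.card_product]
          refine (Finset.card_le_card ?_).trans (Finset.card_image_le (f := fun s :
            List α × List α × List α => s.1 ++ (s.2.1 ++ s.2.2)))
          intro v hv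
          obtain ⟨u, hu, rfl⟩ := Finset.mem_image.1 hv
          refine Finset.mem_image.2 ⟨((u.drop a).take (p + 1 - a), loopWord p q u, u.drop (q + 1)),
            Finset.mem_product.2 ⟨?_, Finset.mem_product.2 ⟨Finset.mem_image_of_mem _ hu,
              Finset.mem_image_of_mem _ hu⟩⟩, (drop_eq_append_loopWord hap hpq u).symm⟩
          have hu := hX (hZX hu)
          have := mem_words_of_sublist hu (v := (u.drop a).take (p + 1 - a))
            ((List.take_sublist _ _).trans (List.drop_sublist _ _))
          have hl : ((u.drop a).take (p + 1 - a)).length = p + 1 - a := by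
            simp only [List.length_take, List.length_drop, (mem_words.1 hu).1]
            omega
          rwa [hl] at this
        have hpe : p - a ≤ e := by have := hbadsplit w₀ hw₀; omega
        have hprod' : ((((Z (p, q, c)).image (List.drop a)).card : ℕ) : ℝ) ≤
            (B.card : ℝ) ^ (p + 1 - a) * ((((Z (p, q, c)).image (loopWord p q)).card : ℝ) *
              ((Z (p, q, c)).image (List.drop (q + 1))).card) := by exact_mod_cast hprod
        have hfin := aux hN0 hV0 hprod' hmid hrec (Nat.cast_nonneg _)
        -- Each removed type costs ℓ + 1 letters: the one at p itself and those of a possible short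
        -- loop.
        have h1 : (p + 1 - a) + ℓ + (e - (p - a) + n * (ℓ + 1)) = e + (n + 1) * (ℓ + 1) := by
          rw [add_mul]; omega
        rw [h1] at hfin
        refine hfin.trans (mul_le_mul_of_nonneg_left (pow_le_pow_right₀ hV (by omega)) ?_)
        exact mul_nonneg (pow_nonneg hM0 _) (pow_nonneg hN0 _)
    have hsum : (((Y.image (List.drop a)).card : ℕ) : ℝ) ≤
        (((Y0.image (List.drop a)).card : ℕ) : ℝ) +
          ∑ s ∈ I, ((((Z s).image (List.drop a)).card : ℕ) : ℝ) := by
      have h1 : (Y.image (List.drop a)).card ≤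
          (Y0.image (List.drop a)).card + ∑ s ∈ I, ((Z s).image (List.drop a)).card := by
        refine (Finset.card_le_card (Finset.image_subset_image hcover)).trans ?_
        rw [Finset.image_union]
        refine (Finset.card_union_le _ _).trans (Nat.add_le_add_left ?_ _)
        rw [Finset.biUnion_image]
        exact Finset.card_biUnion_le
      exact_mod_cast h1
    have h0 := none_le a e hak Y0 ((Finset.filter_subset _ _).trans hYX)
      (fun w hw => he w (Finset.mem_filter.1 hw).1) (fun w hw => (Finset.mem_filter.1 hw).2)
    have hs := Finset.sum_le_sum hpiece
    rw [Finset.sum_const, nsmul_eq_mul] at hs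
    have hIcard : (I.card : ℝ) ≤ (k : ℝ) ^ 2 * M := by
      have : I.card ≤ k ^ 2 * M := by
        simp only [hI, Finset.card_product, Finset.card_range]
        rw [sq, mul_assoc]
        gcongr
      exact_mod_cast this
    set W := ((k : ℝ) ^ 2 * M + 1) ^ n with hW
    set E := (B.card : ℝ) ^ (e + (n + 1) * (ℓ + 1)) * V ^ (k - a) with hE
    have hW1 : 1 ≤ W := one_le_pow₀ (by nlinarith [sq_nonneg (k : ℝ), Nat.cast_nonneg (α := ℝ) M])
    have hE0 : 0 ≤ E := by positivity
    have h0' : (B.card : ℝ) ^ e ≤ W * E := by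
      calc (B.card : ℝ) ^ e ≤ (B.card : ℝ) ^ (e + (n + 1) * (ℓ + 1)) :=
            pow_le_pow_right₀ hN (by omega)
        _ ≤ E := le_mul_of_one_le_right (by positivity) (one_le_pow₀ hV)
        _ ≤ W * E := le_mul_of_one_le_left hE0 hW1
    rw [pow_succ, ← hW, mul_assoc _ _ (V ^ (k - a)), ← hE]
    rw [mul_assoc W, ← hE] at hs
    have : (I.card : ℝ) * (W * E) ≤ ((k : ℝ) ^ 2 * M) * (W * E) :=
      mul_le_mul_of_nonneg_right hIcard (by positivity)
    linarith

/-- Both `p` and `p + 1` are right-good and left-good positions. -/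
def goodPair {α : Type*} (X : Finset (List α)) (ltr ltl : α → α → Prop) (w : List α) (p : ℕ) :
    Prop :=
  rightGood X ltr w p ∧ rightGood X ltr w (p + 1) ∧ leftGood X ltl w p ∧ leftGood X ltl w (p + 1)

theorem card_filter_succ_le (k : ℕ) (P : ℕ → Prop) [DecidablePred P] :
    ((Finset.range k).filter fun p => P (p + 1)).card ≤ ((Finset.range k).filter P).card + 1 := by
  have h1 : ((Finset.range k).filter fun p => P (p + 1)).card ≤
      ((Finset.range (k + 1)).filter P).card := by
    rw [Finset.card_filter, Finset.card_filter, Finset.sum_range_succ']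
    exact Nat.le_add_right _ _
  refine h1.trans ?_
  rw [Finset.card_filter, Finset.card_filter, Finset.sum_range_succ]
  gcongr
  split_ifs <;> simp

open scoped Classical in
/-- A large set of words contains many words between two equal good pairs of letters. -/
theorem exists_loop {α : Type*} (B : Finset α) (hB : 1 ≤ B.card) (ltr ltl : α → α → Prop)
    (len : α → ℕ) (L : ℕ) (hlen : ∀ x ∈ B, len x < L)
    (trir : ∀ x ∈ B, ∀ y ∈ B, len x = len y → x ≠ y → ltr x y ∨ ltr y x)
    (tril : ∀ x ∈ B, ∀ y ∈ B, len x = len y → x ≠ y → ltl x y ∨ ltl y x)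
    (k ℓ m : ℕ) (X : Finset (List α)) (hX : X ⊆ words B k) (V : ℝ) (hV : 1 ≤ V)
    (hm : 4 * ((2 * L + 1) * B.card) ^ k ≤ B.card ^ m * X.card)
    (hlarge : 2 * (((k : ℝ) ^ 2 * (B.card ^ 2 : ℕ) + 1) ^ (B.card ^ 2) *
      (B.card : ℝ) ^ (4 * m + 2 + B.card ^ 2 * (ℓ + 1)) * V ^ k) < X.card) :
    ∃ (p q : ℕ) (a b : α) (Z : Finset (List α)), p + ℓ ≤ q ∧ q < k ∧ a ∈ B ∧ b ∈ B ∧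
      (∀ z ∈ Z, ∃ w ∈ X, goodPair X ltr ltl w p ∧ goodPair X ltr ltl w q ∧
        (w[p]? = some a ∧ w[p + 1]? = some b) ∧ (w[q]? = some a ∧ w[q + 1]? = some b) ∧
        loopWord p q w = z) ∧ V ^ (q - p) < Z.card := by
  by_contra hcon
  have hcon : ∀ p q a b, p + ℓ ≤ q → q < k → a ∈ B → b ∈ B →
      ((((X.filter fun w => goodPair X ltr ltl w p ∧ goodPair X ltr ltl w q ∧
        (w[p]? = some a ∧ w[p + 1]? = some b) ∧ (w[q]? = some a ∧ w[q + 1]? = some b)).image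
          (loopWord p q)).card : ℕ) : ℝ) ≤ V ^ (q - p) := by
    intro p q a b h1 h2 h3 h4
    by_contra h
    refine hcon ⟨p, q, a, b, _, h1, h2, h3, h4, fun z hz => ?_, not_le.1 h⟩
    obtain ⟨w, hw, rfl⟩ := Finset.mem_image.1 hz
    obtain ⟨hwX, hg, hg', ha, hb⟩ := Finset.mem_filter.1 hw
    exact ⟨w, hwX, hg, hg', ha, hb, rfl⟩
  set badr : List α → ℕ := fun w => ((Finset.range k).filter fun j => ¬ rightGood X ltr w j).card
    with hbadr
  set badl : List α → ℕ := fun w => ((Finset.range k).filter fun j => ¬ leftGood X ltl w j).card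
    with hbadl
  have hNm : 0 < B.card ^ m := pow_pos hB m
  have hr := card_bad_right_mul_le B ltr len L hlen trir k X hX m
  have hl := card_bad_left_mul_le B ltl len L hlen tril k X hX m
  set Y := X.filter fun w => badr w < m ∧ badl w < m with hY
  -- By `hm`, each of the two families of words with at least m bad positions is at most a quarter
  -- of X.
  have hhalf : X.card ≤ 2 * Y.card := by
    have hsplit : X ⊆ Y ∪ ((X.filter fun w => m ≤ badr w) ∪ X.filter fun w => m ≤ badl w) := by
      intro w hw
      simp only [hY, Finset.mem_union, Finset.mem_filter, hw, true_and]
      omega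
    have h1 := (Finset.card_le_card hsplit).trans ((Finset.card_union_le _ _).trans
      (Nat.add_le_add_left (Finset.card_union_le _ _) _))
    have h2 : B.card ^ m * (4 * ((X.filter fun w => m ≤ badr w).card +
        (X.filter fun w => m ≤ badl w).card)) ≤ B.card ^ m * (2 * X.card) := by
      nlinarith
    have h3 := Nat.le_of_mul_le_mul_left h2 hNm
    omega
  set ty : List α → ℕ → Option α × Option α := fun w p => (w[p]?, w[p + 1]?) with hty
  set T : Finset (Option α × Option α) := (B ×ˢ B).image fun s => (some s.1, some s.2) with hT
  have hTcard : T.card ≤ B.card ^ 2 := by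
    refine Finset.card_image_le.trans ?_
    rw [Finset.card_product, sq]
  have hsome : ∀ w ∈ X, ∀ p, goodPair X ltr ltl w p →
      ∃ a ∈ B, ∃ b ∈ B, w[p]? = some a ∧ w[p + 1]? = some b := by
    rintro w hw p ⟨⟨⟨-, -, -, -, a, -, ha, -⟩, -⟩, ⟨⟨-, -, -, -, b, -, hb, -⟩, -⟩, -⟩
    have hmem := (mem_words.1 (hX hw)).2
    exact ⟨a, hmem a (List.mem_of_getElem? ha), b, hmem b (List.mem_of_getElem? hb), ha, hb⟩
  have key := card_image_drop_le B hB k ℓ (B.card ^ 2) X hX (goodPair X ltr ltl) ty V hV ?_ T hTcard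
    0 (Nat.zero_le k) Y (Finset.filter_subset _ _) (4 * m + 2) ?_ ?_
  · have hid : Y.image (List.drop 0) = Y := by
      ext w; simp
    rw [hid, Nat.sub_zero] at key
    have hN : (1 : ℝ) ≤ B.card := by exact_mod_cast hB
    have hle : ((k : ℝ) ^ 2 * (B.card ^ 2 : ℕ) + 1) ^ T.card *
        (B.card : ℝ) ^ (4 * m + 2 + T.card * (ℓ + 1)) * V ^ k ≤
        ((k : ℝ) ^ 2 * (B.card ^ 2 : ℕ) + 1) ^ (B.card ^ 2) *
        (B.card : ℝ) ^ (4 * m + 2 + B.card ^ 2 * (ℓ + 1)) * V ^ k := by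
      gcongr
      · have : (0 : ℝ) ≤ (k : ℝ) ^ 2 * (B.card ^ 2 : ℕ) := by positivity
        linarith
    have hhalf' : (X.card : ℝ) ≤ 2 * Y.card := by exact_mod_cast hhalf
    linarith
  · intro p q c hpq hqk Z hZX hZ
    rcases Z.eq_empty_or_nonempty with rfl | ⟨w₀, hw₀⟩
    · simp only [Finset.image_empty, Finset.card_empty, Nat.cast_zero]
      positivity
    obtain ⟨hg, -, h1, -⟩ := hZ w₀ hw₀
    obtain ⟨a, ha, b, hb, h2, h3⟩ := hsome w₀ (hZX hw₀) p hg
    refine le_trans ?_ (hcon p q a b hpq hqk ha hb)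
    norm_cast
    refine Finset.card_le_card (Finset.image_subset_image fun w hw => ?_)
    obtain ⟨g1, g2, t1, t2⟩ := hZ w hw
    rw [← h1] at t1 t2
    simp only [hty, h2, h3, Prod.mk.injEq] at t1 t2
    exact Finset.mem_filter.2 ⟨hZX hw, g1, g2, t1, t2⟩
  · intro w hw p _ _ hg
    obtain ⟨a, ha, b, hb, h2, h3⟩ := hsome w (Finset.mem_filter.1 hw).1 p hg
    exact Finset.mem_image.2 ⟨(a, b), Finset.mem_product.2 ⟨ha, hb⟩, by simp [hty, h2, h3]⟩
  · intro w hw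
    obtain ⟨-, h1, h2⟩ := Finset.mem_filter.1 hw
    have h3 := card_filter_succ_le k fun j => ¬ rightGood X ltr w j
    have h4 := card_filter_succ_le k fun j => ¬ leftGood X ltl w j
    -- A pair fails through one of four causes: right or left, at p or at p + 1. Each has fewer than
    -- m instances, up to one extra for the shifted ones.
    have hsub : ((Finset.Ico 0 k).filter fun p => ¬ goodPair X ltr ltl w p) ⊆
        (((Finset.range k).filter fun j => ¬ rightGood X ltr w j) ∪
          (Finset.range k).filter fun j => ¬ rightGood X ltr w (j + 1)) ∪
        (((Finset.range k).filter fun j => ¬ leftGood X ltl w j) ∪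
          (Finset.range k).filter fun j => ¬ leftGood X ltl w (j + 1)) := by
      intro p hp
      obtain ⟨hp1, hp2⟩ := Finset.mem_filter.1 hp
      have hpk := (Finset.mem_Ico.1 hp1).2
      simp only [Finset.mem_filter, Finset.mem_union, Finset.mem_range]
      unfold goodPair at hp2
      tauto
    have h5 := (Finset.card_le_card hsub).trans ((Finset.card_union_le _ _).trans
      (Nat.add_le_add (Finset.card_union_le _ _) (Finset.card_union_le _ _)))
    simp only [hbadr, hbadl] at h1 h2
    omega

/-! ### Concatenations -/

/-- The concatenation of the first `n` words of a sequence of words. -/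
def flat (g : ℕ → List ℕ+) (n : ℕ) : List ℕ+ := ((List.range n).map g).flatten

/-- The infinite concatenation of a sequence of words. -/
def cat (g : ℕ → List ℕ+) (n : ℕ) : ℕ+ := (flat g (n + 1)).getD n 1

theorem flat_succ (g : ℕ → List ℕ+) (n : ℕ) : flat g (n + 1) = flat g n ++ g n := by
  simp [flat, List.range_succ]

theorem flat_add (g : ℕ → List ℕ+) (m n : ℕ) :
    flat g (m + n) = flat g m ++ flat (fun k => g (m + k)) n := by
  simp [flat, List.range_add, Function.comp_def]

theorem le_length_flat {g : ℕ → List ℕ+} (hg : ∀ i, g i ≠ []) (n : ℕ) :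
    n ≤ (flat g n).length := by
  induction n with
  | zero => simp
  | succ n ih =>
    rw [flat_succ, List.length_append]
    have := List.length_pos_iff.2 (hg n)
    omega

/-- With nonempty words, i + 1 of them already cover position i, so the default value in `cat` is
never reached. -/
theorem getElem_flat_eq_cat {g : ℕ → List ℕ+} (hg : ∀ i, g i ≠ []) (n i : ℕ)
    (hi : i < (flat g n).length) : (flat g n)[i] = cat g i := by
  have hi' : i < (flat g (i + 1)).length := le_length_flat hg (i + 1)
  rw [cat, List.getD_eq_getElem _ _ hi']
  rcases Nat.le_total n (i + 1) with h | h
  · obtain ⟨m, hm⟩ := Nat.exists_eq_add_of_le h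
    simp only [hm, flat_add]
    rw [List.getElem_append_left]
  · obtain ⟨m, rfl⟩ := Nat.exists_eq_add_of_le h
    simp only [flat_add g (i + 1) m]
    rw [List.getElem_append_left]

theorem pre_cat {g : ℕ → List ℕ+} (hg : ∀ i, g i ≠ []) (n : ℕ) :
    pre (cat g) (flat g n).length = flat g n := by
  refine List.ext_getElem (by simp) fun i h1 h2 => ?_
  rw [pre_getElem, getElem_flat_eq_cat hg]

theorem cat_eq_getElem {g : ℕ → List ℕ+} (hg : ∀ i, g i ≠ []) (n k : ℕ)
    (hk : k < (g n).length) : cat g ((flat g n).length + k) = (g n)[k] := by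
  have h : (flat g n).length + k < (flat g (n + 1)).length := by
    rw [flat_succ, List.length_append]; omega
  rw [← getElem_flat_eq_cat hg (n + 1) _ h]
  simp only [flat_succ]
  rw [List.getElem_append_right (by omega)]
  simp

theorem cat_mem {g : ℕ → List ℕ+} (hg : ∀ i, g i ≠ []) (n : ℕ) : ∃ i, cat g n ∈ g i := by
  have hi : n < (flat g (n + 1)).length := le_length_flat hg (n + 1)
  have h := List.getElem_mem hi
  rw [getElem_flat_eq_cat hg] at h
  simp only [flat, List.mem_flatten, List.mem_map] at h
  obtain ⟨l, ⟨i, -, rfl⟩, hl⟩ := h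
  exact ⟨i, hl⟩

theorem continuant_flat_le {g : ℕ → List ℕ+} {P : ℕ} (hg : ∀ i, continuant (g i) ≤ P) (n : ℕ) :
    continuant (flat g n) ≤ (2 * P) ^ n := by
  induction n with
  | zero => simp [flat]
  | succ n ih =>
    rw [flat_succ, pow_succ]
    refine (continuant_append_le _ _).trans ?_
    have := Nat.mul_le_mul ih (hg n)
    linarith

/-- Every one-sided concatenation extends to a bi-infinite one. -/
theorem cfVal_cat_mem {B : Finset (List ℕ+)} (hB : IsAlphabet B) {g : ℕ → List ℕ+}
    (hg : ∀ i, g i ∈ B) : cfVal (cat g) ∈ gaussCantorSet B := by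
  have hne : ∀ i, g i ≠ [] := fun i => hB.ne_nil _ (hg i)
  set gr : ℕ → List ℕ+ := fun i => (g i).reverse with hgr
  have hner : ∀ i, gr i ≠ [] := fun i => by simpa [hgr] using hne i
  -- Any words of B may fill the negative half. Here g 0, g 1, … are placed from right to left; read
  -- leftwards they appear reversed, with position -1 as letter 0.
  set θ : ℤ → ℕ+ := fun n => if 0 ≤ n then cat g n.toNat else cat gr (-n - 1).toNat with hθ
  refine ⟨θ, ?_, ?_⟩
  · refine ⟨fun i => if 0 ≤ i then g i.toNat else g (-i - 1).toNat,
      fun i => if 0 ≤ i then ((flat g i.toNat).length : ℤ) else -((flat gr (-i).toNat).length : ℤ),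
      ?_, by simp [flat], ?_, ?_⟩
    · intro i
      dsimp only
      split_ifs <;> exact hg _
    · intro i
      dsimp only
      rcases lt_trichotomy i (-1) with h | h | h
      · rw [if_neg (by omega), if_neg (by omega), if_neg (by omega)]
        have : (-i).toNat = (-(i + 1)).toNat + 1 := by omega
        rw [this, flat_succ, List.length_append]
        have e : (-i - 1).toNat = (-(i + 1)).toNat := by omega
        rw [e]
        simp only [hgr, List.length_reverse]
        push_cast
        ring
      · subst h
        simp [flat, hgr]
      · rw [if_pos (by omega), if_pos (by omega), if_pos (by omega)]
        have : (i + 1).toNat = i.toNat + 1 := by omega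
        rw [this, flat_succ, List.length_append]
        push_cast
        ring
    · intro i k hk
      by_cases h : 0 ≤ i
      · simp only [h, if_true] at hk ⊢
        rw [hθ]
        dsimp only
        rw [if_pos (by omega)]
        have : (((flat g i.toNat).length : ℤ) + (k : ℤ)).toNat = (flat g i.toNat).length + k := by
          omega
        rw [this, cat_eq_getElem hne]
      · simp only [h, if_false] at hk ⊢
        set j := (-i - 1).toNat with hj
        have e : (-i).toNat = j + 1 := by omega
        rw [hθ, e]
        dsimp only
        have hlen : (flat gr (j + 1)).length = (flat gr j).length + (g j).length := by
          rw [flat_succ, List.length_append]; simp [hgr]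
        rw [hlen, if_neg (by push_cast; omega)]
        have : (-(-(((flat gr j).length + (g j).length : ℕ) : ℤ) + (k : ℤ)) - 1).toNat =
            (flat gr j).length + ((g j).length - 1 - k) := by push_cast; omega
        rw [this, cat_eq_getElem hner _ _ (by simp only [hgr, List.length_reverse]; omega)]
        simp only [hgr, List.getElem_reverse]
        congr 1
        omega
  · simp [hθ]

/-- Prefix-freeness makes the coding injective: if the concatenations agreed throughout, the shorter
of the two n-th words would be a beginning of the other. -/
theorem exists_cat_ne {B : Finset (List ℕ+)} (hB : IsAlphabet B) {g h : ℕ → List ℕ+}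
    (hg : ∀ i, g i ∈ B) (hh : ∀ i, h i ∈ B) {n : ℕ} (heq : ∀ i < n, g i = h i)
    (hne : g n ≠ h n) : ∃ i < (flat g (n + 1)).length, cat g i ≠ cat h i := by
  have hgn : ∀ i, g i ≠ [] := fun i => hB.ne_nil _ (hg i)
  have hhn : ∀ i, h i ≠ [] := fun i => hB.ne_nil _ (hh i)
  by_contra hcon
  push Not at hcon
  have hflat : flat g n = flat h n := by
    unfold flat
    rw [List.map_congr_left fun i hi => heq i (List.mem_range.1 hi)]
  have hlen : (flat g (n + 1)).length = (flat g n).length + (g n).length := by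
    rw [flat_succ, List.length_append]
  have key : ∀ k (h1 : k < (g n).length) (h2 : k < (h n).length), (g n)[k] = (h n)[k] := by
    intro k h1 h2
    rw [← cat_eq_getElem hgn, ← cat_eq_getElem hhn, ← hflat]
    exact hcon _ (by omega)
  rcases Nat.le_total (g n).length (h n).length with hl | hl
  · refine hB.prefix_free _ (hh n) _ (hg n) hne.symm ?_
    rw [List.prefix_iff_eq_take]
    refine List.ext_getElem (by simp [hl]) fun i h1 h2 => ?_
    rw [List.getElem_take]
    exact key i h1 (by omega)
  · refine hB.prefix_free _ (hg n) _ (hh n) hne ?_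
    rw [List.prefix_iff_eq_take]
    refine List.ext_getElem (by simp [hl]) fun i h1 h2 => ?_
    rw [List.getElem_take]
    exact (key i (by omega) h1).symm

/-- A lower bound for the Hausdorff dimension of a Gauss–Cantor set. -/
theorem le_dimH_gaussCantorSet {B : Finset (List ℕ+)} (hB : IsAlphabet B)
    (h4 : ∀ β ∈ B, ∀ a ∈ β, a ≤ 4) {P : ℕ} (hP : 1 ≤ P) (hQ : ∀ β ∈ B, continuant β ≤ P) :
    ENNReal.ofReal (Real.log B.card / (2 * Real.log (2 * P))) ≤ dimH (gaussCantorSet B) := by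
  set M := B.card with hM
  have hM2 : 2 ≤ M := hB.two_le_card
  have hMr : (2 : ℝ) ≤ M := by exact_mod_cast hM2
  have hPr : (1 : ℝ) ≤ P := by exact_mod_cast hP
  have hlogM : 0 < Real.log M := Real.log_pos (by linarith)
  have hlogP : 0 < Real.log (2 * P) := Real.log_pos (by linarith)
  set s := Real.log M / (2 * Real.log (2 * P)) with hs
  have hs0 : 0 < s := by positivity
  set enum : Fin M → List ℕ+ := fun i => (B.equivFin.symm i : List ℕ+) with henum
  have henumB : ∀ i, enum i ∈ B := fun i => (B.equivFin.symm i).2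
  have henum_inj : Function.Injective enum := fun i j h =>
    B.equivFin.symm.injective (Subtype.ext h)
  set F : (ℕ → Fin M) → ℝ := fun d => cfVal (cat fun i => enum (d i)) with hF
  set C : ℝ := M * 500 ^ s with hC
  have hC0 : 0 ≤ C := by positivity
  -- The exponent s is chosen so that one word shrinks lengths by M⁻¹ when they are raised to the
  -- power s.
  have hpow : ((2 * P : ℝ) ^ 2) ^ s = M := by
    rw [← Real.exp_log (show (0 : ℝ) < M by linarith), Real.rpow_def_of_pos (by positivity),
      Real.log_pow, hs]
    congr 1
    push_cast
    field_simp
  -- Reading the code of a point as base-M digits is s-Hölder. After n common words the digits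
  -- differ by at most M⁻ⁿ and the points by at least (2P)^(-2(n+1))/500; C absorbs 500^s and the
  -- extra factor M.
  have key : ∀ d d' : ℕ → Fin M, |Real.ofDigits d - Real.ofDigits d'| ≤ C * |F d - F d'| ^ s := by
    intro d d'
    by_cases hdd : d = d'
    · subst hdd
      simp only [sub_self, abs_zero]
      positivity
    have hex : ∃ n, d n ≠ d' n := by
      by_contra hcon
      push Not at hcon
      exact hdd (funext hcon)
    have hn := Nat.find_spec hex
    set n := Nat.find hex with hndef
    have hmin : ∀ i < n, d i = d' i := fun i hi => by
      simpa using Nat.find_min hex hi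
    have h1 : |Real.ofDigits d - Real.ofDigits d'| ≤ ((M : ℝ) ^ n)⁻¹ := by
      have := Real.abs_ofDigits_sub_ofDigits_le (x := d) (y := d') (n := n) hmin
      simpa using this
    have hdig : ∀ d : ℕ → Fin M, ∀ i, cat (fun i => enum (d i)) i ≤ 4 := by
      intro d i
      obtain ⟨j, hj⟩ := cat_mem (g := fun i => enum (d i)) (fun i => hB.ne_nil _ (henumB _)) i
      exact h4 _ (henumB _) _ hj
    have h2 := le_abs_cfVal_sub (hdig d) (hdig d') (exists_cat_ne hB
      (g := fun i => enum (d i)) (h := fun i => enum (d' i)) (fun i => henumB _) (fun i => henumB _)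
      (n := n) (fun i hi => by simp only [hmin i hi]) (fun he => hn (henum_inj he)))
    rw [pre_cat fun i => hB.ne_nil _ (henumB _)] at h2
    have h3 : (continuant (flat (fun i => enum (d i)) (n + 1)) : ℝ) ≤ (2 * P : ℝ) ^ (n + 1) := by
      exact_mod_cast continuant_flat_le (g := fun i => enum (d i)) (fun i => hQ _ (henumB _)) (n + 1)
    have hq : (0 : ℝ) < continuant (flat (fun i => enum (d i)) (n + 1)) := by
      exact_mod_cast continuant_pos _
    have h4 : 1 / (500 * ((2 * P : ℝ) ^ 2) ^ (n + 1)) ≤ |F d - F d'| := by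
      refine le_trans ?_ h2
      have : ((2 * P : ℝ) ^ 2) ^ (n + 1) = ((2 * P : ℝ) ^ (n + 1)) ^ 2 := by
        rw [← pow_mul, ← pow_mul, mul_comm 2 (n + 1)]
      rw [this]
      gcongr
    have h5 := Real.rpow_le_rpow (by positivity) h4 hs0.le
    have h6 : (1 / (500 * ((2 * P : ℝ) ^ 2) ^ (n + 1))) ^ s = 1 / (500 ^ s * (M : ℝ) ^ (n + 1)) := by
      rw [Real.div_rpow zero_le_one (by positivity), Real.one_rpow,
        Real.mul_rpow (by norm_num) (by positivity), ← Real.rpow_natCast, ← Real.rpow_mul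
        (by positivity), mul_comm ((n + 1 : ℕ) : ℝ) s, Real.rpow_mul (by positivity), hpow,
        Real.rpow_natCast]
    rw [h6] at h5
    calc _ ≤ ((M : ℝ) ^ n)⁻¹ := h1
      _ = C * (1 / (500 ^ s * (M : ℝ) ^ (n + 1))) := by
        rw [hC, pow_succ]
        have : (0 : ℝ) < 500 ^ s := by positivity
        field_simp
      _ ≤ _ := by gcongr
  have hFmem : Set.range F ⊆ gaussCantorSet B := by
    rintro _ ⟨d, rfl⟩
    exact cfVal_cat_mem hB fun i => henumB _
  classical
  -- Well defined on the range of F, since `key` makes equal points have equal digit values. The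
  -- image covers [0, 1], so the domain has dimension at least s.
  set f : ℝ → ℝ := fun x => if h : ∃ d, F d = x then Real.ofDigits h.choose else 0 with hf
  have hfF : ∀ d, f (F d) = Real.ofDigits d := by
    intro d
    have hex : ∃ d', F d' = F d := ⟨d, rfl⟩
    have h1 := key hex.choose d
    rw [hex.choose_spec, sub_self, abs_zero, Real.zero_rpow hs0.ne', mul_zero] at h1
    simp only [hf, dif_pos hex]
    exact sub_eq_zero.1 (abs_eq_zero.1 (le_antisymm h1 (abs_nonneg _)))
  have hhol : HolderOnWith C.toNNReal s.toNNReal f (Set.range F) := by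
    rintro _ ⟨d, rfl⟩ _ ⟨d', rfl⟩
    rw [hfF, hfF, edist_dist, edist_dist, Real.dist_eq, Real.dist_eq, Real.coe_toNNReal _ hs0.le]
    have h1 := ENNReal.ofReal_le_ofReal (key d d')
    rwa [ENNReal.ofReal_mul hC0, ← ENNReal.ofReal_rpow_of_nonneg (abs_nonneg _) hs0.le] at h1
  have himg : Set.Icc (0 : ℝ) 1 ⊆ f '' Set.range F := by
    intro z hz
    obtain ⟨d, -, hd⟩ := Real.ofDigits_SurjOn (b := M) (by omega) hz
    exact ⟨F d, ⟨d, rfl⟩, by rw [hfF, hd]⟩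
  have hdim := hhol.dimH_image_le (Real.toNNReal_pos.2 hs0)
  have hone : (1 : ENNReal) ≤ dimH (f '' Set.range F) := by
    refine le_trans (le_of_eq ?_) (dimH_mono himg)
    rw [Real.dimH_of_nonempty_interior]
    · simp
    · rw [interior_Icc]; exact ⟨1 / 2, by norm_num, by norm_num⟩
  have hfin := hone.trans hdim
  rw [ENNReal.le_div_iff_mul_le (Or.inl (by simpa using hs0)) (Or.inl ENNReal.coe_ne_top),
    one_mul] at hfin
  exact hfin.trans (dimH_mono hFmem)

/-! ### Heights along the orbit -/

/-- The height of the shifted sequence. -/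
def heightAt (θ : ℤ → ℕ+) (n : ℤ) : ℝ :=
  ((θ n : ℕ) : ℝ) + cfVal (fun m : ℕ => θ (n + 1 + m)) + cfVal (fun m : ℕ => θ (n - 1 - m))

theorem height_shift (θ : ℤ → ℕ+) (n : ℤ) : height (fun k => θ (k + n)) = heightAt θ n := by
  have h1 : (fun m : ℕ => θ ((m : ℤ) + 1 + n)) = fun m : ℕ => θ (n + 1 + m) := by
    funext m; congr 1; ring
  have h2 : (fun m : ℕ => θ (-((m : ℤ) + 1) + n)) = fun m : ℕ => θ (n - 1 - m) := by
    funext m; congr 1; ring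
  simp only [height, heightAt, zero_add, h1, h2]

theorem mem_sigmaLe {t : ℝ} {θ : ℤ → ℕ+} : θ ∈ sigmaLe t ↔ ∀ n, heightAt θ n ≤ t := by
  simp only [sigmaLe, Set.mem_ofPred_eq, markovValue, iSup_le_iff, EReal.coe_le_coe_iff,
    height_shift]

theorem heightAt_shift (θ : ℤ → ℕ+) (m n : ℤ) :
    heightAt (fun k => θ (k + m)) n = heightAt θ (n + m) := by
  rw [← height_shift, ← height_shift]
  congr 1
  funext k
  congr 1
  ring

theorem shift_mem_sigmaLe {t : ℝ} {θ : ℤ → ℕ+} (h : θ ∈ sigmaLe t) (m : ℤ) :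
    (fun k => θ (k + m)) ∈ sigmaLe t := by
  rw [mem_sigmaLe] at h ⊢
  intro n
  rw [heightAt_shift]
  exact h _

theorem le_four_of_mem_sigmaLe {t : ℝ} (ht : t < 5) {θ : ℤ → ℕ+} (h : θ ∈ sigmaLe t) (n : ℤ) :
    θ n ≤ 4 := by
  have h1 := mem_sigmaLe.1 h n
  rw [heightAt] at h1
  have h2 := cfVal_nonneg (fun m : ℕ => θ (n + 1 + m))
  have h3 := cfVal_nonneg (fun m : ℕ => θ (n - 1 - m))
  have h4 : ((θ n : ℕ) : ℝ) < 5 := by linarith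
  have h5 : (θ n : ℕ) < 5 := by exact_mod_cast h4
  exact Nat.lt_succ_iff.1 h5

/-! ### Occurrences of words -/

theorem eq_of_pre_eq {a b : ℕ → ℕ+} {n : ℕ} (h : pre a n = pre b n) : ∀ i < n, a i = b i :=
  fun i hi => List.map_inj_left.1 h i (List.mem_range.2 hi)

/-- The word `u` occurs in `θ` at position `n`. -/
def Occ (u : List ℕ+) (θ : ℤ → ℕ+) (n : ℤ) : Prop :=
  ∀ (i : ℕ) (h : i < u.length), θ (n + i) = u[i]

theorem occ_append {u v : List ℕ+} {θ : ℤ → ℕ+} {n : ℤ} :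
    Occ (u ++ v) θ n ↔ Occ u θ n ∧ Occ v θ (n + u.length) := by
  constructor
  · intro h
    refine ⟨fun i hi => ?_, fun i hi => ?_⟩
    · rw [h i (by rw [List.length_append]; omega), List.getElem_append_left hi]
    · have := h (u.length + i) (by rw [List.length_append]; omega)
      rw [List.getElem_append_right (by omega)] at this
      simp only [Nat.add_sub_cancel_left, Nat.cast_add, ← add_assoc] at this
      exact this
  · rintro ⟨h1, h2⟩ i hi
    rw [List.length_append] at hi
    by_cases h : i < u.length
    · rw [List.getElem_append_left h, h1 i h]
    · rw [List.getElem_append_right (by omega), ← h2 (i - u.length) (by omega)]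
      congr 1
      omega

theorem occ_cons {c : ℕ+} {v : List ℕ+} {θ : ℤ → ℕ+} {n : ℤ} :
    Occ (c :: v) θ n ↔ θ n = c ∧ Occ v θ (n + 1) := by
  rw [← List.singleton_append, occ_append]
  refine and_congr ⟨fun h => by simpa using h 0 (by simp), fun h i hi => ?_⟩ (by simp)
  have : i = 0 := by simpa using hi
  subst this
  simpa using h

theorem Occ.shift {u : List ℕ+} {θ : ℤ → ℕ+} {n : ℤ} (h : Occ u θ n) (m : ℤ) :
    Occ u (fun k => θ (k + (n - m))) m := by
  intro i hi
  rw [← h i hi]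
  change θ (m + i + (n - m)) = θ (n + i)
  congr 1
  ring

theorem Occ.pre_forward {u : List ℕ+} {θ : ℤ → ℕ+} {n : ℤ} (h : Occ u θ n) :
    pre (fun m : ℕ => θ (n + m)) u.length = u :=
  List.ext_getElem (by simp) fun i _ h2 => by rw [pre_getElem, h i h2]

theorem Occ.pre_backward {u : List ℕ+} {θ : ℤ → ℕ+} {n : ℤ} (h : Occ u θ (n - u.length)) :
    pre (fun m : ℕ => θ (n - 1 - m)) u.reverse.length = u.reverse := by
  refine List.ext_getElem (by simp) fun i _ h2 => ?_
  rw [List.length_reverse] at h2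
  rw [pre_getElem, List.getElem_reverse, ← h (u.length - 1 - i) (by omega)]
  congr 1
  omega

theorem occ_pre (θ : ℤ → ℕ+) (n : ℤ) (l : ℕ) : Occ (pre (fun m : ℕ => θ (n + m)) l) θ n := by
  intro i hi
  rw [pre_getElem]

/-- The words occurring in sequences of Markov value at most `t`. -/
def Lang (t : ℝ) (u : List ℕ+) : Prop := ∃ θ ∈ sigmaLe t, ∃ n, Occ u θ n

theorem Lang.exists_at {t : ℝ} {u : List ℕ+} (h : Lang t u) (n : ℤ) :
    ∃ θ ∈ sigmaLe t, Occ u θ n := by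
  obtain ⟨θ, hθ, m, hm⟩ := h
  exact ⟨_, shift_mem_sigmaLe hθ (m - n), hm.shift n⟩

theorem Lang.of_infix {t : ℝ} {u v : List ℕ+} (h : Lang t v) (huv : u <:+: v) : Lang t u := by
  obtain ⟨x, y, rfl⟩ := huv
  obtain ⟨θ, hθ, m, hm⟩ := h
  exact ⟨θ, hθ, _, (occ_append.1 (occ_append.1 hm).1).2⟩

theorem Lang.le_four {t : ℝ} (ht : t < 5) {u : List ℕ+} (h : Lang t u) : ∀ a ∈ u, a ≤ 4 := by
  intro a ha
  obtain ⟨θ, hθ, m, hm⟩ := h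
  obtain ⟨i, hi, rfl⟩ := List.mem_iff_getElem.1 ha
  rw [← hm i hi]
  exact le_four_of_mem_sigmaLe ht hθ _

/-! ### Comparison of heights -/

/-- If the word `x` on the right may be replaced by a smaller and by a greater one, the height is
definitely smaller than `t`, up to an error depending on what is known on the left. -/
theorem heightAt_le_of_right {t : ℝ} (ht : t < 5) {θ : ℤ → ℕ+} (h4 : ∀ n, θ n ≤ 4) {n : ℤ}
    {y z x : List ℕ+} {c : ℕ+} (hy : Occ y θ (n - y.length)) (hc : θ n = c)
    (hzx : Occ (z ++ x) θ (n + 1))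
    (hlo : ∃ v, Lang t (y ++ c :: (z ++ v)) ∧ cfLt v x)
    (hhi : ∃ v, Lang t (y ++ c :: (z ++ v)) ∧ cfLt x v) :
    heightAt θ n ≤ t - 1 / (500 * (continuant (z ++ x) : ℝ) ^ 2) +
      1 / (continuant y : ℝ) ^ 2 := by
  obtain ⟨v, hv, hcmp⟩ := exists_cfVal_add_le (fun i : ℕ => h4 (n + 1 + i)) hzx.pre_forward _
    hlo hhi
  -- A sequence of Σ_t with the same y and c and a larger right half: its height is at most t, and
  -- at least that of θ plus the gain minus the discrepancy on the left.
  obtain ⟨θ', hθ', hocc⟩ := hv.exists_at (n - y.length)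
  obtain ⟨hy', hrest⟩ := occ_append.1 hocc
  rw [sub_add_cancel, occ_cons] at hrest
  have h1 := hcmp (fun m : ℕ => θ' (n + 1 + m)) (fun i => le_four_of_mem_sigmaLe ht hθ' _)
    hrest.2.pre_forward
  have h2 : |cfVal (fun m : ℕ => θ (n - 1 - m)) - cfVal (fun m : ℕ => θ' (n - 1 - m))| ≤
      1 / (continuant y : ℝ) ^ 2 := by
    have hag : ∀ i < y.reverse.length, θ (n - 1 - i) = θ' (n - 1 - i) := by
      intro i hi
      exact eq_of_pre_eq (hy.pre_backward.trans hy'.pre_backward.symm) i hi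
    have := abs_cfVal_sub_le (a := fun m : ℕ => θ (n - 1 - m)) (b := fun m : ℕ => θ' (n - 1 - m))
      hag
    rwa [hy.pre_backward, continuant_reverse] at this
  have h3 := mem_sigmaLe.1 hθ' n
  rw [heightAt, hrest.1] at h3
  rw [heightAt, hc]
  have h5 := (abs_le.1 h2).2
  linarith

/-- The mirror image of `heightAt_le_of_right`. -/
theorem heightAt_le_of_left {t : ℝ} (ht : t < 5) {θ : ℤ → ℕ+} (h4 : ∀ n, θ n ≤ 4) {n : ℤ}
    {y z x : List ℕ+} {c : ℕ+} (hxz : Occ (x ++ z) θ (n - (x ++ z).length)) (hc : θ n = c)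
    (hy : Occ y θ (n + 1))
    (hlo : ∃ v, Lang t ((v ++ z) ++ c :: y) ∧ cfLt v.reverse x.reverse)
    (hhi : ∃ v, Lang t ((v ++ z) ++ c :: y) ∧ cfLt x.reverse v.reverse) :
    heightAt θ n ≤ t - 1 / (500 * (continuant (x ++ z) : ℝ) ^ 2) +
      1 / (continuant y : ℝ) ^ 2 := by
  have hpre := hxz.pre_backward
  rw [List.reverse_append] at hpre
  obtain ⟨v, hv, hcmp⟩ := exists_cfVal_add_le (fun i : ℕ => h4 (n - 1 - i)) hpre
    (fun v => Lang t ((v.reverse ++ z) ++ c :: y))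
    (by obtain ⟨v, h1, h2⟩ := hlo; exact ⟨v.reverse, by rwa [List.reverse_reverse], h2⟩)
    (by obtain ⟨v, h1, h2⟩ := hhi; exact ⟨v.reverse, by rwa [List.reverse_reverse], h2⟩)
  obtain ⟨θ', hθ', hocc⟩ := hv.exists_at (n - (v.reverse ++ z).length)
  obtain ⟨hvz', hrest⟩ := occ_append.1 hocc
  rw [sub_add_cancel, occ_cons] at hrest
  have hpre' := hvz'.pre_backward
  rw [List.reverse_append, List.reverse_reverse] at hpre'
  have h1 := hcmp (fun m : ℕ => θ' (n - 1 - m)) (fun i => le_four_of_mem_sigmaLe ht hθ' _) hpre'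
  have h2 : |cfVal (fun m : ℕ => θ (n + 1 + m)) - cfVal (fun m : ℕ => θ' (n + 1 + m))| ≤
      1 / (continuant y : ℝ) ^ 2 := by
    have := abs_cfVal_sub_le (a := fun m : ℕ => θ (n + 1 + m)) (b := fun m : ℕ => θ' (n + 1 + m))
      (eq_of_pre_eq (hy.pre_forward.trans hrest.2.pre_forward.symm))
    rwa [hy.pre_forward] at this
  have h3 := mem_sigmaLe.1 hθ' n
  rw [heightAt, hrest.1] at h3
  rw [heightAt, hc]
  rw [← List.reverse_append, continuant_reverse] at h1
  have h5 := (abs_le.1 h2).2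
  linarith

/-! ### Loops -/

/-- A word `b ++ m ++ a` such that, in `a ++ b ++ m ++ a ++ b`, the first two and the last two
pieces have neighbours on both sides. -/
structure GoodLoop (t : ℝ) (a b m : List ℕ+) : Prop where
  left_a_lo : ∃ v, Lang t (v ++ (b ++ (m ++ (a ++ b)))) ∧ cfLt v.reverse a.reverse
  left_a_hi : ∃ v, Lang t (v ++ (b ++ (m ++ (a ++ b)))) ∧ cfLt a.reverse v.reverse
  left_b_lo : ∃ v, Lang t (v ++ (m ++ (a ++ b))) ∧ cfLt v.reverse b.reverse
  left_b_hi : ∃ v, Lang t (v ++ (m ++ (a ++ b))) ∧ cfLt b.reverse v.reverse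
  right_a_lo : ∃ v, Lang t (a ++ (b ++ (m ++ v))) ∧ cfLt v a
  right_a_hi : ∃ v, Lang t (a ++ (b ++ (m ++ v))) ∧ cfLt a v
  right_b_lo : ∃ v, Lang t (a ++ (b ++ (m ++ (a ++ v)))) ∧ cfLt v b
  right_b_hi : ∃ v, Lang t (a ++ (b ++ (m ++ (a ++ v)))) ∧ cfLt b v

/-- The loss 1/h² is at most half the gain 1/(500 g²). Here g belongs to the modified side and h to
the side left unchanged. -/
theorem gain_sub_loss_le {g h : ℕ} (hg : 0 < g) (hgh : 1000 * g ^ 2 ≤ h ^ 2) {G : ℕ} (hG : g ≤ G)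
    {t x : ℝ} (hx : x ≤ t - 1 / (500 * (g : ℝ) ^ 2) + 1 / (h : ℝ) ^ 2) :
    x ≤ t - 1 / (1000 * (G : ℝ) ^ 2) := by
  have hg' : (0 : ℝ) < g := by exact_mod_cast hg
  have hG' : (g : ℝ) ≤ G := by exact_mod_cast hG
  have h1 : 1000 * (g : ℝ) ^ 2 ≤ (h : ℝ) ^ 2 := by exact_mod_cast hgh
  have h2 : 1 / (h : ℝ) ^ 2 ≤ 1 / (1000 * (g : ℝ) ^ 2) :=
    one_div_le_one_div_of_le (by positivity) h1
  have h3 : 1 / (1000 * (G : ℝ) ^ 2) ≤ 1 / (1000 * (g : ℝ) ^ 2) := by gcongr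
  have h4 : 1 / (500 * (g : ℝ) ^ 2) = 2 * (1 / (1000 * (g : ℝ) ^ 2)) := by field_simp; norm_num
  linarith

theorem exists_split_of_occ {u : List ℕ+} {θ : ℤ → ℕ+} {n₀ n : ℤ} (h : Occ u θ n₀) (h1 : n₀ ≤ n)
    (h2 : n < n₀ + u.length) : ∃ u₁ u₂, u = u₁ ++ θ n :: u₂ ∧ n = n₀ + u₁.length := by
  obtain ⟨i, rfl⟩ := Int.le.dest h1
  have hi : i < u.length := by omega
  refine ⟨u.take i, u.drop (i + 1), ?_, ?_⟩
  · rw [h i hi]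
    simp
  · simp [List.length_take]; omega

/-- A place in the first b modifies the a on its left, a place in the last a modifies the b on its
right, and a place in m modifies the nearer of the inner b and a. Each time, the opposite side is
known much further. -/
theorem heightAt_le_of_goodLoop {t : ℝ} (ht : t < 5) {θ : ℤ → ℕ+} (h4 : ∀ n, θ n ≤ 4)
    {a b m : List ℕ+} (hl : GoodLoop t a b m) {R : ℕ} (hR : 1600 ≤ R)
    (ha : R ≤ continuant a) (ha' : continuant a ≤ 5 * R) (hb : R ≤ continuant b)
    (hb' : continuant b ≤ 5 * R) (hm : R ≤ continuant m) {n₀ n : ℤ}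
    (hocc : Occ (a ++ (b ++ (m ++ (a ++ b)))) θ (n₀ - a.length)) (h1 : n₀ ≤ n)
    (h2 : n < n₀ + b.length + m.length + a.length) :
    heightAt θ n ≤ t - 1 / (1000 * (continuant (a ++ (b ++ (m ++ (a ++ b)))) : ℝ) ^ 2) := by
  obtain ⟨ha1, hocc1⟩ := occ_append.1 hocc
  rw [sub_add_cancel] at hocc1
  obtain ⟨hb1, hocc2⟩ := occ_append.1 hocc1
  obtain ⟨hm1, hocc3⟩ := occ_append.1 hocc2
  obtain ⟨ha2, hb2⟩ := occ_append.1 hocc3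
  -- The source of R ≥ 1600: this needs R² ≥ 1000·50². Two partial blocks on the modified side stand
  -- against three full pieces on the other.
  have hlin : 1000 * (50 * R ^ 2) ^ 2 ≤ (R ^ 3) ^ 2 := by
    have : 2500000 ≤ R ^ 2 := by nlinarith
    calc 1000 * (50 * R ^ 2) ^ 2 = 2500000 * R ^ 4 := by ring
      _ ≤ R ^ 2 * R ^ 4 := Nat.mul_le_mul_right _ this
      _ = (R ^ 3) ^ 2 := by ring
  have hcube : ∀ {g h : ℕ}, g ≤ 50 * R ^ 2 → R ^ 3 ≤ h → 1000 * g ^ 2 ≤ h ^ 2 := by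
    intro g h hg hh
    exact (Nat.mul_le_mul_left _ (Nat.pow_le_pow_left hg 2)).trans
      (hlin.trans (Nat.pow_le_pow_left hh 2))
  have hmul : ∀ {g h h' : ℕ}, g ≤ h → h * R ≤ h' → 1000 * g ^ 2 ≤ h' ^ 2 := by
    intro g h h' hg hh
    calc 1000 * g ^ 2 ≤ R ^ 2 * h ^ 2 := Nat.mul_le_mul (by nlinarith) (Nat.pow_le_pow_left hg 2)
      _ = (h * R) ^ 2 := by ring
      _ ≤ _ := Nat.pow_le_pow_left hh 2
  have hR3 : ∀ {x y z : ℕ}, R ≤ x → R ≤ y → R ≤ z → R ^ 3 ≤ x * (y * z) := by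
    intro x y z hx hy hz
    calc R ^ 3 = R * (R * R) := by ring
      _ ≤ _ := Nat.mul_le_mul hx (Nat.mul_le_mul hy hz)
  have h50 : ∀ {u v : List ℕ+}, continuant u ≤ 5 * R → continuant v ≤ 5 * R →
      continuant (u ++ v) ≤ 50 * R ^ 2 := by
    intro u v hu hv
    refine (continuant_append_le u v).trans ?_
    have := Nat.mul_le_mul hu hv
    nlinarith
  by_cases c1 : n < n₀ + b.length
  · obtain ⟨b₁, b₂, hbs, hn⟩ := exists_split_of_occ hb1 h1 c1
    have hsplit : ∀ r, b ++ r = b₁ ++ θ n :: (b₂ ++ r) := by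
      intro r; conv_lhs => rw [hbs]
      simp
    have hb₁ : continuant b₁ ≤ continuant b := by
      conv_rhs => rw [hbs]
      exact continuant_le_append_right _ _
    rw [hsplit, ← List.append_assoc] at hocc
    obtain ⟨o1, o2⟩ := occ_append.1 hocc
    have hpos : n₀ - a.length = n - (a ++ b₁).length := by
      rw [List.length_append]; push_cast; omega
    rw [hpos] at o1 o2
    rw [sub_add_cancel] at o2
    have key := heightAt_le_of_left ht h4 o1 rfl (occ_cons.1 o2).2
      (by obtain ⟨v, h, h'⟩ := hl.left_a_lo
          rw [hsplit, ← List.append_assoc] at h; exact ⟨v, h, h'⟩)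
      (by obtain ⟨v, h, h'⟩ := hl.left_a_hi
          rw [hsplit, ← List.append_assoc] at h; exact ⟨v, h, h'⟩)
    refine gain_sub_loss_le (continuant_pos _) (hcube (h50 ha' (hb₁.trans hb')) ?_) ?_ key
    · refine (hR3 hm ha hb).trans ?_
      refine (Nat.mul_le_mul_left _ (continuant_mul_le _ _)).trans ?_
      exact (continuant_mul_le _ _).trans (continuant_le_append_left _ _)
    · rw [hsplit, ← List.append_assoc]
      exact continuant_le_append_right _ _
  by_cases c2 : n < n₀ + b.length + m.length
  · obtain ⟨m₁, m₂, hms, hn⟩ := exists_split_of_occ hm1 (by omega) c2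
    have hsplit : ∀ r, m ++ r = m₁ ++ θ n :: (m₂ ++ r) := by
      intro r; conv_lhs => rw [hms]
      simp
    have o := hocc1
    rw [hsplit, ← List.append_assoc] at o
    obtain ⟨o1, o2⟩ := occ_append.1 o
    have hpos : n₀ = n - (b ++ m₁).length := by
      rw [List.length_append]; push_cast; omega
    have o1' := o1
    rw [hpos] at o1' o2
    rw [sub_add_cancel] at o2
    -- The side with the smaller continuant is modified. The other side continues by one more block,
    -- whose factor R makes the loss negligible.
    rcases Nat.le_total (continuant (b ++ m₁)) (continuant (m₂ ++ a)) with hle | hle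
    · have key := heightAt_le_of_left ht h4 o1' rfl (occ_cons.1 o2).2
        (by obtain ⟨v, h, h'⟩ := hl.left_b_lo
            rw [hsplit, ← List.append_assoc] at h; exact ⟨v, h, h'⟩)
        (by obtain ⟨v, h, h'⟩ := hl.left_b_hi
            rw [hsplit, ← List.append_assoc] at h; exact ⟨v, h, h'⟩)
      refine gain_sub_loss_le (continuant_pos _) (hmul hle ?_) ?_ key
      · rw [← List.append_assoc]
        exact (Nat.mul_le_mul_left _ hb).trans (continuant_mul_le _ _)
      · rw [hsplit, ← List.append_assoc b]
        exact (continuant_le_append_right _ _).trans (continuant_le_append_left _ _)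
    · have o3 := (occ_cons.1 o2).2
      rw [← List.append_assoc] at o3
      have o4 : Occ (a ++ (b ++ m₁)) θ (n - (a ++ (b ++ m₁)).length) := by
        have e : n - (a ++ (b ++ m₁)).length = n₀ - a.length := by
          rw [hpos]; simp only [List.length_append]; push_cast; ring
        rw [e]
        refine occ_append.2 ⟨ha1, ?_⟩
        rw [sub_add_cancel]
        exact o1
      have hfix : ∀ v, a ++ (b ++ (m ++ v)) = (a ++ (b ++ m₁)) ++ θ n :: (m₂ ++ v) := by
        intro v; rw [hsplit]; simp
      have key := heightAt_le_of_right ht h4 o4 rfl (occ_append.1 o3).1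
        (by obtain ⟨v, h, h'⟩ := hl.right_a_lo
            rw [hfix] at h; exact ⟨v, h, h'⟩)
        (by obtain ⟨v, h, h'⟩ := hl.right_a_hi
            rw [hfix] at h; exact ⟨v, h, h'⟩)
      refine gain_sub_loss_le (continuant_pos _) (hmul hle ?_) ?_ key
      · rw [mul_comm]
        exact (Nat.mul_le_mul_right _ ha).trans (continuant_mul_le _ _)
      · rw [hfix, ← List.append_assoc m₂, ← List.singleton_append, ← List.append_assoc]
        exact (continuant_le_append_right _ b).trans (continuant_le_append_left _ _)
  · obtain ⟨a₁, a₂, has, hn⟩ := exists_split_of_occ ha2 (by omega) h2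
    have hsplit : ∀ r, a ++ r = a₁ ++ θ n :: (a₂ ++ r) := by
      intro r; conv_lhs => rw [has]
      simp
    have ha₂ : continuant a₂ ≤ continuant a := by
      conv_rhs => rw [has, ← List.singleton_append, ← List.append_assoc]
      exact continuant_le_append_left _ _
    have hfix : ∀ v, a ++ (b ++ (m ++ (a ++ v))) =
        (a ++ (b ++ (m ++ a₁))) ++ θ n :: (a₂ ++ v) := by
      intro v; rw [hsplit v]; simp
    have o := hocc
    rw [hfix] at o
    obtain ⟨o1, o2⟩ := occ_append.1 o
    have hpos : n₀ - a.length = n - (a ++ (b ++ (m ++ a₁))).length := by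
      rw [hn]; simp only [List.length_append]; push_cast; ring
    rw [hpos] at o1 o2
    rw [sub_add_cancel] at o2
    have key := heightAt_le_of_right ht h4 o1 rfl (occ_cons.1 o2).2
      (by obtain ⟨v, h, h'⟩ := hl.right_b_lo
          rw [hfix] at h; exact ⟨v, h, h'⟩)
      (by obtain ⟨v, h, h'⟩ := hl.right_b_hi
          rw [hfix] at h; exact ⟨v, h, h'⟩)
    refine gain_sub_loss_le (continuant_pos _) (hcube (h50 (ha₂.trans ha') hb') ?_) ?_ key
    · refine (hR3 ha hb hm).trans ?_
      refine (Nat.mul_le_mul_left _ (continuant_mul_le _ _)).trans ?_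
      refine (continuant_mul_le _ _).trans ?_
      have e : a ++ (b ++ (m ++ a₁)) = (a ++ (b ++ m)) ++ a₁ := by simp
      rw [e]
      exact continuant_le_append_right _ _
    · rw [hfix, ← List.singleton_append, ← List.append_assoc]
      exact continuant_le_append_left _ _

/-! ### From loops to complete shifts -/

theorem exists_block_containing {c : ℤ → ℤ} {l : ℤ → ℕ} (hc0 : c 0 = 0)
    (hc : ∀ i, c (i + 1) = c i + l i) (hl : ∀ i, 0 < l i) (n : ℤ) :
    ∃ i, c i ≤ n ∧ n < c (i + 1) := by
  have hup : ∀ k : ℕ, (k : ℤ) ≤ c k := by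
    intro k
    induction k with
    | zero => simp [hc0]
    | succ k ih =>
      have := hc k
      have := hl k
      push_cast
      omega
  have hdown : ∀ k : ℕ, c (-k) ≤ -(k : ℤ) := by
    intro k
    induction k with
    | zero => simp [hc0]
    | succ k ih =>
      have h1 := hc (-((k + 1 : ℕ) : ℤ))
      have h2 := hl (-((k + 1 : ℕ) : ℤ))
      have e : -((k + 1 : ℕ) : ℤ) + 1 = -(k : ℤ) := by push_cast; ring
      rw [e] at h1
      push_cast at *
      omega
  obtain ⟨i, hi, hmax⟩ := Int.exists_greatest_of_bdd (P := fun i => c i ≤ n)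
    ⟨n.natAbs, fun z hz => by
      by_contra hcon
      have hz0 : (z.toNat : ℤ) = z := Int.toNat_of_nonneg (by omega)
      have := hup z.toNat
      rw [hz0] at this
      omega⟩
    ⟨-(n.natAbs : ℤ), by have := hdown n.natAbs; omega⟩
  refine ⟨i, hi, ?_⟩
  by_contra hcon
  have := hmax (i + 1) (not_lt.1 hcon)
  omega

/-- The preceding word ends in a and the following one begins with b, so every b m a sits inside a b
m a b, where the loop estimate applies. Finiteness of B makes δ uniform. -/
theorem completeShift_subset_of_goodLoop {t : ℝ} (ht : t < 5) {B : Finset (List ℕ+)}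
    {a b : List ℕ+} {R : ℕ} (hR : 1600 ≤ R)
    (ha : R ≤ continuant a) (ha' : continuant a ≤ 5 * R) (hb : R ≤ continuant b)
    (hb' : continuant b ≤ 5 * R)
    (hB : ∀ β ∈ B, ∃ m, β = b ++ (m ++ a) ∧ R ≤ continuant m ∧ GoodLoop t a b m)
    (hB4 : ∀ β ∈ B, ∀ x ∈ β, x ≤ 4) (hne : ∀ β ∈ B, β ≠ []) :
    (∀ θ ∈ completeShift B, ∀ n : ℤ, θ n ≤ 4) ∧
    ∃ δ : ℝ, 0 < δ ∧ completeShift B ⊆ sigmaLe (t - δ) := by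
  have h4 : ∀ θ ∈ completeShift B, ∀ n : ℤ, θ n ≤ 4 := by
    rintro θ ⟨γ, c, hγ, hc0, hc, hθ⟩ n
    obtain ⟨i, h1, h2⟩ := exists_block_containing hc0 hc
      (fun i => List.length_pos_iff.2 (hne _ (hγ i))) n
    rw [hc] at h2
    obtain ⟨k, rfl⟩ := Int.le.dest h1
    rw [hθ i k (by omega)]
    exact hB4 _ (hγ i) _ (List.getElem_mem _)
  refine ⟨h4, ?_⟩
  set G : ℕ := B.sup fun β => continuant (a ++ (β ++ b)) with hG
  refine ⟨1 / (1000 * ((G + 1 : ℕ) : ℝ) ^ 2), by positivity, ?_⟩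
  intro θ hθs
  have hθ4 := h4 θ hθs
  obtain ⟨γ, c, hγ, hc0, hc, hθ⟩ := hθs
  rw [mem_sigmaLe]
  intro n
  obtain ⟨i, h1, h2⟩ := exists_block_containing hc0 hc
      (fun i => List.length_pos_iff.2 (hne _ (hγ i))) n
  have hocc : ∀ i, Occ (γ i) θ (c i) := fun i k hk => hθ i k hk
  obtain ⟨m, hm, hmR, hloop⟩ := hB _ (hγ i)
  obtain ⟨m', hm', -⟩ := hB _ (hγ (i - 1))
  obtain ⟨m'', hm'', -⟩ := hB _ (hγ (i + 1))
  have oa : Occ a θ (c i - a.length) := by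
    have := hocc (i - 1)
    rw [hm', ← List.append_assoc] at this
    have h3 := (occ_append.1 this).2
    have h5 := hc (i - 1)
    rw [sub_add_cancel, hm', ← List.append_assoc, List.length_append] at h5
    have e : c i - a.length = c (i - 1) + (b ++ m').length := by push_cast at h5; omega
    rwa [e]
  have ob : Occ b θ (c (i + 1)) := by
    have := hocc (i + 1)
    rw [hm''] at this
    exact (occ_append.1 this).1
  have hwhole : Occ (a ++ (b ++ (m ++ (a ++ b)))) θ (c i - a.length) := by
    have e : b ++ (m ++ (a ++ b)) = γ i ++ b := by rw [hm]; simp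
    rw [e]
    refine occ_append.2 ⟨oa, ?_⟩
    rw [sub_add_cancel]
    refine occ_append.2 ⟨hocc i, ?_⟩
    rw [← hc]
    exact ob
  have key := heightAt_le_of_goodLoop ht hθ4 hloop hR ha ha' hb hb' hmR hwhole h1 (by
    rw [hc, hm] at h2
    simp only [List.length_append] at h2
    push_cast at h2
    omega)
  refine key.trans ?_
  have hGle : continuant (a ++ (b ++ (m ++ (a ++ b)))) ≤ G := by
    have e : b ++ (m ++ (a ++ b)) = γ i ++ b := by rw [hm]; simp
    rw [e]
    exact Finset.le_sup (f := fun β => continuant (a ++ (β ++ b))) (hγ i)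
  have hpos : (0 : ℝ) < continuant (a ++ (b ++ (m ++ (a ++ b)))) := by
    exact_mod_cast continuant_pos _
  have hGle' : (continuant (a ++ (b ++ (m ++ (a ++ b)))) : ℝ) ≤ ((G + 1 : ℕ) : ℝ) := by
    exact_mod_cast hGle.trans (Nat.le_succ _)
  have : 1 / (1000 * ((G + 1 : ℕ) : ℝ) ^ 2) ≤
      1 / (1000 * (continuant (a ++ (b ++ (m ++ (a ++ b)))) : ℝ) ^ 2) := by gcongr
  linarith

/-! ### Blocks of a given size -/

/-- The words of the language which are minimal with continuant at least `R`. -/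
def IsBlock (t : ℝ) (R : ℕ) (u : List ℕ+) : Prop :=
  Lang t u ∧ R ≤ continuant u ∧ continuant u.dropLast < R

/-- A strict bound for the lengths of blocks. -/
def blockLen (R : ℕ) : ℕ := Nat.log 2 (50 * R ^ 2) + 1

theorem IsBlock.ne_nil {t : ℝ} {R : ℕ} {u : List ℕ+} (h : IsBlock t R u) : u ≠ [] := by
  rintro rfl
  have := h.2.1.trans_lt h.2.2
  simp at this

theorem IsBlock.continuant_le {t : ℝ} (ht : t < 5) {R : ℕ} {u : List ℕ+} (h : IsBlock t R u) :
    continuant u ≤ 5 * R := by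
  have hu := List.dropLast_append_getLast h.ne_nil
  have h4 : u.getLast h.ne_nil ≤ 4 := h.1.le_four ht _ (List.getLast_mem _)
  have h4' : (u.getLast h.ne_nil : ℕ) ≤ 4 := h4
  rw [← hu]
  refine (continuant_append_singleton_le _ _).trans ?_
  exact Nat.mul_le_mul (by omega) h.2.2.le

theorem IsBlock.length_lt {t : ℝ} (ht : t < 5) {R : ℕ} {u : List ℕ+} (h : IsBlock t R u) :
    u.length < blockLen R := by
  have h1 := two_pow_length_le u
  have h2 := Nat.pow_le_pow_left (h.continuant_le ht) 2
  have h3 : 2 ^ u.length ≤ 50 * R ^ 2 := by nlinarith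
  have h4 : 50 * R ^ 2 ≠ 0 := by
    have := Nat.two_pow_pos u.length
    omega
  exact Nat.lt_succ_of_le ((Nat.le_log_iff_pow_le (by norm_num) h4).2 h3)

/-- Minimality: if v were longer, v without its last letter would still begin by u and have
continuant at least R. -/
theorem IsBlock.eq_of_prefix {t : ℝ} {R : ℕ} {u v : List ℕ+} (hu : IsBlock t R u)
    (hv : IsBlock t R v) (h : u <+: v) : u = v := by
  obtain ⟨r, rfl⟩ := h
  rcases eq_or_ne r [] with rfl | hr
  · simp
  · have h1 := hv.2.2
    rw [List.dropLast_append_of_ne_nil hr] at h1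
    have := hu.2.1.trans ((continuant_le_append_right u r.dropLast))
    omega

theorem finite_isBlock {t : ℝ} (ht : t < 5) (R : ℕ) : {u | IsBlock t R u}.Finite := by
  refine ((Finset.range (blockLen R)).biUnion fun l =>
    words (Finset.Icc 1 4 : Finset ℕ+) l).finite_toSet.subset ?_
  intro u hu
  refine Finset.mem_coe.2 (Finset.mem_biUnion.2 ⟨u.length, Finset.mem_range.2 (hu.length_lt ht),
    mem_words.2 ⟨rfl, fun x hx => Finset.mem_Icc.2 ⟨one_le, hu.1.le_four ht x hx⟩⟩⟩)

open scoped Classical in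
/-- The finite set of blocks. -/
def blocks (t : ℝ) (R : ℕ) : Finset (List ℕ+) :=
  if h : {u | IsBlock t R u}.Finite then h.toFinset else ∅

theorem mem_blocks {t : ℝ} (ht : t < 5) {R : ℕ} {u : List ℕ+} :
    u ∈ blocks t R ↔ IsBlock t R u := by
  rw [blocks, dif_pos (finite_isBlock ht R), Set.Finite.mem_toFinset]
  rfl

theorem exists_block_occ {t : ℝ} {θ : ℤ → ℕ+} (hθ : θ ∈ sigmaLe t) {R : ℕ} (hR : 2 ≤ R)
    (n : ℤ) : ∃ u, IsBlock t R u ∧ Occ u θ n := by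
  classical
  have hex : ∃ l, R ≤ continuant (pre (fun m : ℕ => θ (n + m)) l) := by
    -- Enough letters, since 2^l ≤ 2q² and 2^l > l.
    refine ⟨2 * R ^ 2, ?_⟩
    have h1 := two_pow_length_le (pre (fun m : ℕ => θ (n + m)) (2 * R ^ 2))
    rw [pre_length] at h1
    have h2 : 2 * R ^ 2 < 2 ^ (2 * R ^ 2) := Nat.lt_two_pow_self
    by_contra hcon
    have := Nat.pow_le_pow_left (not_le.1 hcon).le 2
    omega
  have hspec := Nat.find_spec hex
  have hmin : ∀ l < Nat.find hex, continuant (pre (fun m : ℕ => θ (n + m)) l) < R :=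
    fun l hl => not_le.1 (Nat.find_min hex hl)
  rcases hl : Nat.find hex with _ | l
  · rw [hl] at hspec
    simp at hspec
    omega
  · rw [hl] at hspec hmin
    refine ⟨pre (fun m : ℕ => θ (n + m)) (l + 1), ⟨⟨θ, hθ, n, occ_pre θ n _⟩, hspec, ?_⟩,
      occ_pre θ n _⟩
    rw [pre_succ, List.dropLast_concat]
    exact hmin l (Nat.lt_succ_self l)

theorem exists_words_occ {t : ℝ} (ht : t < 5) {θ : ℤ → ℕ+} (hθ : θ ∈ sigmaLe t) {R : ℕ}
    (hR : 2 ≤ R) (k : ℕ) (n : ℤ) : ∃ w ∈ words (blocks t R) k, Occ w.flatten θ n := by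
  induction k generalizing n with
  | zero => exact ⟨[], mem_words.2 ⟨rfl, by simp⟩, fun i hi => by simp at hi⟩
  | succ k ih =>
    obtain ⟨u, hu, hocc⟩ := exists_block_occ hθ hR n
    obtain ⟨w, hw, hocc'⟩ := ih (n + u.length)
    obtain ⟨h1, h2⟩ := mem_words.1 hw
    refine ⟨u :: w, mem_words.2 ⟨by simp [h1], ?_⟩, ?_⟩
    · intro x hx
      rcases List.mem_cons.1 hx with rfl | hx
      · exact (mem_blocks ht).2 hu
      · exact h2 x hx
    · rw [List.flatten_cons]
      exact occ_append.2 ⟨hocc, hocc'⟩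

theorem pow_le_continuant_flatten {R : ℕ} {w : List (List ℕ+)} (h : ∀ u ∈ w, R ≤ continuant u) :
    R ^ w.length ≤ continuant w.flatten := by
  induction w with
  | nil => simp
  | cons u w ih =>
    rw [List.flatten_cons, List.length_cons, pow_succ, mul_comm]
    exact (Nat.mul_le_mul (h u (by simp)) (ih fun v hv => h v (by simp [hv]))).trans
      (continuant_mul_le _ _)

theorem continuant_flatten_le {P : ℕ} {w : List (List ℕ+)} (h : ∀ u ∈ w, continuant u ≤ P) :
    continuant w.flatten ≤ (2 * P) ^ w.length := by
  induction w with
  | nil => simp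
  | cons u w ih =>
    rw [List.flatten_cons, List.length_cons, pow_succ]
    refine (continuant_append_le _ _).trans ?_
    have := Nat.mul_le_mul (h u (by simp)) (ih fun v hv => h v (by simp [hv]))
    linarith

/-- Concatenations of equally many blocks are prefix-free. -/
theorem eq_of_flatten_prefix {t : ℝ} {R : ℕ} {w v : List (List ℕ+)}
    (hw : ∀ u ∈ w, IsBlock t R u) (hv : ∀ u ∈ v, IsBlock t R u) (hl : w.length = v.length)
    (h : w.flatten <+: v.flatten) : w = v := by
  induction w generalizing v with
  | nil => exact (List.length_eq_zero_iff.1 hl.symm).symm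
  | cons a w ih =>
    cases v with
    | nil => simp at hl
    | cons b v =>
      rw [List.flatten_cons, List.flatten_cons] at h
      have ha : a <+: b ++ v.flatten := (List.prefix_append _ _).trans h
      have hb : b <+: b ++ v.flatten := List.prefix_append _ _
      have hab : a = b := by
        rcases List.prefix_or_prefix_of_prefix ha hb with h1 | h1
        · exact (hw a (by simp)).eq_of_prefix (hv b (by simp)) h1
        · exact ((hv b (by simp)).eq_of_prefix (hw a (by simp)) h1).symm
      subst hab
      rw [ih (fun u hu => hw u (by simp [hu])) (fun u hu => hv u (by simp [hu]))
        (by simpa using hl) ((List.prefix_append_right_inj a).1 h)]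

open scoped Classical in
/-- The concatenations of `k` blocks that occur in sequences of Markov value at most `t`. -/
def blockWords (t : ℝ) (R k : ℕ) : Finset (List (List ℕ+)) :=
  (words (blocks t R) k).filter fun w => Lang t w.flatten

theorem mem_blockWords {t : ℝ} {R k : ℕ} {w : List (List ℕ+)} :
    w ∈ blockWords t R k ↔ w ∈ words (blocks t R) k ∧ Lang t w.flatten :=
  by simp [blockWords]

theorem blockWords_subset (t : ℝ) (R k : ℕ) : blockWords t R k ⊆ words (blocks t R) k :=
  fun _ h => (mem_blockWords.1 h).1

/-! ### Counting blocks and box-counting -/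

/-- The numbers beginning with a given word of k blocks lie within q⁻² ≤ R^(-2k) of each other. This
turns a lower bound for the box count into many block words. -/
theorem boxCount_le_card_blockWords {t : ℝ} (ht : t < 5) {R : ℕ} (hR : 2 ≤ R) (k : ℕ) {r : ℝ}
    (hr : 1 / ((R : ℝ) ^ k) ^ 2 ≤ r) :
    boxCount (cfProj (sigmaLe t)) r ≤ (blockWords t R k).card := by
  classical
  -- Left ends of the intervals; which of the tails 0 and 1 gives the left end depends on the parity
  -- of the length.
  set s : Finset ℝ := (blockWords t R k).image fun w =>
    min (cfApp w.flatten 0) (cfApp w.flatten 1) with hs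
  have hcard : (s.card : ℕ∞) ≤ (blockWords t R k).card := by
    exact_mod_cast Finset.card_image_le
  refine le_trans (iInf₂_le s ?_) hcard
  rintro _ ⟨θ, hθ, rfl⟩
  obtain ⟨w, hw, hocc⟩ := exists_words_occ ht hθ hR k 0
  obtain ⟨hwl, hwB⟩ := mem_words.1 hw
  refine Set.mem_iUnion₂.2 ⟨_, Finset.mem_image_of_mem _ (mem_blockWords.2
    ⟨hw, θ, hθ, 0, hocc⟩), ?_⟩
  have hpre := hocc.pre_forward
  simp only [zero_add] at hpre
  have hval := cfVal_eq_cfApp (fun n : ℕ => θ n) w.flatten.length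
  rw [hpre] at hval
  set x := cfVal (fun k : ℕ => θ ((k + w.flatten.length : ℕ) : ℤ)) with hx
  have hx0 : 0 ≤ x := cfVal_nonneg _
  have hx1 : x ≤ 1 := cfVal_le_one _
  change cfVal (fun n : ℕ => θ n) ∈ _
  rw [hval]
  have hQ : (R : ℝ) ^ k ≤ continuant w.flatten := by
    have := pow_le_continuant_flatten (R := R) (w := w)
      fun u hu => ((mem_blocks ht).1 (hwB u hu)).2.1
    rw [hwl] at this
    exact_mod_cast this
  have hRpos : (0 : ℝ) < (R : ℝ) ^ k := by positivity
  have hq : (0 : ℝ) < continuant w.flatten := hRpos.trans_le hQ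
  have hdr : 1 / (continuant w.flatten : ℝ) ^ 2 ≤ r := by
    refine le_trans ?_ hr
    gcongr
  have e0 := cfApp_sub_cfApp w.flatten hx0 hx1 le_rfl zero_le_one
  have e1 := cfApp_sub_cfApp w.flatten hx0 hx1 zero_le_one le_rfl
  have a0 := abs_le.1 (abs_cfApp_sub_le w.flatten hx0 hx1 le_rfl zero_le_one)
  have a1 := abs_le.1 (abs_cfApp_sub_le w.flatten hx0 hx1 zero_le_one le_rfl)
  have d0 := hq.trans_le (contMat_den_bounds w.flatten (x := (0 : ℝ)) le_rfl zero_le_one).1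
  have d1 := hq.trans_le (contMat_den_bounds w.flatten (x := (1 : ℝ)) zero_le_one le_rfl).1
  have dx := hq.trans_le (contMat_den_bounds w.flatten hx0 hx1).1
  have b0 : |x - 0| / (continuant w.flatten : ℝ) ^ 2 ≤ r := by
    refine le_trans ?_ hdr
    gcongr
    rw [sub_zero, abs_of_nonneg hx0]
    exact hx1
  have b1 : |x - 1| / (continuant w.flatten : ℝ) ^ 2 ≤ r := by
    refine le_trans ?_ hdr
    gcongr
    rw [abs_le]; constructor <;> linarith
  rcases Nat.even_or_odd w.flatten.length with hp | hp
  · rw [hp.neg_one_pow, one_mul] at e0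
    have : 0 ≤ cfApp w.flatten x - cfApp w.flatten 0 :=
      nonneg_of_mul_nonneg_left (by rw [e0]; linarith) (mul_pos dx d0)
    constructor
    · exact (min_le_left _ _).trans (by linarith)
    · rcases min_choice (cfApp w.flatten 0) (cfApp w.flatten 1) with h | h <;> rw [h] <;> linarith
  · rw [hp.neg_one_pow] at e1
    have : 0 ≤ cfApp w.flatten x - cfApp w.flatten 1 :=
      nonneg_of_mul_nonneg_left (by rw [e1]; linarith) (mul_pos dx d1)
    constructor
    · exact (min_le_right _ _).trans (by linarith)
    · rcases min_choice (cfApp w.flatten 0) (cfApp w.flatten 1) with h | h <;> rw [h] <;> linarith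

/-- Numbers beginning with different blocks are at least 1/(500·(5R)²) apart, so an interval of
length r meets only one of the chosen representatives. -/
theorem card_blocks_le_boxCount {t : ℝ} (ht : t < 5) {R : ℕ} {r : ℝ}
    (hr : r < 1 / (12500 * (R : ℝ) ^ 2)) :
    ((blocks t R).card : ℕ∞) ≤ boxCount (cfProj (sigmaLe t)) r := by
  classical
  refine le_iInf₂ fun s hs => ?_
  have hch : ∀ u ∈ blocks t R, ∃ θ ∈ sigmaLe t, Occ u θ 0 := fun u hu =>
    ((mem_blocks ht).1 hu).1.exists_at 0
  choose! Θ hΘ hocc using hch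
  have hex : ∀ u ∈ blocks t R, ∃ a ∈ s, cfVal (fun n : ℕ => Θ u n) ∈ Set.Icc a (a + r) := by
    intro u hu
    have := hs ⟨Θ u, hΘ u hu, rfl⟩
    obtain ⟨a, ha, h⟩ := Set.mem_iUnion₂.1 this
    exact ⟨a, ha, h⟩
  choose! A hA hmem using hex
  norm_cast
  refine Finset.card_le_card_of_injOn A hA ?_
  intro u hu v hv huv
  by_contra hne
  have hu' := (mem_blocks ht).1 hu
  have hv' := (mem_blocks ht).1 hv
  have pu := (hocc u hu).pre_forward
  have pv := (hocc v hv).pre_forward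
  simp only [zero_add] at pu pv
  have hdiff : ∃ i < u.length, Θ u (i : ℕ) ≠ Θ v (i : ℕ) := by
    by_contra hcon
    push Not at hcon
    have e := pre_congr (a := fun n : ℕ => Θ u n) (b := fun n : ℕ => Θ v n) hcon
    rw [pu] at e
    rcases Nat.le_total u.length v.length with h | h
    · obtain ⟨d, hd⟩ := Nat.exists_eq_add_of_le h
      rw [hd, pre_add, ← e] at pv
      exact hne (hu'.eq_of_prefix hv' ⟨_, pv⟩)
    · obtain ⟨d, hd⟩ := Nat.exists_eq_add_of_le h
      rw [hd, pre_add, pv] at e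
      exact hne (hv'.eq_of_prefix hu' ⟨_, e.symm⟩).symm
  have hgap := le_abs_cfVal_sub (a := fun n : ℕ => Θ u n) (b := fun n : ℕ => Θ v n)
    (fun i => le_four_of_mem_sigmaLe ht (hΘ u hu) _)
    (fun i => le_four_of_mem_sigmaLe ht (hΘ v hv) _) hdiff
  rw [pu] at hgap
  have m1 := hmem u hu
  have m2 := hmem v hv
  rw [← huv] at m2
  have hle : |cfVal (fun n : ℕ => Θ u n) - cfVal (fun n : ℕ => Θ v n)| ≤ r := by
    rw [abs_le]
    constructor <;> linarith [m1.1, m1.2, m2.1, m2.2]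
  have hQ : (continuant u : ℝ) ≤ 5 * R := by exact_mod_cast hu'.continuant_le ht
  have hq : (0 : ℝ) < continuant u := by exact_mod_cast continuant_pos u
  have : 1 / (12500 * (R : ℝ) ^ 2) ≤ 1 / (500 * (continuant u : ℝ) ^ 2) := by
    apply one_div_le_one_div_of_le (by positivity)
    nlinarith
  linarith

/-! ### Good loops in words of blocks -/

theorem drop_eq_cons_of_getElem? {α : Type*} {w : List α} {i : ℕ} {x : α} (h : w[i]? = some x) :
    w.drop i = x :: w.drop (i + 1) := by
  obtain ⟨hi, rfl⟩ := List.getElem?_eq_some_iff.1 h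
  exact List.drop_eq_getElem_cons hi

/-- Left-goodness at p and p + 1 supplies the replacements on the left, right-goodness at q and q +
1 those on the right; p + 3 ≤ q leaves at least one block in the middle. -/
theorem exists_goodLoop {t : ℝ} {R k p q : ℕ} {w : List (List ℕ+)} {a b : List ℕ+}
    (hw : w ∈ blockWords t R k) (hpq : p + 3 ≤ q)
    (hp : goodPair (blockWords t R k) cfLt (fun x y => cfLt x.reverse y.reverse) w p)
    (hq : goodPair (blockWords t R k) cfLt (fun x y => cfLt x.reverse y.reverse) w q)
    (hpa : w[p]? = some a) (hpb : w[p + 1]? = some b) (hqa : w[q]? = some a)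
    (hqb : w[q + 1]? = some b) :
    ∃ mid : List (List ℕ+), loopWord p q w = b :: (mid ++ [a]) ∧ mid ≠ [] ∧
      (∀ u ∈ mid, u ∈ blocks t R) ∧ GoodLoop t a b mid.flatten := by
  have hwords := mem_words.1 (blockWords_subset t R k hw)
  have hql : q < w.length := (List.getElem?_eq_some_iff.1 hqa).1
  set mid := (w.drop (p + 2)).take (q - (p + 2)) with hmid
  have hmidl : mid.length = q - (p + 2) := by
    rw [hmid, List.length_take, List.length_drop]; omega
  have d0 := drop_eq_cons_of_getElem? hpa
  have d1 := drop_eq_cons_of_getElem? hpb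
  have d2 : w.drop (p + 2) = mid ++ w.drop q := by
    conv_lhs => rw [← List.take_append_drop (q - (p + 2)) (w.drop (p + 2)), List.drop_drop]
    rw [show p + 2 + (q - (p + 2)) = q by omega]
  have d3 := drop_eq_cons_of_getElem? hqa
  have d4 := drop_eq_cons_of_getElem? hqb
  have dp1 : w.drop (p + 1) = b :: (mid ++ a :: b :: w.drop (q + 2)) := by
    rw [d1, d2, d3, d4]
  have dp2 : w.drop (p + 2) = mid ++ a :: b :: w.drop (q + 2) := by rw [d2, d3, d4]
  have hwdec : w = w.take p ++ a :: b :: (mid ++ a :: b :: w.drop (q + 2)) := by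
    conv_lhs => rw [← List.take_append_drop p w, d0, dp1]
  have hpl : (w.take p).length = p := by rw [List.length_take]; omega
  have tq : w.take q = w.take p ++ a :: b :: mid := by
    conv_lhs => rw [hwdec]
    rw [show w.take p ++ a :: b :: (mid ++ a :: b :: w.drop (q + 2)) =
      (w.take p ++ a :: b :: mid) ++ a :: b :: w.drop (q + 2) by simp]
    exact List.take_left' (by simp [hmidl]; omega)
  have tq1 : w.take (q + 1) = w.take p ++ a :: b :: (mid ++ [a]) := by
    conv_lhs => rw [hwdec]
    rw [show w.take p ++ a :: b :: (mid ++ a :: b :: w.drop (q + 2)) =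
      (w.take p ++ a :: b :: (mid ++ [a])) ++ b :: w.drop (q + 2) by simp]
    exact List.take_left' (by simp [hmidl]; omega)
  have hlang : ∀ u ∈ blockWords t R k, Lang t u.flatten := fun u hu =>
    (mem_blockWords.1 hu).2
  have hright : ∀ (P : List ℕ+ → List ℕ+ → Prop) (j : ℕ) (c : List ℕ+) (l : List (List ℕ+)),
      w[j]? = some c → w.take j = w.take p ++ l →
      (∃ u ∈ blockWords t R k, u.take j = w.take j ∧
        ∃ x y, u[j]? = some x ∧ w[j]? = some y ∧ P x y) →
      ∃ v, Lang t (l.flatten ++ v) ∧ P v c := by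
    rintro P j c l hj hl ⟨u, hu, ht, x, y, hx, hy, hP⟩
    rw [hj, Option.some.injEq] at hy
    subst hy
    refine ⟨x, (hlang u hu).of_infix ?_, hP⟩
    have : u = w.take p ++ l ++ x :: u.drop (j + 1) := by
      conv_lhs => rw [← List.take_append_drop j u, ht, hl, drop_eq_cons_of_getElem? hx]
    rw [this]
    exact ⟨(w.take p).flatten, (u.drop (j + 1)).flatten, by simp⟩
  have hleft : ∀ (P : List ℕ+ → List ℕ+ → Prop) (j : ℕ) (c : List ℕ+) (l r : List (List ℕ+)),
      w[j]? = some c → w.drop (j + 1) = l ++ r →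
      (∃ u ∈ blockWords t R k, u.drop (j + 1) = w.drop (j + 1) ∧
        ∃ x y, u[j]? = some x ∧ w[j]? = some y ∧ P x y) →
      ∃ v, Lang t (v ++ l.flatten) ∧ P v c := by
    rintro P j c l r hj hl ⟨u, hu, ht, x, y, hx, hy, hP⟩
    rw [hj, Option.some.injEq] at hy
    subst hy
    refine ⟨x, (hlang u hu).of_infix ?_, hP⟩
    have : u = u.take j ++ x :: (l ++ r) := by
      conv_lhs => rw [← List.take_append_drop j u, drop_eq_cons_of_getElem? hx, ht, hl]
    rw [this]
    exact ⟨(u.take j).flatten, r.flatten, by simp⟩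
  refine ⟨mid, ?_, ?_, ?_, ?_⟩
  · rw [loopWord, dp1, show b :: (mid ++ a :: b :: w.drop (q + 2)) =
      (b :: (mid ++ [a])) ++ b :: w.drop (q + 2) by simp]
    exact List.take_left' (by simp [hmidl]; omega)
  · intro h
    rw [h] at hmidl
    simp at hmidl
    omega
  · intro u hu
    exact hwords.2 u (List.mem_of_mem_drop (List.mem_of_mem_take hu))
  · have la := fun P h => hleft P p a (b :: (mid ++ [a, b])) (w.drop (q + 2)) hpa
      (by rw [dp1]; simp) h
    have lb := fun P h => hleft P (p + 1) b (mid ++ [a, b]) (w.drop (q + 2)) hpb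
      (by rw [dp2]; simp) h
    have ra := fun P h => hright P q a (a :: b :: mid) hqa tq h
    have rb := fun P h => hright P (q + 1) b (a :: b :: (mid ++ [a])) hqb tq1 h
    simp only [List.flatten_cons, List.flatten_append, List.flatten_nil, List.append_nil,
      List.append_assoc] at la lb ra rb
    exact ⟨la _ hp.2.2.1.1, la (fun x y => cfLt y.reverse x.reverse) hp.2.2.1.2,
      lb _ hp.2.2.2.1, lb (fun x y => cfLt y.reverse x.reverse) hp.2.2.2.2,
      ra _ hq.1.1, ra (fun x y => cfLt y x) hq.1.2, rb _ hq.2.1.1,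
      rb (fun x y => cfLt y x) hq.2.1.2⟩

/-! ### From many words to an alphabet -/

/-- The alphabet consists of the loops found by `exists_loop`. Having more than V^(q-p) words of
continuant at most (10R)^(q-p), it yields a dimension bound in which the loop length q - p cancels.
-/
theorem exists_alphabet_of_card {t : ℝ} (ht : t < 5) {R k m : ℕ} (hR : 1600 ≤ R) {V : ℝ}
    (hV : 1 ≤ V) (hB : 1 ≤ (blocks t R).card)
    (hm : 4 * ((2 * blockLen R + 1) * (blocks t R).card) ^ k ≤
      (blocks t R).card ^ m * (blockWords t R k).card)
    (hlarge : 2 * (((k : ℝ) ^ 2 * ((blocks t R).card ^ 2 : ℕ) + 1) ^ ((blocks t R).card ^ 2) *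
      ((blocks t R).card : ℝ) ^ (4 * m + 2 + (blocks t R).card ^ 2 * (3 + 1)) * V ^ k) <
        (blockWords t R k).card) :
    ∃ (δ : ℝ) (B : Finset (List ℕ+)), 0 < δ ∧ IsAlphabet B ∧
      (∀ θ ∈ completeShift B, ∀ n : ℤ, θ n ≤ 4) ∧ completeShift B ⊆ sigmaLe (t - δ) ∧
      ENNReal.ofReal (Real.log V / (2 * Real.log (20 * R))) ≤ dimH (gaussCantorSet B) := by
  classical
  obtain ⟨p, q, a, b, Z, hpq, hqk, ha, hb, hZ, hcard⟩ := exists_loop (blocks t R) hB cfLt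
    (fun x y => cfLt x.reverse y.reverse) List.length (blockLen R)
    (fun u hu => ((mem_blocks ht).1 hu).length_lt ht)
    (fun x _ y _ hl hne => cfLt_or_cfLt hl hne)
    (fun x _ y _ hl hne => cfLt_or_cfLt (by simpa using hl) (by simpa using hne))
    k 3 m (blockWords t R k) (blockWords_subset t R k) V hV hm hlarge
  have hZprop : ∀ z ∈ Z, z.length = q - p ∧ (∀ u ∈ z, IsBlock t R u) ∧ Lang t z.flatten ∧
      ∃ mid : List (List ℕ+), z = b :: (mid ++ [a]) ∧ mid ≠ [] ∧ (∀ u ∈ mid, u ∈ blocks t R) ∧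
        GoodLoop t a b mid.flatten := by
    intro z hz
    obtain ⟨w, hwX, hgp, hgq, ⟨hpa, hpb⟩, ⟨hqa, hqb⟩, rfl⟩ := hZ z hz
    obtain ⟨hwW, hwL⟩ := mem_blockWords.1 hwX
    obtain ⟨hwl, hwB⟩ := mem_words.1 hwW
    refine ⟨?_, ?_, ?_, exists_goodLoop hwX hpq hgp hgq hpa hpb hqa hqb⟩
    · rw [loopWord, List.length_take, List.length_drop]; omega
    · intro u hu
      exact (mem_blocks ht).1 (hwB u (List.mem_of_mem_drop (List.mem_of_mem_take hu)))
    · refine hwL.of_infix ?_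
      have := drop_eq_append_loopWord (Nat.zero_le p) (by omega : p ≤ q) w
      rw [List.drop_zero] at this
      conv_rhs => rw [this]
      exact ⟨(w.take (p + 1 - 0)).flatten, (w.drop (q + 1)).flatten, by simp⟩
  have hinj : Set.InjOn List.flatten (Z : Set (List (List ℕ+))) := by
    intro z hz y hy hzy
    obtain ⟨h1, h2, -⟩ := hZprop z hz
    obtain ⟨h3, h4, -⟩ := hZprop y hy
    exact eq_of_flatten_prefix h2 h4 (h1.trans h3.symm) (by rw [hzy])
  set B := Z.image List.flatten with hBdef
  have hBcard : B.card = Z.card := Finset.card_image_of_injOn hinj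
  have hVB : V ^ (q - p) < B.card := by rw [hBcard]; exact hcard
  have hblock_a := (mem_blocks ht).1 ha
  have hblock_b := (mem_blocks ht).1 hb
  have hne : ∀ β ∈ B, β ≠ [] := by
    intro β hβ
    obtain ⟨z, hz, rfl⟩ := Finset.mem_image.1 hβ
    obtain ⟨-, -, -, mid, rfl, -⟩ := hZprop z hz
    rw [List.flatten_cons]
    simp [hblock_b.ne_nil]
  have hcard1 : 1 < B.card := by
    have : (1 : ℝ) < B.card := (one_le_pow₀ hV).trans_lt hVB
    exact_mod_cast this
  have halph : IsAlphabet B := by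
    refine ⟨hcard1, hne, ?_⟩
    intro β hβ γ hγ hβγ hpre
    obtain ⟨z, hz, rfl⟩ := Finset.mem_image.1 hβ
    obtain ⟨y, hy, rfl⟩ := Finset.mem_image.1 hγ
    obtain ⟨h1, h2, -⟩ := hZprop z hz
    obtain ⟨h3, h4, -⟩ := hZprop y hy
    exact hβγ (by rw [eq_of_flatten_prefix h4 h2 (h3.trans h1.symm) hpre])
  have hB4 : ∀ β ∈ B, ∀ x ∈ β, x ≤ 4 := by
    intro β hβ
    obtain ⟨z, hz, rfl⟩ := Finset.mem_image.1 hβ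
    exact (hZprop z hz).2.2.1.le_four ht
  obtain ⟨h4, δ, hδ, hsub⟩ := completeShift_subset_of_goodLoop ht hR hblock_a.2.1
    (hblock_a.continuant_le ht) hblock_b.2.1 (hblock_b.continuant_le ht) (B := B) (by
      intro β hβ
      obtain ⟨z, hz, rfl⟩ := Finset.mem_image.1 hβ
      obtain ⟨-, -, -, mid, rfl, hmid, hmidB, hloop⟩ := hZprop z hz
      refine ⟨mid.flatten, by simp, ?_, hloop⟩
      refine le_trans ?_ (pow_le_continuant_flatten (R := R)
        fun u hu => ((mem_blocks ht).1 (hmidB u hu)).2.1)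
      exact Nat.le_self_pow (List.length_pos_iff.2 hmid).ne' R) hB4 hne
  refine ⟨δ, B, hδ, halph, h4, hsub, ?_⟩
  have hQ : ∀ β ∈ B, continuant β ≤ (10 * R) ^ (q - p) := by
    intro β hβ
    obtain ⟨z, hz, rfl⟩ := Finset.mem_image.1 hβ
    obtain ⟨h1, h2, -⟩ := hZprop z hz
    have := continuant_flatten_le (P := 5 * R) fun u hu => (h2 u hu).continuant_le ht
    rw [h1] at this
    convert this using 2
    ring
  refine le_trans (ENNReal.ofReal_le_ofReal ?_) (le_dimH_gaussCantorSet halph hB4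
    (Nat.one_le_pow _ _ (by omega)) hQ)
  have hRr : (1600 : ℝ) ≤ R := by exact_mod_cast hR
  have hl : (1 : ℝ) ≤ ((q - p : ℕ) : ℝ) := by
    have : 1 ≤ q - p := by omega
    exact_mod_cast this
  have hlogV : 0 ≤ Real.log V := Real.log_nonneg hV
  have h20 : 0 < Real.log (20 * R) := Real.log_pos (by linarith)
  have hnum : ((q - p : ℕ) : ℝ) * Real.log V ≤ Real.log B.card := by
    rw [← Real.log_pow]
    exact Real.log_le_log (by positivity) hVB.le
  have hden : Real.log (2 * (((10 * R) ^ (q - p) : ℕ) : ℝ)) ≤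
      ((q - p : ℕ) : ℝ) * Real.log (20 * R) := by
    rw [← Real.log_pow]
    refine Real.log_le_log (by positivity) ?_
    push_cast
    have e : (20 * (R : ℝ)) ^ (q - p) = 2 ^ (q - p) * (10 * R) ^ (q - p) := by
      rw [← mul_pow]; ring
    rw [e]
    have : (2 : ℝ) ≤ 2 ^ (q - p) := by
      have := pow_le_pow_right₀ (by norm_num : (1 : ℝ) ≤ 2) (by omega : 1 ≤ q - p)
      simpa using this
    gcongr
  have hdpos : 0 < Real.log (2 * (((10 * R) ^ (q - p) : ℕ) : ℝ)) := by
    apply Real.log_pos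
    have : (1 : ℝ) ≤ (((10 * R) ^ (q - p) : ℕ) : ℝ) := by
      exact_mod_cast Nat.one_le_pow _ _ (by omega)
    linarith
  rw [div_le_div_iff₀ (by positivity) (by positivity)]
  calc Real.log V * (2 * Real.log (2 * (((10 * R) ^ (q - p) : ℕ) : ℝ)))
      ≤ Real.log V * (2 * (((q - p : ℕ) : ℝ) * Real.log (20 * R))) := by gcongr
    _ = (((q - p : ℕ) : ℝ) * Real.log V) * (2 * Real.log (20 * R)) := by ring
    _ ≤ _ := by gcongr

/-! ### The box-counting dimension -/

theorem log_natCast {n : ℕ} (hn : n ≠ 0) : ENNReal.log (n : ENNReal) = (Real.log n : EReal) := by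
  rw [← ENNReal.ofReal_natCast, ENNReal.log_ofReal_of_pos (by exact_mod_cast Nat.pos_of_ne_zero hn)]

theorem eventually_log_one_div_pos : ∀ᶠ r : ℝ in 𝓝[>] 0, 0 < r ∧ 0 < Real.log (1 / r) := by
  have h1 : ∀ᶠ r : ℝ in 𝓝[>] 0, r < 1 :=
    mem_nhdsWithin_of_mem_nhds (Iio_mem_nhds one_pos)
  filter_upwards [h1, self_mem_nhdsWithin] with r hr hr0
  exact ⟨hr0, Real.log_pos (by rw [lt_div_iff₀ hr0]; linarith)⟩

theorem eventually_log_le_of_boxDim_lt {X : Set ℝ} {c : ℝ} (h : boxDim X < c) :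
    ∀ᶠ r : ℝ in 𝓝[>] 0, ∀ n : ℕ, n ≠ 0 → (n : ℕ∞) ≤ boxCount X r →
      Real.log n ≤ c * Real.log (1 / r) := by
  filter_upwards [eventually_lt_of_limsup_lt h, eventually_log_one_div_pos] with r hr hr0 n hn hle
  rw [EReal.div_lt_iff (by exact_mod_cast hr0.2) (EReal.coe_ne_top _)] at hr
  have h1 : ENNReal.log (n : ENNReal) ≤ ENNReal.log (boxCount X r : ENNReal) :=
    ENNReal.log_le_log (by exact_mod_cast hle)
  rw [log_natCast hn] at h1
  exact_mod_cast (h1.trans_lt hr).le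

theorem frequently_lt_log_of_lt_boxDim {X : Set ℝ} {c : ℝ} (h : (c : EReal) < boxDim X) :
    ∃ᶠ r : ℝ in 𝓝[>] 0, ∀ n : ℕ, boxCount X r ≤ n → n ≠ 0 ∧ c * Real.log (1 / r) < Real.log n := by
  refine ((frequently_lt_of_lt_limsup (by isBoundedDefault) h).and_eventually
    eventually_log_one_div_pos).mono ?_
  rintro r ⟨hr, hr0⟩ n hle
  rw [EReal.lt_div_iff (by exact_mod_cast hr0.2) (EReal.coe_ne_top _)] at hr
  have h1 : ENNReal.log (boxCount X r : ENNReal) ≤ ENNReal.log (n : ENNReal) :=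
    ENNReal.log_le_log (by exact_mod_cast hle)
  have hn : n ≠ 0 := by
    rintro rfl
    have := hr.trans_le h1
    simp at this
  rw [log_natCast hn] at h1
  exact ⟨hn, by exact_mod_cast hr.trans_le h1⟩

/-- A crude bound: only finiteness is needed, to treat Δ⁺(t) as a real number. -/
theorem boxDim_le_two {X : Set ℝ} (hX : X ⊆ Set.Icc 0 1) : boxDim X ≤ (2 : ℝ) := by
  refine limsup_le_of_le (by isBoundedDefault) ?_
  have h1 : ∀ᶠ r : ℝ in 𝓝[>] 0, r < 1 / 2 :=
    mem_nhdsWithin_of_mem_nhds (Iio_mem_nhds (by norm_num))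
  filter_upwards [h1, eventually_log_one_div_pos] with r hr hr0
  rw [EReal.div_le_iff_le_mul (by exact_mod_cast hr0.2) (EReal.coe_ne_top _)]
  classical
  have hle : boxCount X r ≤ ((⌊1 / r⌋₊ + 1 : ℕ) : ℕ∞) := by
    refine le_trans (iInf₂_le ((Finset.range (⌊1 / r⌋₊ + 1)).image fun i : ℕ => (i : ℝ) * r) ?_) ?_
    · intro x hx
      obtain ⟨hx0, hx1⟩ := hX hx
      refine Set.mem_iUnion₂.2 ⟨(⌊x / r⌋₊ : ℝ) * r, Finset.mem_image.2 ⟨⌊x / r⌋₊, ?_, rfl⟩, ?_⟩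
      · rw [Finset.mem_range, Nat.lt_succ_iff]
        exact Nat.floor_le_floor (div_le_div_of_nonneg_right hx1 hr0.1.le)
      · have h2 := Nat.floor_le (div_nonneg hx0 hr0.1.le)
        have h3 := Nat.lt_floor_add_one (x / r)
        rw [le_div_iff₀ hr0.1] at h2
        rw [div_lt_iff₀ hr0.1] at h3
        exact ⟨h2, by linarith⟩
    · exact_mod_cast Finset.card_image_le.trans (by simp)
  have h2 : ENNReal.log (boxCount X r : ENNReal) ≤ ENNReal.log ((⌊1 / r⌋₊ + 1 : ℕ) : ENNReal) :=
    ENNReal.log_le_log (by exact_mod_cast hle)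
  rw [log_natCast (by omega)] at h2
  refine h2.trans ?_
  have h3 : (2 : ℝ) ≤ 1 / r := by rw [le_div_iff₀ hr0.1]; linarith
  have h4 : ((⌊1 / r⌋₊ + 1 : ℕ) : ℝ) ≤ (1 / r) ^ 2 := by
    push_cast
    have := Nat.floor_le (by linarith : 0 ≤ 1 / r)
    nlinarith
  have h5 := Real.log_le_log (by positivity) h4
  rw [Real.log_pow] at h5
  have h6 : Real.log ((⌊1 / r⌋₊ + 1 : ℕ) : ℝ) ≤ Real.log (1 / r) * 2 := by
    push_cast at h5 ⊢; linarith
  exact_mod_cast h6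

theorem cfProj_subset (S : Set (ℤ → ℕ+)) : cfProj S ⊆ Set.Icc 0 1 := by
  rintro _ ⟨θ, -, rfl⟩
  exact ⟨cfVal_nonneg _, cfVal_le_one _⟩

/-! ### The choice of the scale -/

theorem log_le_two_mul_sqrt {y : ℝ} (hy : 0 < y) : Real.log y ≤ 2 * √y := by
  have h1 := Real.log_le_sub_one_of_pos (Real.sqrt_pos.2 hy)
  rw [Real.log_sqrt hy.le] at h1
  linarith

/-- For fixed R, the polynomial factors of `exists_loop` are subexponential in k. -/
theorem eventually_add_mul_log_lt {A C M c : ℝ} (hC : 0 ≤ C) (hM : 0 ≤ M) (hc : 0 < c) :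
    ∀ᶠ k : ℕ in atTop, A + C * Real.log ((k : ℝ) ^ 2 * M + 1) < c * k := by
  have h1 : ∀ᶠ k : ℕ in atTop, ‖Real.log k‖ ≤ c / (4 * (C + 1)) * ‖(k : ℝ)‖ :=
    tendsto_natCast_atTop_atTop.eventually
      (Real.isLittleO_log_id_atTop.bound (show 0 < c / (4 * (C + 1)) by positivity))
  have h2 : ∀ᶠ k : ℕ in atTop, (A + C * Real.log (M + 1)) / (c / 2) < k :=
    tendsto_natCast_atTop_atTop.eventually (eventually_gt_atTop _)
  filter_upwards [h1, h2, eventually_ge_atTop 1] with k h1 h2 h3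
  have hk : (1 : ℝ) ≤ k := by exact_mod_cast h3
  have hle : Real.log ((k : ℝ) ^ 2 * M + 1) ≤ Real.log (M + 1) + 2 * Real.log k := by
    have : Real.log (M + 1) + 2 * Real.log k = Real.log ((M + 1) * (k : ℝ) ^ 2) := by
      rw [Real.log_mul (by positivity) (by positivity), Real.log_pow]
      push_cast
      ring
    rw [this]
    apply Real.log_le_log (by positivity)
    nlinarith [one_le_pow₀ hk (n := 2)]
  rw [Real.norm_of_nonneg (Real.log_nonneg hk), Real.norm_of_nonneg (by positivity)] at h1
  rw [div_lt_iff₀ (by positivity)] at h2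
  have h4 : C * Real.log ((k : ℝ) ^ 2 * M + 1) ≤ C * Real.log (M + 1) + 2 * (C * Real.log k) := by
    nlinarith
  have h5 : C * Real.log k ≤ c / 4 * k := by
    calc C * Real.log k ≤ (C + 1) * (c / (4 * (C + 1)) * k) := by
          apply mul_le_mul (by linarith) h1 (Real.log_nonneg hk) (by positivity)
      _ = c / 4 * k := by field_simp
  linarith

/-- Block lengths are O(log R), so the factor 2L + 1 lost per position is negligible against any
power of R. -/
theorem eventually_log_blockLen_le {c : ℝ} (hc : 0 < c) :
    ∀ᶠ R : ℕ in atTop, 2 * Real.log (2 * (blockLen R : ℝ) + 1) ≤ c * Real.log R := by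
  have hlog : Tendsto (fun R : ℕ => Real.log R) atTop atTop :=
    Real.tendsto_log_atTop.comp tendsto_natCast_atTop_atTop
  filter_upwards [hlog.eventually_ge_atTop (4 * Real.log 50 + 3),
    hlog.eventually_ge_atTop ((12 / c) ^ 2), eventually_ge_atTop 1] with R h1 h2 h3
  have hR : (1 : ℝ) ≤ R := by exact_mod_cast h3
  set x := Real.log R with hx
  have h50 : 0 < Real.log 50 := Real.log_pos (by norm_num)
  have hx0 : 0 < x := by linarith
  have hL : (blockLen R : ℝ) ≤ 2 * Real.log 50 + 4 * x + 1 := by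
    have hne : 50 * R ^ 2 ≠ 0 := by positivity
    have h4 : (2 : ℝ) ^ (Nat.log 2 (50 * R ^ 2)) ≤ 50 * (R : ℝ) ^ 2 := by
      exact_mod_cast Nat.pow_log_le_self 2 hne
    have h5 := Real.log_le_log (by positivity) h4
    rw [Real.log_pow, Real.log_mul (by norm_num) (by positivity), Real.log_pow] at h5
    have h6 : (1 : ℝ) / 2 ≤ Real.log 2 := by have := Real.log_two_gt_d9; linarith
    have h7 : (Nat.log 2 (50 * R ^ 2) : ℝ) * (1 / 2) ≤
        (Nat.log 2 (50 * R ^ 2) : ℝ) * Real.log 2 := by gcongr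
    rw [blockLen]
    push_cast at *
    linarith
  have h8 : Real.log (2 * (blockLen R : ℝ) + 1) ≤ 6 * √x := by
    calc Real.log (2 * (blockLen R : ℝ) + 1) ≤ Real.log (9 * x) :=
          Real.log_le_log (by positivity) (by linarith)
      _ ≤ 2 * √(9 * x) := log_le_two_mul_sqrt (by positivity)
      _ = 6 * √x := by
          rw [Real.sqrt_mul (by norm_num), show (9 : ℝ) = 3 ^ 2 by norm_num,
            Real.sqrt_sq (by norm_num)]
          ring
  have h9 : 12 / c ≤ √x := Real.le_sqrt_of_sq_le h2
  rw [div_le_iff₀ hc] at h9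
  have h10 : √x * √x = x := Real.mul_self_sqrt hx0.le
  nlinarith [Real.sqrt_nonneg x]

set_option maxHeartbeats 1600000 in
/-- Almost all of the dimension is carried by a complete shift of smaller Markov value. -/
theorem exists_alphabet_of_deltaPlus {t : ℝ} (ht : t < 5) {D : ℝ} (hD0 : 0 < D)
    (hD : deltaPlus t = (D : EReal)) {η : ℝ} (hη : 0 < η) (hη1 : η ≤ 1 / 2) :
    ∃ (δ : ℝ) (B : Finset (List ℕ+)), 0 < δ ∧ IsAlphabet B ∧
      (∀ θ ∈ completeShift B, ∀ n : ℤ, θ n ≤ 4) ∧ completeShift B ⊆ sigmaLe (t - δ) ∧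
      ENNReal.ofReal ((1 - η) * D) ≤ dimH (gaussCantorSet B) := by
  -- The unit of error is κ and ε is the admitted proportion of bad positions. The losses below add
  -- up to 74κ, plus κ for the constant 20, within η = 80κ.
  obtain ⟨κ, hκ⟩ : ∃ κ, κ = η / 80 := ⟨_, rfl⟩
  obtain ⟨ε, hε⟩ : ∃ ε, ε = 8 * κ := ⟨_, rfl⟩
  have hκ0 : 0 < κ := by rw [hκ]; positivity
  have hκ1 : κ ≤ 1 / 160 := by rw [hκ]; linarith
  have hU := eventually_log_le_of_boxDim_lt (X := cfProj (sigmaLe t)) (c := (1 + κ) * D) (by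
    change deltaPlus t < _
    rw [hD]
    exact_mod_cast (by nlinarith : D < (1 + κ) * D))
  have hF := frequently_lt_log_of_lt_boxDim (X := cfProj (sigmaLe t)) (c := (1 - κ) * D) (by
    change _ < deltaPlus t
    rw [hD]
    exact_mod_cast (by nlinarith : (1 - κ) * D < D))
  have hlog : Tendsto (fun R : ℕ => Real.log R) atTop atTop :=
    Real.tendsto_log_atTop.comp tendsto_natCast_atTop_atTop
  have hscale : Tendsto (fun R : ℕ => 1 / (12501 * (R : ℝ) ^ 2)) atTop (𝓝[>] 0) := by
    have h1 : Tendsto (fun R : ℕ => 12501 * (R : ℝ) ^ 2) atTop atTop :=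
      ((tendsto_pow_atTop (two_ne_zero)).comp tendsto_natCast_atTop_atTop).const_mul_atTop
        (by norm_num)
    have h2 := tendsto_inv_atTop_nhdsGT_zero.comp h1
    simpa [Function.comp_def] using h2
  obtain ⟨R, hR1600, hRb, hRc, hRd, hRU⟩ :=
    ((eventually_ge_atTop 1600).and ((hlog.eventually_ge_atTop (Real.log 12501 / (2 * κ))).and
      ((hlog.eventually_ge_atTop (Real.log 20 / κ)).and
        ((eventually_log_blockLen_le (show 0 < 6 * κ * D by positivity)).and
          (hscale.eventually hU))))).exists
  obtain ⟨x, hx⟩ : ∃ x, x = Real.log R := ⟨_, rfl⟩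
  rw [← hx] at hRb hRc hRd
  rw [div_le_iff₀ (by positivity)] at hRb hRc
  have hRr : (1600 : ℝ) ≤ R := by exact_mod_cast hR1600
  have hx0 : 0 < x := by rw [hx]; exact Real.log_pos (by linarith)
  obtain ⟨h, hh⟩ : ∃ h, h = 2 * D * x := ⟨_, rfl⟩
  have hh0 : 0 < h := by rw [hh]; positivity
  obtain ⟨N, hN⟩ : ∃ N, N = (blocks t R).card := ⟨_, rfl⟩
  -- The scale 1/(12501 R²) lies just below the separation of blocks; `hRb` absorbs log 12501.
  have hlogN : N ≠ 0 → Real.log N ≤ (1 + 3 * κ) * h := by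
    intro hN0
    have h1 := hRU N hN0 (by
      rw [hN]
      refine card_blocks_le_boxCount ht ?_
      apply one_div_lt_one_div_of_lt (by positivity)
      nlinarith)
    rw [one_div_one_div, Real.log_mul (by norm_num) (by positivity), Real.log_pow, ← hx] at h1
    push_cast at h1
    have h2 : (1 + κ) * D * (Real.log 12501 + 2 * x) ≤ (1 + κ) * D * ((1 + κ) * (2 * x)) := by
      apply mul_le_mul_of_nonneg_left _ (by positivity)
      linarith
    have h3 : (1 + κ) * D * ((1 + κ) * (2 * x)) = (1 + κ) ^ 2 * h := by rw [hh]; ring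
    have h4 : (1 + κ) ^ 2 * h ≤ (1 + 3 * κ) * h :=
      mul_le_mul_of_nonneg_right (by nlinarith) hh0.le
    linarith
  have hkev : ∀ᶠ k : ℕ in atTop, 1 ≤ κ * k ∧
      (Real.log 2 + (6 + 4 * (N : ℝ) ^ 2) * Real.log N) +
        (N : ℝ) ^ 2 * Real.log ((k : ℝ) ^ 2 * ((N ^ 2 : ℕ) : ℝ) + 1) < ε * h * k := by
    refine Eventually.and ?_ (eventually_add_mul_log_lt (by positivity) (by positivity)
      (by rw [hε]; positivity))
    filter_upwards [tendsto_natCast_atTop_atTop.eventually (eventually_ge_atTop (1 / κ))] with k hk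
    rw [div_le_iff₀ hκ0] at hk
    linarith
  obtain ⟨k₀, hk₀⟩ := eventually_atTop.1 hkev
  have hlarge_log : ∀ᶠ r : ℝ in 𝓝[>] 0, 2 * x * k₀ ≤ Real.log (1 / r) := by
    have := Real.tendsto_log_atTop.comp (tendsto_inv_nhdsGT_zero (𝕜 := ℝ))
    filter_upwards [this.eventually_ge_atTop (2 * x * k₀)] with r hr
    simpa using hr
  -- The upper limit gives the lower bound only for arbitrarily small r. So r is chosen after R and
  -- k₀, and k is then the least number with R^(-2k) ≤ r.
  obtain ⟨r, hrF, hrk, hr0, hrlog⟩ := (hF.and_eventually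
    (hlarge_log.and eventually_log_one_div_pos)).exists
  obtain ⟨k, hk⟩ : ∃ k, k = ⌈Real.log (1 / r) / (2 * x)⌉₊ := ⟨_, rfl⟩
  have hkl : Real.log (1 / r) ≤ 2 * x * k := by
    have := Nat.le_ceil (Real.log (1 / r) / (2 * x))
    rw [← hk, div_le_iff₀ (by positivity)] at this
    linarith
  have hku : 2 * x * (k - 1) ≤ Real.log (1 / r) := by
    have := Nat.ceil_lt_add_one (div_nonneg hrlog.le (by positivity : 0 ≤ 2 * x))
    rw [← hk, ← sub_lt_iff_lt_add, lt_div_iff₀ (by positivity)] at this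
    linarith
  have hkk : k₀ ≤ k := by
    have : (k₀ : ℝ) ≤ k := by
      have := hrk.trans hkl
      exact le_of_mul_le_mul_left this (by positivity)
    exact_mod_cast this
  obtain ⟨hκk, hklarge⟩ := hk₀ k hkk
  have hk1 : (1 : ℝ) ≤ k := by nlinarith
  have hkpos : k ≠ 0 := by
    rintro rfl
    norm_num at hk1
  have hcover := boxCount_le_card_blockWords ht (by omega : 2 ≤ R) k (r := r) (by
    have e : ((R : ℝ) ^ k) ^ 2 = Real.exp (2 * x * k) := by
      rw [hx, mul_comm 2, mul_assoc, Real.exp_mul, Real.exp_log (by linarith), ← pow_mul,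
        ← Real.rpow_natCast]
      push_cast
      ring_nf
    rw [e, div_le_iff₀ (Real.exp_pos _)]
    have h1 : 1 / r ≤ Real.exp (2 * x * k) := by
      rw [← Real.exp_log (show 0 < 1 / r by positivity)]
      exact Real.exp_le_exp.2 hkl
    rw [div_le_iff₀ hr0] at h1
    linarith)
  obtain ⟨hX0, hXlog⟩ := hrF _ hcover
  obtain ⟨W, hW⟩ : ∃ W, W = (blockWords t R k).card := ⟨_, rfl⟩
  rw [← hW] at hX0 hXlog
  -- One κ comes from the dimension, the other from rounding k, since κk ≥ 1.
  have hWlog : (1 - 2 * κ) * (k * h) ≤ Real.log W := by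
    refine le_trans ?_ hXlog.le
    calc (1 - 2 * κ) * (k * h) ≤ (1 - κ) * (k - 1) * h := by
          nlinarith
      _ = (1 - κ) * D * (2 * x * (k - 1)) := by rw [hh]; ring
      _ ≤ _ := mul_le_mul_of_nonneg_left hku (by nlinarith)
  have hN0 : N ≠ 0 := by
    intro h0
    have := (Finset.card_le_card (blockWords_subset t R k)).trans (card_words_le _ k)
    rw [← hN, h0, zero_pow hkpos, ← hW] at this
    omega
  have hN1 : (1 : ℝ) ≤ N := by exact_mod_cast Nat.one_le_iff_ne_zero.2 hN0
  have hlN := hlogN hN0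
  have hlN0 : 0 ≤ Real.log N := Real.log_nonneg hN1
  have hWpos : (0 : ℝ) < W := by exact_mod_cast Nat.pos_of_ne_zero hX0
  obtain ⟨m, hm⟩ : ∃ m, m = ⌈ε * k⌉₊ := ⟨_, rfl⟩
  have hε0 : 0 < ε := by rw [hε]; positivity
  have hm1 : ε * k ≤ m := by rw [hm]; exact Nat.le_ceil _
  have hm2 : (m : ℝ) ≤ ε * k + 1 := by
    rw [hm]; exact (Nat.ceil_lt_add_one (by positivity)).le
  have hL4 : Real.log 4 ≤ Real.log (2 * (blockLen R : ℝ) + 1) := by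
    apply Real.log_le_log (by norm_num)
    have : 2 ≤ blockLen R := by
      rw [blockLen]
      have : 1 ≤ Nat.log 2 (50 * R ^ 2) := Nat.log_pos (by norm_num) (by nlinarith)
      omega
    have : (2 : ℝ) ≤ blockLen R := by exact_mod_cast this
    linarith
  have hL0 : 0 ≤ Real.log (2 * (blockLen R : ℝ) + 1) :=
    (Real.log_nonneg (by norm_num : (1 : ℝ) ≤ 4)).trans hL4
  have hLh : 2 * Real.log (2 * (blockLen R : ℝ) + 1) ≤ 3 * κ * h := by
    rw [hh]; linarith
  -- Per position: (1 - 8κ)(1 + 3κ) ≤ 1 - 5κ from N, and 3κ from the block lengths and the factor 4,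
  -- against 1 - 2κ from W.
  have hcond1 : 4 * ((2 * blockLen R + 1) * N) ^ k ≤ N ^ m * W := by
    have hreal : (4 : ℝ) * ((2 * (blockLen R : ℝ) + 1) * N) ^ k ≤ (N : ℝ) ^ m * W := by
      rw [← Real.log_le_log_iff (by positivity) (by positivity),
        Real.log_mul (by norm_num) (by positivity), Real.log_pow,
        Real.log_mul (by positivity) (by positivity), Real.log_mul (by positivity) (by positivity),
        Real.log_pow]
      have e1 : ε * k * Real.log N ≤ m * Real.log N := by gcongr
      have e2 : (k : ℝ) * (2 * Real.log (2 * (blockLen R : ℝ) + 1)) ≤ k * (3 * κ * h) := by gcongr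
      have e3 : Real.log 4 ≤ k * Real.log (2 * (blockLen R : ℝ) + 1) :=
        hL4.trans (le_mul_of_one_le_left hL0 hk1)
      have e4 : (1 - ε) * Real.log N ≤ (1 - 5 * κ) * h := by
        calc (1 - ε) * Real.log N ≤ (1 - ε) * ((1 + 3 * κ) * h) := by
              apply mul_le_mul_of_nonneg_left hlN; rw [hε]; linarith
          _ ≤ (1 - 5 * κ) * h := by
              rw [← mul_assoc]
              apply mul_le_mul_of_nonneg_right _ hh0.le
              rw [hε]; nlinarith
      have e5 := mul_le_mul_of_nonneg_left e4 (by positivity : (0 : ℝ) ≤ k)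
      linarith
    exact_mod_cast hreal
  -- 74 = 2 + 64 + 8: the deficit of W, the factor N^(4m) with m about 8κk and log N ≤ 2h, and the
  -- terms sublinear in k.
  obtain ⟨V, hV⟩ : ∃ V, V = Real.exp ((1 - 74 * κ) * h) := ⟨_, rfl⟩
  have hVpos : 0 < V := by rw [hV]; exact Real.exp_pos _
  have hlogV : Real.log V = (1 - 74 * κ) * h := by rw [hV, Real.log_exp]
  have hV1 : 1 ≤ V := by
    rw [hV]
    apply Real.one_le_exp
    apply mul_nonneg _ hh0.le
    linarith
  have hcond2 : 2 * (((k : ℝ) ^ 2 * (N ^ 2 : ℕ) + 1) ^ (N ^ 2) *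
      (N : ℝ) ^ (4 * m + 2 + N ^ 2 * (3 + 1)) * V ^ k) < W := by
    rw [← Real.log_lt_log_iff (by positivity) hWpos, Real.log_mul (by norm_num) (by positivity),
      Real.log_mul (by positivity) (by positivity), Real.log_mul (by positivity) (by positivity),
      Real.log_pow, Real.log_pow, Real.log_pow, hlogV]
    have e1 : (m : ℝ) * Real.log N ≤ (ε * k + 1) * Real.log N := by gcongr
    have e2 : ε * k * Real.log N ≤ ε * k * (2 * h) := by
      apply mul_le_mul_of_nonneg_left _ (by positivity)
      refine hlN.trans (mul_le_mul_of_nonneg_right (by linarith) hh0.le)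
    push_cast at hklarge ⊢
    subst hε
    linarith
  obtain ⟨δ, B, hδ, hB, hB4, hBs, hdim⟩ := exists_alphabet_of_card ht hR1600 (k := k) (m := m) hV1
    (by rw [← hN]; omega) (by rw [← hN, ← hW]; exact hcond1)
    (by rw [← hN, ← hW]; exact hcond2)
  refine ⟨δ, B, hδ, hB, hB4, hBs, le_trans (ENNReal.ofReal_le_ofReal ?_) hdim⟩
  rw [hlogV, Real.log_mul (by norm_num) (by positivity), ← hx, le_div_iff₀ (by
    have := Real.log_pos (by norm_num : (1 : ℝ) < 20)
    positivity)]
  have hη' : η = 80 * κ := by rw [hκ]; ring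
  calc (1 - η) * D * (2 * (Real.log 20 + x)) ≤ (1 - η) * D * (2 * ((1 + κ) * x)) := by
        apply mul_le_mul_of_nonneg_left _ (mul_nonneg (by linarith) hD0.le)
        linarith
    _ = ((1 - η) * (1 + κ)) * h := by rw [hh]; ring
    _ ≤ _ := by
        apply mul_le_mul_of_nonneg_right _ hh0.le
        rw [hη']
        nlinarith

/-! ### Sums of two elements of a set of dimension zero -/

theorem eventually_exists_cover {X : Set ℝ} {c : ℝ} (h : boxDim X < c) :
    ∀ᶠ r : ℝ in 𝓝[>] 0, ∃ s : Finset ℝ, X ⊆ ⋃ a ∈ s, Set.Icc a (a + r) ∧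
      (s.card : ℝ) ≤ Real.exp (c * Real.log (1 / r)) := by
  filter_upwards [eventually_log_le_of_boxDim_lt h, eventually_log_one_div_pos] with r hr hr0
  have hfin : boxCount X r ≠ ⊤ := by
    intro htop
    obtain ⟨n, hn⟩ := exists_nat_gt (Real.exp (c * Real.log (1 / r)))
    have hn0 : (0 : ℝ) < n := (Real.exp_pos _).trans hn
    have h1 := hr n (by rintro rfl; simp at hn0) (by rw [htop]; exact le_top)
    rw [Real.log_le_iff_le_exp hn0] at h1
    linarith
  obtain ⟨n, hn⟩ := ENat.ne_top_iff_exists.1 hfin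
  have hlt : boxCount X r < ((n + 1 : ℕ) : ℕ∞) := by
    rw [← hn]; exact_mod_cast Nat.lt_succ_self n
  rw [boxCount, iInf_lt_iff] at hlt
  obtain ⟨s, hs⟩ := hlt
  rw [iInf_lt_iff] at hs
  obtain ⟨hcov, hcard⟩ := hs
  have hcard' : s.card ≤ n := Nat.lt_succ_iff.1 (by exact_mod_cast hcard)
  refine ⟨s, hcov, ?_⟩
  rcases Nat.eq_zero_or_pos s.card with h0 | hpos
  · rw [h0, Nat.cast_zero]; exact (Real.exp_pos _).le
  · have h1 := hr s.card hpos.ne' (by rw [← hn]; exact_mod_cast hcard')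
    rwa [Real.log_le_iff_le_exp (by exact_mod_cast hpos)] at h1

/-- Integer translates of sums of two elements of a set of box-counting dimension zero form a set
of Hausdorff dimension zero. -/
theorem dimH_sum_eq_zero {X S : Set ℝ} (hX : boxDim X ≤ 0) (M : ℕ)
    (hS : ∀ x ∈ S, ∃ a < M, ∃ u ∈ X, ∃ v ∈ X, x = (a : ℝ) + u + v) : dimH S = 0 := by
  classical
  suffices h : ∀ d : NNReal, 0 < d → dimH S ≤ d by
    refine le_antisymm (ENNReal.le_of_forall_pos_le_add fun d hd _ => ?_) bot_le
    rw [zero_add]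
    exact h d hd
  intro d hd
  have hd' : (0 : ℝ) < d := hd
  apply dimH_le_of_hausdorffMeasure_ne_top
  -- Pairs of intervals number at most r^(-2c) = r^(-d), which exactly balances the diameters raised
  -- to the power d.
  set c : ℝ := d / 2 with hc
  have hc0 : 0 < c := by positivity
  have hcov := eventually_exists_cover (hX.trans_lt (by exact_mod_cast hc0))
  -- The empty default concerns only values of r away from 0 and plays no role in the limit.
  set s : ℝ → Finset ℝ := fun r => if h : ∃ s : Finset ℝ, X ⊆ ⋃ a ∈ s, Set.Icc a (a + r) ∧
      (s.card : ℝ) ≤ Real.exp (c * Real.log (1 / r)) then h.choose else ∅ with hs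
  have hcov' : ∀ᶠ r : ℝ in 𝓝[>] 0, X ⊆ ⋃ a ∈ s r, Set.Icc a (a + r) ∧
      ((s r).card : ℝ) ≤ Real.exp (c * Real.log (1 / r)) := by
    filter_upwards [hcov] with r hr
    simp only [hs, dif_pos hr]
    exact hr.choose_spec
  have hμ := MeasureTheory.Measure.hausdorffMeasure_le_liminf_sum (X := ℝ)
    (ι := fun r : ℝ => ↥(Finset.range M ×ˢ s r ×ˢ s r)) (d : ℝ) S
    (l := 𝓝[>] (0 : ℝ)) (fun r => ENNReal.ofReal (2 * r)) ?_
    (fun r i => Set.Icc ((i.1.1 : ℝ) + i.1.2.1 + i.1.2.2) ((i.1.1 : ℝ) + i.1.2.1 + i.1.2.2 + 2 * r))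
    ?_ ?_
  · refine ne_top_of_le_ne_top (b := ENNReal.ofReal (M * 2 ^ (d : ℝ))) ENNReal.ofReal_ne_top
      (hμ.trans (liminf_le_of_frequently_le' (Eventually.frequently ?_)))
    filter_upwards [hcov', eventually_log_one_div_pos] with r hr hr0
    have hdiam : ∀ y : ℝ, Metric.ediam (Set.Icc y (y + 2 * r)) = ENNReal.ofReal (2 * r) := by
      intro y; rw [Real.ediam_Icc]; congr 1; ring
    simp only [hdiam]
    rw [Finset.sum_const, nsmul_eq_mul, Finset.card_univ, Fintype.card_coe, Finset.card_product,
      Finset.card_product, Finset.card_range,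
      ENNReal.ofReal_rpow_of_nonneg (by linarith [hr0.1]) hd'.le, ← ENNReal.ofReal_natCast,
      ← ENNReal.ofReal_mul (Nat.cast_nonneg _)]
    apply ENNReal.ofReal_le_ofReal
    push_cast
    have hr1 := hr0.1
    have e1 : Real.exp (c * Real.log (1 / r)) * Real.exp (c * Real.log (1 / r)) * r ^ (d : ℝ) = 1 := by
      rw [Real.rpow_def_of_pos hr1, ← Real.exp_add, ← Real.exp_add, one_div, Real.log_inv, hc]
      rw [← Real.exp_zero]
      congr 1
      ring
    rw [Real.mul_rpow (by norm_num) hr1.le]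
    have hn0 : (0 : ℝ) ≤ ((s r).card : ℝ) := Nat.cast_nonneg _
    have e2 : ((s r).card : ℝ) * (s r).card ≤
        Real.exp (c * Real.log (1 / r)) * Real.exp (c * Real.log (1 / r)) :=
      mul_le_mul hr.2 hr.2 hn0 (Real.exp_pos _).le
    calc (M : ℝ) * (((s r).card : ℝ) * (s r).card) * (2 ^ (d : ℝ) * r ^ (d : ℝ))
        ≤ (M : ℝ) * (Real.exp (c * Real.log (1 / r)) * Real.exp (c * Real.log (1 / r))) *
          (2 ^ (d : ℝ) * r ^ (d : ℝ)) := by gcongr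
      _ = M * 2 ^ (d : ℝ) * (Real.exp (c * Real.log (1 / r)) * Real.exp (c * Real.log (1 / r)) *
          r ^ (d : ℝ)) := by ring
      _ = M * 2 ^ (d : ℝ) := by rw [e1, mul_one]
  · have : Tendsto (fun r : ℝ => ENNReal.ofReal (2 * r)) (𝓝 0) (𝓝 0) := by
      have h1 : Continuous fun r : ℝ => ENNReal.ofReal (2 * r) :=
        ENNReal.continuous_ofReal.comp (continuous_const.mul continuous_id)
      simpa using h1.tendsto 0
    exact this.mono_left nhdsWithin_le_nhds
  · refine Eventually.of_forall fun r i => ?_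
    rw [Real.ediam_Icc]
    apply ENNReal.ofReal_le_ofReal
    linarith
  · filter_upwards [hcov'] with r hr x hx
    obtain ⟨a, ha, u, hu, v, hv, rfl⟩ := hS x hx
    obtain ⟨p, hp, hpu⟩ := Set.mem_iUnion₂.1 (hr.1 hu)
    obtain ⟨q, hq, hqv⟩ := Set.mem_iUnion₂.1 (hr.1 hv)
    refine Set.mem_iUnion.2 ⟨⟨(a, p, q), Finset.mem_product.2 ⟨Finset.mem_range.2 ha,
      Finset.mem_product.2 ⟨hp, hq⟩⟩⟩, ?_⟩
    constructor
    · change (a : ℝ) + p + q ≤ _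
      linarith [hpu.1, hqv.1]
    · change _ ≤ (a : ℝ) + p + q + 2 * r
      linarith [hpu.2, hqv.2]

/-! ### Limits of one-sided sequences -/

/-- `[dₙ; dₙ₊₁, …] + [0; dₙ₋₁, …, d₀]`. -/
def oneSidedHeight (d : ℕ → ℕ+) (n : ℕ) : ℝ :=
  ((d n : ℕ) : ℝ) + cfVal (fun i => d (i + (n + 1))) + cfApp (pre d n).reverse 0

theorem one_div_continuant_sq_le (a : ℕ → ℕ+) (l : ℕ) :
    1 / (continuant (pre a l) : ℝ) ^ 2 ≤ 2 / 2 ^ l := by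
  have h := two_pow_length_le (pre a l)
  rw [pre_length] at h
  have h' : (2 : ℝ) ^ l ≤ 2 * (continuant (pre a l) : ℝ) ^ 2 := by exact_mod_cast h
  have hq : (0 : ℝ) < continuant (pre a l) := by exact_mod_cast continuant_pos _
  rw [div_le_div_iff₀ (by positivity) (by positivity)]
  linarith

theorem reverse_pre (d : ℕ → ℕ+) {l n : ℕ} (hl : l ≤ n) :
    (pre d n).reverse = pre (fun i => d (n - 1 - i)) l ++ (pre d (n - l)).reverse := by
  obtain ⟨m, rfl⟩ := Nat.exists_eq_add_of_le' hl
  rw [pre_add, List.reverse_append, Nat.add_sub_cancel]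
  congr 1
  refine List.ext_getElem (by simp) fun i h1 h2 => ?_
  rw [List.getElem_reverse, pre_getElem, pre_getElem]
  simp only [pre_length] at h2 ⊢
  congr 1
  omega

/-- Agreement of l letters on either side costs at most 2/2^l for each half. -/
theorem abs_oneSidedHeight_sub_le {d : ℕ → ℕ+} {θ : ℤ → ℕ+} {k : ℤ} {n l : ℕ} (hl : l ≤ n)
    (h : ∀ j : ℤ, -l ≤ j → j ≤ l → d ((n : ℤ) + j).toNat = θ (k + j)) :
    |oneSidedHeight d n - heightAt θ k| ≤ 4 / 2 ^ l := by
  have h0 : d n = θ k := by simpa using h 0 (by simp) (by simp)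
  have h1 : |cfVal (fun i => d (i + (n + 1))) - cfVal (fun m : ℕ => θ (k + 1 + m))| ≤ 2 / 2 ^ l := by
    refine le_trans (abs_cfVal_sub_le (n := l) fun i hi => ?_) (one_div_continuant_sq_le _ l)
    have := h (i + 1) (by omega) (by omega)
    rw [show k + 1 + (i : ℤ) = k + (i + 1) by ring, ← this]
    congr 1
    omega
  have h2 : |cfApp (pre d n).reverse 0 - cfVal (fun m : ℕ => θ (k - 1 - m))| ≤ 2 / 2 ^ l := by
    rw [reverse_pre d hl, cfApp_append, cfVal_eq_cfApp _ l]
    have e : pre (fun i => d (n - 1 - i)) l = pre (fun m : ℕ => θ (k - 1 - m)) l := by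
      refine pre_congr fun i hi => ?_
      have := h (-(i + 1)) (by omega) (by omega)
      rw [show k - 1 - (i : ℤ) = k + -(i + 1) by ring, ← this]
      congr 1
      omega
    rw [e]
    have hz := cfApp_mem (pre d (n - l)).reverse (x := 0) le_rfl zero_le_one
    set y := cfVal (fun i : ℕ => θ (k - 1 - ((i + l : ℕ) : ℤ)))
    have hy0 : 0 ≤ y := cfVal_nonneg _
    have hy1 : y ≤ 1 := cfVal_le_one _
    refine (abs_cfApp_sub_le _ hz.1 hz.2 hy0 hy1).trans
      (le_trans ?_ (one_div_continuant_sq_le (fun m : ℕ => θ (k - 1 - m)) l))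
    gcongr
    rw [abs_le]
    constructor <;> linarith [hz.1, hz.2]
  rw [oneSidedHeight, heightAt, h0]
  have e4 : (4 : ℝ) / 2 ^ l = 2 / 2 ^ l + 2 / 2 ^ l := by ring
  rw [e4]
  have h1' := abs_le.1 h1
  have h2' := abs_le.1 h2
  rw [abs_le]
  constructor <;> linarith [h1'.1, h1'.2, h2'.1, h2'.2]

theorem tendsto_four_div_two_pow : Tendsto (fun l : ℕ => (4 : ℝ) / 2 ^ l) atTop (𝓝 0) := by
  have := (tendsto_pow_atTop_nhds_zero_of_lt_one (by norm_num : (0 : ℝ) ≤ 1 / 2)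
    (by norm_num)).const_mul 4
  simpa [div_eq_mul_inv] using this

/-- A cluster value of the heights of a one-sided sequence, if it is also their upper limit, is
the height and the Markov value of a bi-infinite sequence. -/
theorem exists_mem_sigmaLe_of_mapClusterPt {d : ℕ → ℕ+} {x : ℝ} (hx5 : x < 5)
    (hup : ∀ y, x < y → ∀ᶠ n in atTop, oneSidedHeight d n < y)
    (hcl : MapClusterPt x atTop (oneSidedHeight d)) :
    ∃ θ ∈ sigmaLe x, heightAt θ 0 = x := by
  obtain ⟨U, hU, hUx⟩ := mapClusterPt_iff_ultrafilter.1 hcl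
  have hshift : ∀ k : ℤ, Tendsto (fun n : ℕ => ((n : ℤ) + k).toNat) U atTop := by
    intro k
    refine Tendsto.mono_left ?_ hU
    refine tendsto_atTop.2 fun b => ?_
    filter_upwards [eventually_ge_atTop (b + k.natAbs)] with n hn
    omega
  have hd4 : ∀ᶠ n in atTop, d n ≤ 4 := by
    filter_upwards [hup 5 hx5] with n hn
    rw [oneSidedHeight] at hn
    have h1 := cfVal_nonneg (fun i => d (i + (n + 1)))
    have h2 := (cfApp_mem (pre d n).reverse (x := 0) le_rfl zero_le_one).1
    have h3 : ((d n : ℕ) : ℝ) < 5 := by linarith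
    have h4 : (d n : ℕ) < 5 := by exact_mod_cast h3
    exact Nat.lt_succ_iff.1 h4
  -- The ultrafilter replaces a diagonal extraction: with finitely many letters, each coordinate
  -- relative to n is constant along U.
  have hex : ∀ k : ℤ, ∃ c : ℕ+, ∀ᶠ n : ℕ in U, d ((n : ℤ) + k).toNat = c := by
    intro k
    have h1 := (hshift k).eventually hd4
    have h2 : (⋃ c ∈ (Finset.Icc 1 4 : Finset ℕ+), {n : ℕ | d ((n : ℤ) + k).toNat = c}) ∈ U := by
      refine mem_of_superset h1 fun n hn => ?_
      exact Set.mem_iUnion₂.2 ⟨_, Finset.mem_Icc.2 ⟨one_le, hn⟩, rfl⟩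
    obtain ⟨c, -, hc⟩ := (Ultrafilter.finite_biUnion_mem_iff (Finset.finite_toSet _)).1 h2
    exact ⟨c, hc⟩
  choose θ hθ using hex
  have hlim : ∀ (k : ℤ) (l : ℕ), ∀ᶠ n : ℕ in U,
      |oneSidedHeight d ((n : ℤ) + k).toNat - heightAt θ k| ≤ 4 / 2 ^ l := by
    intro k l
    have h1 : ∀ᶠ n : ℕ in U, ∀ j ∈ Set.Icc (-(l : ℤ)) l, d ((n : ℤ) + (k + j)).toNat = θ (k + j) :=
      (eventually_all_finite (Set.finite_Icc _ _)).2 fun j _ => hθ (k + j)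
    filter_upwards [h1, (hshift k).eventually (eventually_ge_atTop (l + 1))] with n hn hnl
    refine abs_oneSidedHeight_sub_le (by omega) fun j hj1 hj2 => ?_
    rw [← hn j ⟨hj1, hj2⟩]
    congr 1
    omega
  refine ⟨θ, mem_sigmaLe.2 fun k => ?_, ?_⟩
  · refine le_of_forall_gt_imp_ge_of_dense fun y hy => ?_
    have h1 : ∀ l : ℕ, heightAt θ k ≤ y + 4 / 2 ^ l := by
      intro l
      obtain ⟨n, hn1, hn2⟩ := ((hlim k l).and ((hshift k).eventually (hup y hy))).exists
      linarith [(abs_le.1 hn1).1]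
    have h2 := tendsto_four_div_two_pow.const_add y
    rw [add_zero] at h2
    exact ge_of_tendsto' h2 h1
  · have h1 : ∀ l : ℕ, |x - heightAt θ 0| ≤ 4 / 2 ^ l := by
      intro l
      have h2 : Tendsto (fun n => |oneSidedHeight d n - heightAt θ 0|) U
          (𝓝 |x - heightAt θ 0|) := (hUx.sub_const _).abs
      refine le_of_tendsto h2 ?_
      filter_upwards [hlim 0 l] with n hn
      simpa using hn
    have h3 := ge_of_tendsto' tendsto_four_div_two_pow h1
    have h4 := abs_eq_zero.1 (le_antisymm h3 (abs_nonneg _))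
    linarith

/-! ### Continued fraction expansions -/

/-- The complete quotients of `α`. -/
def completeQuot (α : ℝ) : ℕ → ℝ
  | 0 => α
  | n + 1 => (Int.fract (completeQuot α n))⁻¹

/-- The partial quotients of the fractional part of `α`. -/
def partialQuot (α : ℝ) (n : ℕ) : ℕ+ := ⌊completeQuot α (n + 1)⌋.toNat.toPNat'

theorem irrational_completeQuot {α : ℝ} (hα : Irrational α) (n : ℕ) :
    Irrational (completeQuot α n) := by
  induction n with
  | zero => exact hα
  | succ n ih => exact (ih.sub_intCast _).inv

theorem fract_completeQuot_pos {α : ℝ} (hα : Irrational α) (n : ℕ) :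
    0 < Int.fract (completeQuot α n) :=
  Int.fract_pos.2 ((irrational_completeQuot hα n).ne_int _)

/-- The complete quotient is the inverse of a number in (0, 1), so its floor is at least 1 and both
truncations in `partialQuot` are harmless. -/
theorem partialQuot_eq {α : ℝ} (hα : Irrational α) (n : ℕ) :
    ((partialQuot α n : ℕ) : ℝ) = ⌊completeQuot α (n + 1)⌋ := by
  have h1 : 1 ≤ ⌊completeQuot α (n + 1)⌋ := by
    rw [Int.le_floor, Int.cast_one]
    exact (one_lt_inv₀ (fract_completeQuot_pos hα n)).2 (Int.fract_lt_one _) |>.le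
  have h2 : (partialQuot α n : ℕ) = ⌊completeQuot α (n + 1)⌋.toNat := by
    rw [partialQuot, PNat.toPNat'_coe (by omega)]
  rw [h2]
  have h3 : ((⌊completeQuot α (n + 1)⌋.toNat : ℕ) : ℤ) = ⌊completeQuot α (n + 1)⌋ :=
    Int.toNat_of_nonneg (by omega)
  exact_mod_cast h3

theorem completeQuot_succ_eq {α : ℝ} (hα : Irrational α) (n : ℕ) :
    completeQuot α (n + 1) = partialQuot α n + Int.fract (completeQuot α (n + 1)) := by
  rw [partialQuot_eq hα, Int.floor_add_fract]

theorem fract_completeQuot {α : ℝ} (hα : Irrational α) (n : ℕ) :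
    Int.fract (completeQuot α n) = 1 / (partialQuot α n + Int.fract (completeQuot α (n + 1))) := by
  rw [← completeQuot_succ_eq hα, completeQuot, one_div, inv_inv]

theorem fract_eq_cfApp {α : ℝ} (hα : Irrational α) (m n : ℕ) :
    Int.fract (completeQuot α m) =
      cfApp (pre (fun k => partialQuot α (k + m)) n) (Int.fract (completeQuot α (n + m))) := by
  induction n generalizing m with
  | zero => simp [pre, cfApp]
  | succ n ih =>
    rw [pre_succ', cfApp, fract_completeQuot hα, ih (m + 1)]
    simp only [zero_add, add_assoc, add_comm 1 m]

/-- Both numbers begin with the same l partial quotients for every l. -/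
theorem fract_eq_cfVal {α : ℝ} (hα : Irrational α) (m : ℕ) :
    Int.fract (completeQuot α m) = cfVal (fun k => partialQuot α (k + m)) := by
  have h1 : ∀ l : ℕ, |Int.fract (completeQuot α m) - cfVal (fun k => partialQuot α (k + m))| ≤
      4 / 2 ^ l := by
    intro l
    have hx0 := Int.fract_nonneg (completeQuot α (l + m))
    have hx1 := (Int.fract_lt_one (completeQuot α (l + m))).le
    set b : ℕ → ℕ+ := fun k => partialQuot α (k + m)
    have hy0 := cfVal_nonneg (fun k => b (k + l))
    have hy1 := cfVal_le_one (fun k => b (k + l))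
    rw [fract_eq_cfApp hα m l, cfVal_eq_cfApp b l]
    refine (abs_cfApp_sub_le _ hx0 hx1 hy0 hy1).trans ?_
    have h2 := one_div_continuant_sq_le b l
    have h3 : |Int.fract (completeQuot α (l + m)) - cfVal (fun k => b (k + l))| ≤ 1 := by
      rw [abs_le]
      constructor <;> linarith
    calc _ ≤ 1 / (continuant (pre b l) : ℝ) ^ 2 := by gcongr
      _ ≤ 2 / 2 ^ l := h2
      _ ≤ 4 / 2 ^ l := by gcongr; norm_num
  have h3 := ge_of_tendsto' tendsto_four_div_two_pow h1
  have h4 := abs_eq_zero.1 (le_antisymm h3 (abs_nonneg _))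
  linarith

theorem convergent_completeQuot {α : ℝ} (hα : Irrational α) (m n : ℕ) :
    ((completeQuot α m).convergent n : ℝ) =
      ⌊completeQuot α m⌋ + cfApp (pre (fun k => partialQuot α (k + m)) n) 0 := by
  induction n generalizing m with
  | zero => simp [pre, cfApp]
  | succ n ih =>
    have h := ih (m + 1)
    rw [Real.convergent_succ, pre_succ', cfApp]
    push_cast
    rw [show (Int.fract (completeQuot α m))⁻¹ = completeQuot α (m + 1) from rfl, h,
      ← partialQuot_eq hα, one_div]
    simp only [zero_add, add_assoc, add_comm 1 m]

/-- The numerators of the convergents of `α`. -/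
def convNum (α : ℝ) (n : ℕ) : ℤ :=
  ⌊α⌋ * continuant (pre (partialQuot α) n) + contMat (pre (partialQuot α) n) 1 0

/-- The denominators of the convergents of `α`. -/
def convDen (α : ℝ) (n : ℕ) : ℕ := continuant (pre (partialQuot α) n)

theorem convDen_pos (α : ℝ) (n : ℕ) : 0 < convDen α n := continuant_pos _

theorem isCoprime_convDen (α : ℝ) (n : ℕ) : IsCoprime (convDen α n : ℤ) (convNum α n) := by
  have h := Nat.isCoprime_iff_coprime.2 (contMat_coprime (pre (partialQuot α) n))
  rw [convNum, add_comm]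
  exact h.add_mul_right_right _

theorem tendsto_convDen (α : ℝ) : Tendsto (convDen α) atTop atTop := by
  refine tendsto_atTop.2 fun b => ?_
  filter_upwards [eventually_ge_atTop (2 * b ^ 2)] with n hn
  by_contra! hlt
  have h1 := two_pow_length_le (pre (partialQuot α) n)
  rw [pre_length] at h1
  have h2 : n < 2 ^ n := Nat.lt_two_pow_self
  have h3 : continuant (pre (partialQuot α) n) ^ 2 ≤ b ^ 2 := Nat.pow_le_pow_left hlt.le 2
  omega

theorem cfApp_zero_mul (w : List ℕ+) :
    cfApp w 0 * (continuant w : ℝ) = (contMat w 1 0 : ℝ) := by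
  simpa [continuant] using cfApp_eq w (x := 0) le_rfl

theorem convNum_eq {α : ℝ} (n : ℕ) : (convNum α n : ℝ) =
    convDen α n * (⌊α⌋ + cfApp (pre (partialQuot α) n) 0) := by
  rw [convNum, convDen]
  push_cast
  rw [← cfApp_zero_mul]
  ring

theorem convergent_eq {α : ℝ} (hα : Irrational α) (n : ℕ) :
    (α.convergent n : ℝ) * convDen α n = convNum α n := by
  have h := convergent_completeQuot hα 0 n
  simp only [add_zero, completeQuot] at h
  rw [h, convNum_eq, mul_comm]

theorem oneSidedHeight_pos (d : ℕ → ℕ+) (n : ℕ) : 0 < oneSidedHeight d n := by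
  have h1 := cfVal_nonneg (fun i => d (i + (n + 1)))
  have h2 := (cfApp_mem (pre d n).reverse (x := 0) le_rfl zero_le_one).1
  have h3 : (0 : ℝ) < ((d n : ℕ) : ℝ) := by exact_mod_cast (d n).pos
  rw [oneSidedHeight]
  linarith

/-- The quality of approximation by the convergents. -/
theorem one_div_convDen_mul {α : ℝ} (hα : Irrational α) (n : ℕ) :
    1 / |(convDen α n : ℝ) * (convDen α n * α - convNum α n)| =
      oneSidedHeight (partialQuot α) n := by
  set w := pre (partialQuot α) n with hw
  set x := Int.fract (completeQuot α n) with hx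
  have hx0 : 0 < x := fract_completeQuot_pos hα n
  have hx1 : x ≤ 1 := (Int.fract_lt_one _).le
  have hQ : (0 : ℝ) < convDen α n := by exact_mod_cast convDen_pos α n
  have hQ' : (contMat w 0 0 : ℝ) = convDen α n := rfl
  have hα' : α = ⌊α⌋ + cfApp w x := by
    have h := fract_eq_cfApp hα 0 n
    simp only [add_zero, completeQuot] at h
    rw [← h, Int.floor_add_fract]
  have hd := cfApp_sub_cfApp w hx0.le hx1 le_rfl zero_le_one
  rw [hQ', mul_zero, add_zero, sub_zero] at hd
  have hM : (0 : ℝ) ≤ contMat w 0 1 := Nat.cast_nonneg _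
  set Q : ℝ := (convDen α n : ℝ) with hQdef
  set N : ℝ := (contMat w 0 1 : ℝ) with hN
  have hden : 0 < Q + N * x := by positivity
  have e1 : Q * (Q * α - convNum α n) = Q ^ 2 * (cfApp w x - cfApp w 0) := by
    rw [convNum_eq, ← hQdef, ← hw]
    have h1 : α - ⌊α⌋ = cfApp w x := by linarith
    rw [← h1]
    ring
  have e2 : |Q ^ 2 * (cfApp w x - cfApp w 0)| = Q * x / (Q + N * x) := by
    rw [eq_div_iff hden.ne']
    have h1 := congrArg abs hd
    rw [abs_mul, abs_of_pos (mul_pos hden hQ), abs_mul, abs_pow, abs_neg, abs_one, one_pow, one_mul,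
      abs_of_pos hx0] at h1
    rw [abs_mul, abs_of_pos (by positivity : 0 < Q ^ 2)]
    linear_combination Q * h1
  -- Reversal transposes the matrix, so the quotient of consecutive denominators is the continued
  -- fraction read backwards.
  have e3 : cfApp w.reverse 0 = N / Q := by
    have h := cfApp_zero_mul w.reverse
    rw [continuant_reverse, contMat_reverse] at h
    rw [eq_div_iff hQ.ne']
    exact h
  have e4 : ((partialQuot α n : ℕ) : ℝ) + cfVal (fun i => partialQuot α (i + (n + 1))) = x⁻¹ := by
    rw [← fract_eq_cfVal hα, ← completeQuot_succ_eq hα]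
    rfl
  rw [e1, e2, oneSidedHeight, e4, ← hw, e3]
  field_simp

/-- Good rational approximations are multiples of convergents. -/
theorem exists_lt_oneSidedHeight {α : ℝ} (hα : Irrational α) {y : ℝ} (hy : 2 ≤ y) {p : ℤ} {q : ℕ}
    (hq : 0 < q) (h : y < 1 / |(q : ℝ) * (q * α - p)|) :
    ∃ n, y < oneSidedHeight (partialQuot α) n ∧
      (q : ℝ) < oneSidedHeight (partialQuot α) n * convDen α n := by
  have hq' : (0 : ℝ) < q := by exact_mod_cast hq
  have hpos : 0 < |(q : ℝ) * (q * α - p)| := by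
    by_contra! h0
    have h1 := le_antisymm h0 (abs_nonneg _)
    rw [h1, div_zero] at h
    linarith
  have hlt : |(q : ℝ) * (q * α - p)| * y < 1 := by
    rw [lt_div_iff₀ hpos] at h
    linarith
  set r : ℚ := (p : ℚ) / (q : ℤ) with hr
  have hr' : (r : ℝ) = p / q := by rw [hr]; push_cast; rfl
  have hden : (r.den : ℝ) ≤ q := by
    have h1 : (r.den : ℤ) ∣ (q : ℤ) := by
      rw [hr, ← Rat.divInt_eq_div]; exact Rat.den_dvd p q
    exact_mod_cast Int.le_of_dvd (by exact_mod_cast hq) h1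
  have hden0 : (0 : ℝ) < r.den := by exact_mod_cast r.den_pos
  -- Legendre's criterion for the reduced fraction; this is where y ≥ 2 enters.
  have hleg : |α - r| < 1 / (2 * (r.den : ℝ) ^ 2) := by
    have e : (q : ℝ) * (q * α - p) = q ^ 2 * (α - r) := by
      rw [hr']; field_simp
    rw [e, abs_mul, abs_of_pos (by positivity : (0 : ℝ) < q ^ 2)] at hlt
    rw [lt_div_iff₀ (by positivity)]
    have h1 : (r.den : ℝ) ^ 2 ≤ q ^ 2 := by gcongr
    calc |α - r| * (2 * (r.den : ℝ) ^ 2) ≤ |α - r| * (y * (q : ℝ) ^ 2) := by gcongr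
      _ = (q : ℝ) ^ 2 * |α - r| * y := by ring
      _ < 1 := hlt
  obtain ⟨n, hn⟩ := Real.exists_rat_eq_convergent hleg
  refine ⟨n, ?_⟩
  have hc := convergent_eq hα n
  rw [← hn, hr'] at hc
  have hQ : (0 : ℝ) < convDen α n := by exact_mod_cast convDen_pos α n
  have hcross : (p : ℝ) * convDen α n = q * convNum α n := by
    rw [← hc]; field_simp
  have hcrossZ : p * (convDen α n : ℤ) = q * convNum α n := by exact_mod_cast hcross
  obtain ⟨k, hk⟩ : (convDen α n : ℤ) ∣ q :=
    (isCoprime_convDen α n).dvd_of_dvd_mul_right (hcrossZ ▸ dvd_mul_left _ _)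
  have hk' : (q : ℝ) = convDen α n * k := by exact_mod_cast hk
  have hp : (p : ℝ) = convNum α n * k := by
    rw [hk'] at hcross
    apply mul_right_cancel₀ hQ.ne'
    rw [hcross]; ring
  have hk0 : 0 < (k : ℝ) := by
    rw [hk'] at hq'
    exact pos_of_mul_pos_right hq' hQ.le
  have hk1 : (1 : ℝ) ≤ k := by
    have : 0 < k := by exact_mod_cast hk0
    exact_mod_cast this
  have e : (q : ℝ) * (q * α - p) = k ^ 2 * (convDen α n * (convDen α n * α - convNum α n)) := by
    rw [hk', hp]; ring
  have hH := oneSidedHeight_pos (partialQuot α) n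
  have hv := one_div_convDen_mul hα n
  set H := oneSidedHeight (partialQuot α) n
  -- A k-fold multiple of a convergent has its quality divided by k². So y k² < H, which bounds both
  -- y and k by H.
  rw [e, abs_mul, abs_of_pos (by positivity : (0 : ℝ) < (k : ℝ) ^ 2), ← div_div, div_right_comm, hv,
    lt_div_iff₀ (by positivity)] at h
  have hkk : (k : ℝ) ≤ k ^ 2 := by nlinarith
  constructor
  · nlinarith
  · rw [hk', mul_comm]
    have : (k : ℝ) < H := by nlinarith
    gcongr

theorem eventually_oneSidedHeight_lt {α x : ℝ} (hα : Irrational α) (hx : bestConst α = x) {y : ℝ}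
    (hy : x < y) : ∀ᶠ n in atTop, oneSidedHeight (partialQuot α) n < y := by
  have h1 : bestConst α < (y : EReal) := by rw [hx]; exact_mod_cast hy
  have h2 := eventually_lt_of_limsup_lt h1
  have h3 : Tendsto (fun n => (convNum α n, convDen α n)) atTop (comap Prod.snd atTop) :=
    tendsto_comap_iff.2 (tendsto_convDen α)
  filter_upwards [h3.eventually h2] with n hn
  rw [← one_div_convDen_mul hα]
  exact_mod_cast hn

theorem frequently_lt_oneSidedHeight {α x : ℝ} (hα : Irrational α) (hx : bestConst α = x) {y : ℝ}
    (hy2 : 2 ≤ y) (hy : y < x) : ∃ᶠ n in atTop, y < oneSidedHeight (partialQuot α) n := by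
  rw [frequently_atTop]
  intro m
  have h1 : (y : EReal) < bestConst α := by rw [hx]; exact_mod_cast hy
  have h2 := frequently_lt_of_lt_limsup (by isBoundedDefault) h1
  -- Convergents of index below m account only for denominators q below this sum, so a larger q
  -- forces n ≥ m.
  obtain ⟨b, hb⟩ := exists_nat_gt
    (∑ n ∈ Finset.range m, oneSidedHeight (partialQuot α) n * convDen α n)
  have h3 : ∀ᶠ z : ℤ × ℕ in comap Prod.snd atTop, b + 1 ≤ z.2 :=
    tendsto_comap.eventually (eventually_ge_atTop (b + 1))
  obtain ⟨⟨p, q⟩, hpq, hbq⟩ := (h2.and_eventually h3).exists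
  simp only [EReal.coe_lt_coe_iff] at hpq hbq
  obtain ⟨n, hn, hnq⟩ := exists_lt_oneSidedHeight hα hy2 (by omega) hpq
  refine ⟨n, ?_, hn⟩
  by_contra! hnm
  have h4 := Finset.single_le_sum
    (f := fun n => oneSidedHeight (partialQuot α) n * (convDen α n : ℝ))
    (fun i _ => mul_nonneg (oneSidedHeight_pos _ i).le (Nat.cast_nonneg _))
    (Finset.mem_range.2 hnm)
  have h5 : (b : ℝ) + 1 ≤ q := by exact_mod_cast hbq
  linarith

/-- A weak form of Hurwitz's theorem, needed to exceed the threshold 2 of Legendre's criterion.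
Below 21/10 all late letters are at most 2; a 2 would give at least 2 + 1/5, and all ones give at
least 1 + 3/5 + 1/2. -/
theorem le_of_eventually_oneSidedHeight_lt {d : ℕ → ℕ+} {x : ℝ}
    (h : ∀ᶠ n in atTop, oneSidedHeight d n < x) : 21 / 10 ≤ x := by
  by_contra! hx
  obtain ⟨m, hm⟩ := eventually_atTop.1 h
  have hlow : ∀ n, ((d n : ℕ) : ℝ) + cfVal (fun i => d (i + (n + 1))) ≤ oneSidedHeight d n := by
    intro n
    rw [oneSidedHeight]
    linarith [(cfApp_mem (pre d n).reverse (x := 0) le_rfl zero_le_one).1]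
  have h2 : ∀ n, m ≤ n → (d n : ℕ) ≤ 2 := by
    intro n hn
    have h3 : ((d n : ℕ) : ℝ) < 3 := by
      linarith [hlow n, hm n hn, cfVal_nonneg (fun i => d (i + (n + 1)))]
    have : (d n : ℕ) < 3 := by exact_mod_cast h3
    omega
  have h1 : ∀ n, m ≤ n → (d n : ℕ) = 1 := by
    intro n hn
    by_contra hne
    have h3 : (2 : ℝ) ≤ ((d n : ℕ) : ℝ) := by
      have := (d n).pos
      exact_mod_cast (by omega : 2 ≤ (d n : ℕ))
    have h4 := inv_five_le_cfVal (fun i => d (i + (n + 1)))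
      (show ((d (0 + (n + 1)) : ℕ+) : ℕ) ≤ 4 by
        have := h2 (0 + (n + 1)) (by omega); omega)
    linarith [hlow n, hm n hn]
  have h3 := hm (m + 1) (by omega)
  have hrec : ∀ n, m ≤ n → cfVal (fun i => d (i + n)) = 1 / (1 + cfVal (fun i => d (i + (n + 1)))) := by
    intro n hn
    rw [cfVal_eq, zero_add, h1 n hn, Nat.cast_one]
    simp only [add_assoc, add_comm 1 n]
  rw [oneSidedHeight, pre_succ, List.reverse_append, List.reverse_singleton, List.singleton_append,
    cfApp, h1 m le_rfl, h1 (m + 1) (by omega), hrec (m + 1 + 1) (by omega),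
    hrec (m + 1 + 1 + 1) (by omega), hrec (m + 1 + 1 + 1 + 1) (by omega), Nat.cast_one] at h3
  have hz := cfApp_mem (pre d m).reverse (x := 0) le_rfl zero_le_one
  have hc0 := cfVal_nonneg (fun i => d (i + (m + 1 + 1 + 1 + 1 + 1)))
  have hc1 := cfVal_le_one (fun i => d (i + (m + 1 + 1 + 1 + 1 + 1)))
  generalize cfApp (pre d m).reverse 0 = z at *
  generalize cfVal (fun i => d (i + (m + 1 + 1 + 1 + 1 + 1))) = c at *
  have g1 : 1 / 2 ≤ 1 / (1 + z) := one_div_le_one_div_of_le (by linarith) (by linarith [hz.2])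
  have g2 : 1 / 2 ≤ 1 / (1 + c) := one_div_le_one_div_of_le (by linarith) (by linarith)
  have g3 : 1 / (1 + 1 / (1 + c)) ≤ 1 / (1 + 1 / 2) :=
    one_div_le_one_div_of_le (by norm_num) (by linarith)
  have g4 : 1 / (1 + 1 / (1 + 1 / 2)) ≤ 1 / (1 + 1 / (1 + 1 / (1 + c))) := by
    refine one_div_le_one_div_of_le ?_ (by linarith)
    have : 0 < 1 / (1 + 1 / (1 + c)) := by positivity
    linarith
  norm_num at g1 g4
  norm_num at h3
  linarith

/-! ### The Lagrange spectrum -/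

/-- The best constant is the upper limit of the heights at the partial quotients, hence one of their
cluster values, and a limit of shifts realizes it. -/
theorem exists_mem_sigmaLe_of_bestConst {α x : ℝ} (hα : Irrational α) (hx : bestConst α = x)
    (hx5 : x < 5) : ∃ θ ∈ sigmaLe x, heightAt θ 0 = x := by
  have hup : ∀ y, x < y → ∀ᶠ n in atTop, oneSidedHeight (partialQuot α) n < y :=
    fun y hy => eventually_oneSidedHeight_lt hα hx hy
  have hx2 : 2 < x := by
    have : 21 / 10 ≤ x := le_of_forall_gt_imp_ge_of_dense fun y hy =>
      le_of_eventually_oneSidedHeight_lt (hup y hy)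
    linarith
  refine exists_mem_sigmaLe_of_mapClusterPt hx5 hup (mapClusterPt_iff_frequently.2 fun s hs => ?_)
  obtain ⟨ε, hε, hball⟩ := Metric.mem_nhds_iff.1 hs
  have h1 := frequently_lt_oneSidedHeight hα hx (y := max 2 (x - ε)) (le_max_left _ _)
    (max_lt hx2 (by linarith))
  refine (h1.and_eventually (hup (x + ε) (by linarith))).mono fun n hn => hball ?_
  rw [Metric.mem_ball, Real.dist_eq, abs_lt]
  have := (le_max_right 2 (x - ε)).trans_lt hn.1
  constructor <;> linarith [hn.2]

theorem heightAt_neg (θ : ℤ → ℕ+) (n : ℤ) :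
    heightAt (fun k => θ (-k - 1)) n = heightAt θ (-n - 1) := by
  have e1 : (fun m : ℕ => θ (-(n + 1 + m) - 1)) = fun m : ℕ => θ (-n - 1 - 1 - m) := by
    funext m; congr 1; ring
  have e2 : (fun m : ℕ => θ (-(n - 1 - m) - 1)) = fun m : ℕ => θ (-n - 1 + 1 + m) := by
    funext m; congr 1; ring
  simp only [heightAt]
  rw [e1, e2]
  ring

/-- Each value below t is θ 0 plus two elements of K_t⁺: a shift provides the right half, and the
reflection k ↦ -k - 1, which preserves Σ_t, the left half. -/
theorem dimLagrange_eq_zero {t : ℝ} (ht : t < 5) (h : deltaPlus t ≤ 0) : dimLagrange t = 0 := by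
  refine dimH_sum_eq_zero h 5 ?_
  rintro x ⟨⟨α, hα, hx⟩, hxt⟩
  have hxt' : x < t := hxt
  obtain ⟨θ, hθ, rfl⟩ := exists_mem_sigmaLe_of_bestConst hα hx (hxt'.trans ht)
  have hθt : θ ∈ sigmaLe t := mem_sigmaLe.2 fun n => (mem_sigmaLe.1 hθ n).trans hxt'.le
  have h4 : (θ 0 : ℕ) ≤ 4 := le_four_of_mem_sigmaLe ht hθt 0
  refine ⟨θ 0, by omega, _, ⟨_, shift_mem_sigmaLe hθt 1, rfl⟩, _,
    ⟨fun k => θ (-k - 1), mem_sigmaLe.2 fun n => ?_, rfl⟩, ?_⟩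
  · rw [heightAt_neg]
    exact mem_sigmaLe.1 hθt _
  · rw [heightAt]
    have e1 : (fun m : ℕ => θ (0 + 1 + m)) = fun m : ℕ => θ ((m : ℤ) + 1) := by
      funext m; congr 1; ring
    have e2 : (fun m : ℕ => θ (0 - 1 - m)) = fun m : ℕ => θ (-(m : ℤ) - 1) := by
      funext m; congr 1; ring
    rw [e1, e2]

end

end GaussCantor


theorem mainTheorem3 (η t : ℝ) (hη : 0 < η) (ht3 : 3 ≤ t) (ht5 : t < 5)
    (hd : 0 < GaussCantor.dimLagrange t) :
    ∃ (δ : ℝ) (B : Finset (List ℕ+)), 0 < δ ∧ GaussCantor.IsAlphabet B ∧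
      (∀ θ ∈ GaussCantor.completeShift B, ∀ n : ℤ, θ n ∈ ({1, 2, 3, 4} : Set ℕ+)) ∧
      GaussCantor.completeShift B ⊆ GaussCantor.sigmaLe (t - δ) ∧
      ((1 - η : ℝ) : EReal) * GaussCantor.deltaPlus t ≤
        ((dimH (GaussCantor.gaussCantorSet B) : ENNReal) : EReal) := by
  have hpos : 0 < GaussCantor.deltaPlus t := by
    by_contra! h
    exact hd.ne' (GaussCantor.dimLagrange_eq_zero ht5 h)
  have hle : GaussCantor.deltaPlus t ≤ (2 : ℝ) :=
    GaussCantor.boxDim_le_two (GaussCantor.cfProj_subset _)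
  obtain ⟨D, hD⟩ : ∃ D : ℝ, GaussCantor.deltaPlus t = D :=
    ⟨_, (EReal.coe_toReal (ne_top_of_le_ne_top (EReal.coe_ne_top 2) hle)
      (ne_bot_of_gt hpos)).symm⟩
  have hD0 : 0 < D := by rw [hD] at hpos; exact_mod_cast hpos
  -- Replacing η by min η (1/2) only strengthens the claim and keeps 1 - η positive.
  obtain ⟨δ, B, hδ, hB, h4, hsub, hdim⟩ := GaussCantor.exists_alphabet_of_deltaPlus ht5 hD0 hD
    (lt_min hη (by norm_num : (0 : ℝ) < 1 / 2)) (min_le_right _ _)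
  refine ⟨δ, B, hδ, hB, fun θ hθ n => ?_, hsub, ?_⟩
  · have h1 : (θ n : ℕ) ≤ 4 := h4 θ hθ n
    have h2 := (θ n).pos
    simp only [Set.mem_insert_iff, Set.mem_singleton_iff, ← PNat.coe_inj]
    change (θ n : ℕ) = 1 ∨ (θ n : ℕ) = 2 ∨ (θ n : ℕ) = 3 ∨ (θ n : ℕ) = 4
    omega
  · have h1 : (1 - η) * D ≤ (1 - min η (1 / 2)) * D := by
      gcongr
      exact min_le_left _ _
    have h2 : 0 ≤ (1 - min η (1 / 2)) * D :=
      mul_nonneg (by linarith [min_le_right η (1 / 2)]) hD0.le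
    rw [hD, ← EReal.coe_mul]
    calc (((1 - η) * D : ℝ) : EReal) ≤ (((1 - min η (1 / 2)) * D : ℝ) : EReal) := by
          exact_mod_cast h1
      _ = ((ENNReal.ofReal ((1 - min η (1 / 2)) * D) : ENNReal) : EReal) := by
          rw [EReal.coe_ennreal_ofReal, max_eq_left h2]
      _ ≤ _ := EReal.coe_ennreal_le_coe_ennreal_iff.2 hdim
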